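/- Let $k$ be a field, $n\ge 0$, $R=k[[x_1,\dots,x_n]]$ with maximal ideal $\mathfrak m$, and let $w=\sum_{\underline i} r_{\underline i}\,x^{\underline i}\in\mathfrak m^2$, where $\underline i=(i_1,\dots,i_n)$ and $|\underline i|=i_1+\dots+i_n$. Choose $w_1,\dots,w_n\in R$ with $w=\sum_j x_jw_j$. Let $A$ be the $\mathbb Z/2$-graded algebra of all $R$-linear endomorphisms of the superalgebra $R\langle\theta_1,\dots,\theta_n\rangle$ (the exterior algebra of $R^n$), write $\theta_j\in A$ for left multiplication by $\theta_j$ and $\partial_j=\partial/\partial\theta_j$, and equip $A$ with the differential $d=[\delta,-]$ (supercommutator), $\delta=\sum_j(x_j\partial_j+w_j\theta_j)$. A contracting homotopy of $A$ is an odd $k$-linear map $h:A\to A$ such that $p=\mathrm{id}-(dh+hd)$ is idempotent and its image is a subcomplex with zero differential, so that $p$ identifies $\operatorname{H}^*(A)$ with $\operatorname{im}p$. The operations $m_N$ induced by $h$ on $\operatorname{H}^*(A)$ are those given by the sum over planar binary rooted trees with $N$ leaves (multiplication at the vertices, $h$ on the internal edges, $p$ at the root, with the standard signs), and $m_1=0$.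 Then there is a contracting homotopy of $A$ such that the induced operations form a minimal ($m_1=0$) $A_\infty$-structure on $\operatorname{H}^*(A)$ with the following properties, where $\overline{\partial_j}\in\operatorname{H}^*(A)$ is the class of a cocycle of the form $\partial_j-\sum_l f_{jl}\theta_l$ with $f_{jl}\in R$ (such cocycles exist). 1. The underlying associative algebra $(\operatorname{H}^*(A),m_2)$ is given by the Clifford algebra of the quadratic part $q=\sum_{a\le b}r_{ab}x_ax_b$ of $w$ (here $r_{ab}$ is the coefficient of $x_ax_b$): there is an isomorphism of superalgebras from $\operatorname{Cl}(q)$ (with $v^2=q(v)$ for $v\in k^n$) to $(\operatorname{H}^*(A),m_2)^{\mathrm{op}}$, the product of the opposite superalgebra being $(u,v)\mapsto(-1)^{|u||v|}m_2(v,u)$, that sends the $j$-th standard basis vector to $\overline{\partial_j}$. 2. For every multi-index $\underline i$ with $|\underline i|\ge 2$ that is not the exponent of a monomial $x_ax_b$ with $a\ne b$ (for these, $m_2(\overline{\partial_a},\overline{\partial_b})$ is described by 1), $$m_{|\underline i|}(\underbrace{\overline{\partial_1},\dots,\overline{\partial_1}}_{i_1},\dots,\underbrace{\overline{\partial_n},\dots,\overline{\partial_n}}_{i_n})=\pm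 r_{\underline i}\cdot 1.$$ 3. If $n=1$ (write $x,\theta,\partial$ for $x_1,\theta_1,\partial_1$), the homotopy can moreover be taken to be $h(a\,\omega)=\frac{a-a(0)}{x}\,\theta\omega$ for $a\in k[[x]]$ and $\omega\in k\langle\theta,\partial\rangle$, and the $A_\infty$-structure is strictly unital. In particular, by 2, $m_i(\overline\partial,\dots,\overline\partial)=\pm r_i$ for all $i\ge2$. -/

import Mathlib

noncomputable section

namespace MFKoszul

/-! ### `ℤ/2`-graded `A_∞`-algebras and homotopy transfer along trees -/

section General

variable {k : Type*} [Field k]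

/-- An `A_∞`-algebra structure on a `ℤ/2`-graded vector space `V` with homogeneous parts `𝒱 0`
and `𝒱 1`: operations `m N` of degree `2 - N` (`N ≥ 1`) such that, for all `N ≥ 1`,
`∑_{r+s+t=N, s ≥ 1} (-1)^(r+st) m_{r+1+t} (1^{⊗r} ⊗ m_s ⊗ 1^{⊗t}) = 0`, where the Koszul rule
is used in evaluating on homogeneous elements. The inputs are the entries `a 0, …, a (N-1)` of a
sequence `a`. The value `m 0` is not part of the data and is set to `0`. -/
structure AInfinityStructure {V : Type*} [AddCommGroup V] [Module k V]
    (𝒱 : ZMod 2 → Submodule k V) where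
  m : (N : ℕ) → MultilinearMap k (fun _ : Fin N => V) V
  m_zero : m 0 = 0
  m_degree : ∀ (N : ℕ) (a : Fin N → V) (e : Fin N → ZMod 2), (∀ j, a j ∈ 𝒱 (e j)) →
    m N a ∈ 𝒱 ((∑ j, e j) + (N : ZMod 2))
  stasheff : ∀ (N : ℕ), 1 ≤ N → ∀ (a : ℕ → V) (e : ℕ → ZMod 2), (∀ j, a j ∈ 𝒱 (e j)) →
    ∑ r ∈ Finset.range N, ∑ s ∈ Finset.Icc 1 (N - r),
      (-1 : k) ^ (r + s * (N - r - s) + s * ∑ j ∈ Finset.range r, (e j).val) •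
        m (r + 1 + (N - r - s)) (fun j =>
          if (j : ℕ) < r then a j
          else if (j : ℕ) = r then m s (fun i => a (r + i))
          else a (j + s - 1)) = 0

/-- Strict unitality with unit `u`. -/
def AInfinityStructure.IsStrictlyUnital {V : Type*} [AddCommGroup V] [Module k V]
    {𝒱 : ZMod 2 → Submodule k V} (M : AInfinityStructure 𝒱) (u : V) : Prop :=
  M.m 1 ![u] = 0 ∧ (∀ v, M.m 2 ![u, v] = v) ∧ (∀ v, M.m 2 ![v, u] = v) ∧
    ∀ (N : ℕ), 3 ≤ N → ∀ (a : Fin N → V) (j : Fin N), a j = u → M.m N a = 0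

variable {A : Type*} [Ring A] [Algebra k A]

/-- The cohomology of `(A, d)`. -/
abbrev Cohomology (d : A →ₗ[k] A) : Type _ :=
  LinearMap.ker d ⧸ (LinearMap.range d).comap (LinearMap.ker d).subtype

/-- The class of a cocycle. -/
def cohClass (d : A →ₗ[k] A) : LinearMap.ker d →ₗ[k] Cohomology d :=
  ((LinearMap.range d).comap (LinearMap.ker d).subtype).mkQ

/-- The classes of homogeneous cocycles. -/
def cohGrading (𝒜 : ZMod 2 → Submodule k A) (d : A →ₗ[k] A) (s : ZMod 2) :
    Submodule k (Cohomology d) :=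
  ((𝒜 s).comap (LinearMap.ker d).subtype).map (cohClass d)

/-- A homotopy `h` contracting `(A, d)` onto its cohomology: an odd `k`-linear map such that
`p = id - (d h + h d)` is an idempotent and its image is a subcomplex with zero differential
(which thus represents the cohomology). -/
structure ContractingHomotopy (𝒜 : ZMod 2 → Submodule k A) (d : A →ₗ[k] A) where
  h : A →ₗ[k] A
  h_odd : ∀ s, ∀ a ∈ 𝒜 s, h a ∈ 𝒜 (s + 1)
  idem : (LinearMap.id - (d ∘ₗ h + h ∘ₗ d)) ∘ₗ (LinearMap.id - (d ∘ₗ h + h ∘ₗ d)) =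
    LinearMap.id - (d ∘ₗ h + h ∘ₗ d)
  d_proj : d ∘ₗ (LinearMap.id - (d ∘ₗ h + h ∘ₗ d)) = 0
  proj_d : (LinearMap.id - (d ∘ₗ h + h ∘ₗ d)) ∘ₗ d = 0

/-- The value on a sequence of inputs of a planar binary tree with inputs at its leaves, in the
bar (suspended) picture: each vertex is the operation `q₂(a, b) = σ(a) b`, with `σ` the parity
automorphism, followed by `-h` on the edge that leaves the vertex. All these composites have degree
`0` on the suspension, so that no further signs occur. -/
def treeValue (σ h : A →ₗ[k] A) : BinaryTree Unit → (ℕ → A) → A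
  | .nil, a => a 0
  | .node _ l r, a =>
      -h (σ (treeValue σ h l a) * treeValue σ h r (fun j => a (j + l.numLeaves)))

/-- The same with no `h` at the root vertex; the tree without vertices contributes `0`. -/
def treeRootValue (σ h : A →ₗ[k] A) : BinaryTree Unit → (ℕ → A) → A
  | .nil, _ => 0
  | .node _ l r, a =>
      σ (treeValue σ h l a) * treeValue σ h r (fun j => a (j + l.numLeaves))

namespace ContractingHomotopy

variable {𝒜 : ZMod 2 → Submodule k A} {d : A →ₗ[k] A} (H : ContractingHomotopy 𝒜 d)

/-- The projection `p = id - (d h + h d)`. -/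
def proj : A →ₗ[k] A := LinearMap.id - (d ∘ₗ H.h + H.h ∘ₗ d)

/-- The inclusion of the cohomology, identified with the image of `p`:
the class of a cocycle `z` is sent to its representative `p z`. -/
def incl : Cohomology d →ₗ[k] A :=
  Submodule.liftQ _ (H.proj ∘ₗ (LinearMap.ker d).subtype) (by
    rintro ⟨_, _⟩ ⟨y, rfl⟩
    exact LinearMap.congr_fun H.proj_d y)

/-- The projection onto the cohomology: `a` is sent to the class of the cocycle `p a`. -/
def toCohomology : A →ₗ[k] Cohomology d :=
  cohClass d ∘ₗ H.proj.codRestrict (LinearMap.ker d)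
    (fun a => LinearMap.congr_fun H.d_proj a)

/-- The operations induced on the cohomology of `A` by the tree formula: the sum over all planar
binary trees with `N` leaves. On homogeneous elements the passage from the suspension to
the operation `m_N` is the sign `(-1)^(∑_j (N - j) |c_j|)`, where `j = 1, …, N`; this sign is the
action of `σ^(N - j)` on the `j`-th input. The operation for `N = 1` is the differential induced on
the cohomology, that is, `0`. -/
def transfer (σ : A →ₗ[k] A) (N : ℕ) (c : Fin N → Cohomology d) : Cohomology d :=
  H.toCohomology (∑ T ∈ BinaryTree.treesOfNumNodesEq (N - 1),
    treeRootValue σ H.h T (fun j =>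
      if hj : j < N then (σ ^ (N - 1 - j)) (H.incl (c ⟨j, hj⟩)) else 0))

end ContractingHomotopy

end General

/-! ### The endomorphism dg algebra of the stabilized residue field -/

section Koszul

variable (k : Type*) [Field k] (n : ℕ)

/-- `R = k[[x_1, …, x_n]]`. -/
abbrev R : Type _ := MvPowerSeries (Fin n) k

/-- The superalgebra `R⟨θ_1, …, θ_n⟩`, that is, the exterior algebra of `Rⁿ`. -/
abbrev Lam : Type _ := ExteriorAlgebra (R k n) (Fin n → R k n)

/-- The underlying algebra of `A`: the `R`-linear endomorphisms of `R⟨θ_1, …, θ_n⟩`. -/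
abbrev Alg : Type _ := Module.End (R k n) (Lam k n)

variable {k n}

/-- Left multiplication by `θ_i`. -/
def theta (i : Fin n) : Alg k n :=
  LinearMap.mulLeft (R k n) (ExteriorAlgebra.ι (R k n) (Pi.single i (1 : R k n)))

/-- The odd derivation `∂_i = ∂/∂θ_i`. -/
def del (i : Fin n) : Alg k n :=
  CliffordAlgebra.contractLeft (LinearMap.proj i : (Fin n → R k n) →ₗ[R k n] R k n)

/-- The odd operator `δ = ∑_i (x_i ∂_i + w_i θ_i)`. -/
def delta (w' : Fin n → R k n) : Alg k n :=
  ∑ i, ((MvPowerSeries.X i : R k n) • del i + w' i • theta i)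

/-- The `ℤ/2`-grading of `A` by parity of endomorphisms. -/
def parity (s : ZMod 2) : Submodule k (Alg k n) where
  carrier := {f | ∀ t : ZMod 2,
    ∀ v ∈ CliffordAlgebra.evenOdd (0 : QuadraticForm (R k n) (Fin n → R k n)) t,
      f v ∈ CliffordAlgebra.evenOdd (0 : QuadraticForm (R k n) (Fin n → R k n)) (t + s)}
  add_mem' := fun hf hg t v hv => Submodule.add_mem _ (hf t v hv) (hg t v hv)
  zero_mem' := fun _ _ _ => Submodule.zero_mem _
  smul_mem' := fun c f hf t v hv => by
    have h := Submodule.smul_mem _ (algebraMap k (R k n) c) (hf t v hv)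
    rwa [algebraMap_smul] at h

/-- The parity automorphism of `A`, `f ↦ (-1)^{|f|} f` on homogeneous `f`: conjugation with the
parity involution of `R⟨θ_1, …, θ_n⟩`. -/
def sgn : Alg k n →ₗ[k] Alg k n :=
  LinearMap.mulLeft k (CliffordAlgebra.involute.toLinearMap : Alg k n) ∘ₗ
    LinearMap.mulRight k (CliffordAlgebra.involute.toLinearMap : Alg k n)

/-- The differential `[δ, -]` of `A`: `f ↦ δ f - (-1)^{|f|} f δ`. -/
def diff (w' : Fin n → R k n) : Alg k n →ₗ[k] Alg k n :=
  LinearMap.mulLeft k (delta w') - LinearMap.mulRight k (delta w') ∘ₗ sgn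

/-- The quadratic form on `kⁿ` given by the quadratic part
`∑_{i ≤ j} r_{ij} x_i x_j` of `w`. -/
def quadraticPart (w : R k n) : QuadraticForm k (Fin n → k) :=
  Matrix.toQuadraticForm' (Matrix.of fun i j : Fin n =>
    if i ≤ j then MvPowerSeries.coeff (Finsupp.single i 1 + Finsupp.single j 1) w else 0)

/-- The list `1, …, 1, 2, …, 2, …, n, …, n` in which `j` occurs `i_j` times. -/
def blocks (i : Fin n →₀ ℕ) : List (Fin n) :=
  (List.finRange n).flatMap fun j => List.replicate (i j) j

end Koszul

end MFKoszul

end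

/-!
Write `w_i = ∑_j f_{ij} x_j`. The elements `D_i = ∂_i - ∑_j f_{ij} θ_j` are cocycles,
`d θ_i = x_i`, and `A` is free over `R` with basis the ordered monomials `θ_I D_J`. As a complex,
`A` is therefore the Koszul complex of `x_1, …, x_n` tensored with the span of the `D_J`, on which
the differential vanishes; this situation is axiomatized in `IsKoszulDGA`. The Koszul complex is
contracted by eliminating one variable after the other,
`h (a θ_I D_J) = ∑_{j > max I} (divX j a) θ_j θ_I D_J`, where `divX j a` sets `x_l = 0` for
`l > j`, removes the terms without `x_j` and divides by `x_j`. The projection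
`p = id - (d h + h d)` sets all `x_j` and `θ_j` to zero, and the side conditions `h h = 0`,
`h p = 0`, `p h = 0` hold, which gives strict unitality.

That the tree formula yields an `A_∞`-algebra holds for every contracting homotopy. In the
suspended picture, where vertices are the operation `σ(a) b` and all signs are absorbed, the sums
`treeSum` and `treeRootSum` satisfy a recursion by splitting a tree at its root, and
`differential_treeRootSum` computes the differential of a tree sum by induction: the terms in
which three subtrees are bracketed in two ways cancel, and `d h = id - p - h d` produces the
insertions of induced operations.

The choice of `f` matters. By exactness of the Koszul complex in degree one
(`exists_coefficients`) it can be made such that `f_{ii} = divX i (divX i w)` and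
`f_{ij} + f_{ji} = divX i (divX j w)` for `i < j`, whatever the `w_i` are. Since
`D_i D_j + D_j D_i = -(f_{ij} + f_{ji})` and `D_i² = -f_{ii}`, this has two consequences. Modulo
the maximal ideal the relations are those of the Clifford algebra of the quadratic part of `w`,
with the sign of the opposite superalgebra. So right multiplication makes the cohomology a module
over the Clifford algebra, generated by the class of `1`, and a comparison of dimensions
identifies the two (`ofClifford_bijective`, `ofClifford_mul_of_mem`). For a sorted word
`D_{c_1} ⋯ D_{c_N}`, on the other hand, only the right comb among all trees contributes: the first
product gives `divX c_{N-1} (divX c_N w)`, each further letter `c` turns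
`h (a · 1) = ∑_j (divX j a) θ_j` into `divX c a`, and all other trees produce multiples
`a θ_I D_J` with `I` non-empty in which `a` involves no variable after the last `θ_j`, and these
are killed by `h` and `p` (`treeRootSum_word`). Dividing by all the letters in this way leaves the
coefficient of the corresponding monomial of `w`.
-/

noncomputable section

namespace MFKoszul

open Finset.HasAntidiagonal (antidiagonal mem_antidiagonal)

/-! ### Sums over planar binary trees -/

section Transfer

lemma update_shift_of_le {A : Type*} (a : ℕ → A) {i j : ℕ} (hij : i ≤ j) (x : A) :
    (fun l => Function.update a j x (l + i)) =
      Function.update (fun l => a (l + i)) (j - i) x := by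
  funext l
  by_cases hl : l = j - i
  · subst hl; simp [Nat.sub_add_cancel hij]
  · rw [Function.update_of_ne hl, Function.update_of_ne (by omega)]

lemma update_shift_of_lt {A : Type*} (a : ℕ → A) {i j : ℕ} (hij : j < i) (x : A) :
    (fun l => Function.update a j x (l + i)) = (fun l => a (l + i)) := by
  funext l
  rw [Function.update_of_ne (by omega)]

variable {k : Type*} [Field k] {A : Type*} [Ring A] [Algebra k A]

/-- The sum of the values of all planar binary trees with `N` leaves, with `-h` on the root edge of
every tree that has a vertex; there is no tree without leaves. -/
def treeSum (σ h : A →ₗ[k] A) (N : ℕ) (a : ℕ → A) : A :=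
  if N = 0 then 0 else ∑ T ∈ BinaryTree.treesOfNumNodesEq (N - 1), treeValue σ h T a

/-- The sum of the values of all planar binary trees with `N` leaves and at least one vertex, with
no `h` on the root edge. -/
def treeRootSum (σ h : A →ₗ[k] A) (N : ℕ) (a : ℕ → A) : A :=
  ∑ T ∈ BinaryTree.treesOfNumNodesEq (N - 1), treeRootValue σ h T a

variable (σ h : A →ₗ[k] A)

@[simp] lemma treeSum_zero (a : ℕ → A) : treeSum σ h 0 a = 0 := by simp [treeSum]

@[simp] lemma treeSum_one (a : ℕ → A) : treeSum σ h 1 a = a 0 := by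
  simp [treeSum, treeValue]

/-- A tree with a vertex is determined by its left and right subtrees. -/
lemma sum_trees_succ {B : Type*} [AddCommMonoid B] (N : ℕ) (F : BinaryTree Unit → B) :
    ∑ T ∈ BinaryTree.treesOfNumNodesEq (N + 1), F T =
      ∑ ij ∈ antidiagonal N, ∑ l ∈ BinaryTree.treesOfNumNodesEq ij.1,
        ∑ r ∈ BinaryTree.treesOfNumNodesEq ij.2, F (.node () l r) := by
  rw [BinaryTree.treesOfNumNodesEq_succ, Finset.sum_biUnion]
  · refine Finset.sum_congr rfl fun ij _ => ?_
    rw [BinaryTree.pairwiseNode, Finset.sum_map, Finset.sum_product]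
    rfl
  · rintro ⟨i, j⟩ - ⟨i', j'⟩ - hne
    rw [Function.onFun, Finset.disjoint_left]
    intro T hT hT'
    simp only [BinaryTree.pairwiseNode, Finset.mem_map, Finset.mem_product, Prod.exists,
      BinaryTree.mem_treesOfNumNodesEq] at hT hT'
    obtain ⟨l, r, ⟨rfl, rfl⟩, rfl⟩ := hT
    obtain ⟨l', r', ⟨rfl, rfl⟩, h⟩ := hT'
    have h' : BinaryTree.node () l' r' = .node () l r := h
    cases h'
    exact hne rfl

lemma treeRootSum_eq (N : ℕ) (a : ℕ → A) :
    treeRootSum σ h N a = ∑ ij ∈ antidiagonal N,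
      σ (treeSum σ h ij.1 a) * treeSum σ h ij.2 (fun j => a (j + ij.1)) := by
  match N with
  | 0 => simp [treeRootSum, treeRootValue]
  | 1 => simp [treeRootSum, treeRootValue, Finset.Nat.antidiagonal_succ]
  | N + 2 =>
    rw [treeRootSum, show N + 2 - 1 = N + 1 from rfl, sum_trees_succ,
      Finset.Nat.antidiagonal_succ_succ']
    simp only [Finset.sum_cons, treeSum_zero, map_zero, zero_mul, mul_zero, zero_add, add_zero,
      Finset.sum_map]
    refine Finset.sum_congr rfl fun ij _ => ?_
    have h1 : ∀ l ∈ BinaryTree.treesOfNumNodesEq ij.1, l.numLeaves = ij.1 + 1 := by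
      intro l hl
      rw [BinaryTree.numLeaves_eq_numNodes_succ, BinaryTree.mem_treesOfNumNodesEq.1 hl]
    simp only [treeSum, Function.Embedding.prodMap, Function.Embedding.coeFn_mk, Prod.map,
      Nat.succ_ne_zero, if_false, Nat.succ_eq_add_one, Nat.add_sub_cancel, map_sum,
      Finset.sum_mul_sum, treeRootValue]
    refine Finset.sum_congr rfl fun l hl => Finset.sum_congr rfl fun r _ => ?_
    rw [h1 l hl]

lemma treeSum_eq {N : ℕ} (hN : N ≠ 1) (a : ℕ → A) :
    treeSum σ h N a = -h (treeRootSum σ h N a) := by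
  match N with
  | 0 => simp [treeRootSum, treeRootValue]
  | 1 => exact absurd rfl hN
  | N + 2 =>
    rw [treeRootSum, treeSum, show N + 2 - 1 = N + 1 from rfl, sum_trees_succ, sum_trees_succ]
    simp only [map_sum, treeRootValue, treeValue, ← Finset.sum_neg_distrib]
    rfl

@[simp] lemma treeRootSum_zero (a : ℕ → A) : treeRootSum σ h 0 a = 0 := by
  simp [treeRootSum, treeRootValue]

@[simp] lemma treeRootSum_one (a : ℕ → A) : treeRootSum σ h 1 a = 0 := by
  simp [treeRootSum, treeRootValue]

/-- A tree sum depends only on the inputs at the leaves. -/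
lemma treeSum_congr (N : ℕ) {a b : ℕ → A} (hab : ∀ j < N, a j = b j) :
    treeSum σ h N a = treeSum σ h N b := by
  induction N using Nat.strong_induction_on generalizing a b with
  | _ N ih =>
    by_cases hN : N = 1
    · subst hN; simp [hab]
    rw [treeSum_eq σ h hN, treeSum_eq σ h hN, treeRootSum_eq, treeRootSum_eq]
    congr 2
    refine Finset.sum_congr rfl fun ij hij => ?_
    rw [mem_antidiagonal] at hij
    rcases Nat.eq_zero_or_pos ij.1 with h0 | h0
    · simp [h0]
    rcases Nat.eq_zero_or_pos ij.2 with h0' | h0'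
    · simp [h0']
    rw [ih ij.1 (by omega) (fun j hj => hab j (by omega)),
      ih ij.2 (by omega) (fun j hj => hab (j + ij.1) (by omega))]

lemma treeRootSum_congr (N : ℕ) {a b : ℕ → A} (hab : ∀ j < N, a j = b j) :
    treeRootSum σ h N a = treeRootSum σ h N b := by
  rw [treeRootSum_eq, treeRootSum_eq]
  refine Finset.sum_congr rfl fun ij hij => ?_
  rw [mem_antidiagonal] at hij
  rw [treeSum_congr σ h ij.1 (fun j hj => hab j (by omega)),
      treeSum_congr σ h ij.2 (fun j hj => hab (j + ij.1) (by omega))]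

lemma treeSum_update_of_le (N j : ℕ) (hj : N ≤ j) (a : ℕ → A) (x : A) :
    treeSum σ h N (Function.update a j x) = treeSum σ h N a :=
  treeSum_congr σ h N fun l hl => Function.update_of_ne (by omega) _ _

/-- The tree sums are linear in each input. -/
lemma treeSum_update (N j : ℕ) (hj : j < N) (a : ℕ → A) (c : k) (x y : A) :
    treeSum σ h N (Function.update a j (c • x + y)) =
      c • treeSum σ h N (Function.update a j x) + treeSum σ h N (Function.update a j y) := by
  induction N using Nat.strong_induction_on generalizing j a with
  | _ N ih =>
    by_cases hN : N = 1
    · subst hN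
      obtain rfl : j = 0 := by omega
      simp
    suffices h1 : treeRootSum σ h N (Function.update a j (c • x + y)) =
        c • treeRootSum σ h N (Function.update a j x) +
          treeRootSum σ h N (Function.update a j y) by
      simp only [treeSum_eq σ h hN, h1, map_add, map_smul, neg_add, smul_neg]
    simp only [treeRootSum_eq, Finset.smul_sum, ← Finset.sum_add_distrib]
    refine Finset.sum_congr rfl fun ij hij => ?_
    rw [mem_antidiagonal] at hij
    rcases Nat.eq_zero_or_pos ij.1 with h0 | h0
    · simp [h0]
    rcases Nat.eq_zero_or_pos ij.2 with h0' | h0'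
    · simp [h0']
    by_cases hl : j < ij.1
    · simp only [update_shift_of_lt a hl]
      rw [ih ij.1 (by omega) j hl]
      simp [add_mul]
    · push Not at hl
      simp only [update_shift_of_le a hl, treeSum_update_of_le σ h ij.1 j hl]
      rw [ih ij.2 (by omega) (j - ij.1) (by omega)]
      simp [mul_add]

lemma treeRootSum_update (N j : ℕ) (hj : j < N) (a : ℕ → A) (c : k) (x y : A) :
    treeRootSum σ h N (Function.update a j (c • x + y)) =
      c • treeRootSum σ h N (Function.update a j x) +
        treeRootSum σ h N (Function.update a j y) := by
  simp only [treeRootSum_eq, Finset.smul_sum, ← Finset.sum_add_distrib]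
  refine Finset.sum_congr rfl fun ij hij => ?_
  rw [mem_antidiagonal] at hij
  by_cases hl : j < ij.1
  · simp only [update_shift_of_lt a hl]
    rw [treeSum_update σ h _ _ hl]
    simp [add_mul]
  · push Not at hl
    simp only [update_shift_of_le a hl, treeSum_update_of_le σ h ij.1 j hl]
    rw [treeSum_update σ h _ _ (by omega)]
    simp [mul_add]

end Transfer

/-! ### The `A_∞`-relations for tree sums -/

section Relations

variable {k : Type*} [Field k] {A : Type*} [Ring A] [Algebra k A]

/-- The sequence `τ a₀, …, τ a_{r-1}, y, a_{r+s}, a_{r+s+1}, …`, where `τ = -σ` is the parity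
automorphism of the suspension. -/
def insertAt (σ : A →ₗ[k] A) (r s : ℕ) (y : A) (a : ℕ → A) : ℕ → A := fun j =>
  if j < r then -σ (a j) else if j = r then y else a (j + s - 1)

/-- The sum of all ways of evaluating `F` after having applied an operation `B s` to `s` consecutive
entries among the first `N` entries of `a`. -/
def insertionSum (σ : A →ₗ[k] A) (B F : ℕ → (ℕ → A) → A) (N : ℕ) (a : ℕ → A) : A :=
  ∑ r ∈ Finset.range N, ∑ s ∈ Finset.Icc 1 (N - r),
    F (r + 1 + (N - r - s)) (insertAt σ r s (B s fun j => a (r + j)) a)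

variable (σ h : A →ₗ[k] A)

/-- Applying `B` to inputs of a tree with a vertex means applying it to inputs of the left or of the
right subtree; in the second case the parity automorphism moves past the left subtree. -/
lemma insertionSum_treeRootSum (B : ℕ → (ℕ → A) → A) (N : ℕ) (a : ℕ → A) :
    insertionSum σ B (treeRootSum σ h) N a = ∑ ij ∈ antidiagonal N,
      (σ (insertionSum σ B (treeSum σ h) ij.1 a) * treeSum σ h ij.2 (fun j => a (j + ij.1)) +
        σ (treeSum σ h ij.1 (fun j => -σ (a j))) *
          insertionSum σ B (treeSum σ h) ij.2 (fun j => a (j + ij.1))) := by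
  rw [Finset.sum_add_distrib]
  simp only [insertionSum, treeRootSum_eq, map_sum, Finset.sum_mul, Finset.mul_sum]
  simp only [Finset.sum_sigma']
  rw [← Finset.sum_filter_add_sum_filter_not _ (fun x => x.1 < x.2.2.1)]
  congr 1
  -- insertions into the left subtree
  · refine Finset.sum_bij' (fun x _ => ⟨(x.2.2.1 + x.2.1 - 1, x.2.2.2), ⟨x.1, x.2.1⟩⟩)
      (fun x _ => ⟨x.2.1, ⟨x.2.2, (x.2.1 + 1 + (x.1.1 - x.2.1 - x.2.2), x.1.2)⟩⟩) ?_ ?_ ?_ ?_ ?_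
    · rintro ⟨r, s, p, q⟩ hx
      simp only [Finset.mem_filter, Finset.mem_sigma, Finset.mem_range, Finset.mem_Icc,
        mem_antidiagonal] at hx ⊢
      omega
    · rintro ⟨⟨i, j⟩, r, s⟩ hx
      simp only [Finset.mem_filter, Finset.mem_sigma, Finset.mem_range, Finset.mem_Icc,
        mem_antidiagonal] at hx ⊢
      omega
    · rintro ⟨r, s, p, q⟩ hx
      simp only [Finset.mem_filter, Finset.mem_sigma, Finset.mem_range, Finset.mem_Icc,
        mem_antidiagonal] at hx
      have : r + 1 + (p + s - 1 - r - s) = p := by omega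
      simp only [this]
    · rintro ⟨⟨i, j⟩, r, s⟩ hx
      simp only [Finset.mem_sigma, Finset.mem_range, Finset.mem_Icc,
        mem_antidiagonal] at hx
      have : r + 1 + (i - r - s) + s - 1 = i := by omega
      simp only [this]
    · rintro ⟨r, s, p, q⟩ hx
      simp only [Finset.mem_filter, Finset.mem_sigma, Finset.mem_range, Finset.mem_Icc,
        mem_antidiagonal] at hx
      have h1 : r + 1 + (p + s - 1 - r - s) = p := by omega
      simp only [h1]
      congr 1
      refine treeSum_congr σ h q fun j _ => ?_
      rw [insertAt, if_neg (by omega), if_neg (by omega)]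
      congr 1
      omega
  -- insertions into the right subtree
  · refine Finset.sum_bij' (fun x _ => ⟨(x.2.2.1, x.2.2.2 + x.2.1 - 1), ⟨x.1 - x.2.2.1, x.2.1⟩⟩)
      (fun x _ => ⟨x.2.1 + x.1.1, ⟨x.2.2,
        (x.1.1, x.2.1 + 1 + (x.1.2 - x.2.1 - x.2.2))⟩⟩) ?_ ?_ ?_ ?_ ?_
    · rintro ⟨r, s, p, q⟩ hx
      simp only [Finset.mem_filter, Finset.mem_sigma, Finset.mem_range, Finset.mem_Icc,
        mem_antidiagonal] at hx ⊢
      omega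
    · rintro ⟨⟨i, j⟩, r, s⟩ hx
      simp only [Finset.mem_filter, Finset.mem_sigma, Finset.mem_range, Finset.mem_Icc,
        mem_antidiagonal] at hx ⊢
      omega
    · rintro ⟨r, s, p, q⟩ hx
      simp only [Finset.mem_filter, Finset.mem_sigma, Finset.mem_range, Finset.mem_Icc,
        mem_antidiagonal] at hx
      have h1 : r - p + 1 + (q + s - 1 - (r - p) - s) = q := by omega
      have h2 : r - p + p = r := by omega
      simp only [h1, h2]
    · rintro ⟨⟨i, j⟩, r, s⟩ hx
      simp only [Finset.mem_sigma, Finset.mem_range, Finset.mem_Icc,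
        mem_antidiagonal] at hx
      have h1 : r + 1 + (j - r - s) + s - 1 = j := by omega
      have h2 : r + i - i = r := by omega
      simp only [h1, h2]
    · rintro ⟨r, s, p, q⟩ hx
      simp only [Finset.mem_filter, Finset.mem_sigma, Finset.mem_range, Finset.mem_Icc,
        mem_antidiagonal] at hx
      have h1 : r - p + 1 + (q + s - 1 - (r - p) - s) = q := by omega
      have h2 : ∀ j, r - p + j + p = r + j := by omega
      simp only [h1, h2]
      congr 1
      · congr 1
        refine treeSum_congr σ h p fun j _ => ?_
        rw [insertAt, if_pos (by omega)]
      · refine treeSum_congr σ h q fun j _ => ?_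
        simp only [insertAt]
        by_cases hj : j + p < r
        · rw [if_pos hj, if_pos (by omega)]
        · have hj1 : ¬j < r - p := by omega
          rw [if_neg hj, if_neg hj1]
          by_cases hj' : j + p = r
          · rw [if_pos hj', if_pos (by omega)]
          · have hj1' : ¬j = r - p := by omega
            rw [if_neg hj', if_neg hj1']
            congr 1
            omega

variable {σ h} {d p : A →ₗ[k] A}

/-- The parity automorphism of the suspension commutes with tree sums. -/
lemma treeSum_neg_parity (hσm : ∀ x y, σ (x * y) = σ x * σ y) (hσh : ∀ x, σ (h x) = -h (σ x))
    (N : ℕ) (a : ℕ → A) :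
    treeSum σ h N (fun j => -σ (a j)) = -σ (treeSum σ h N a) := by
  induction N using Nat.strong_induction_on generalizing a with
  | _ N ih =>
    by_cases hN : N = 1
    · subst hN; simp
    simp only [treeSum_eq σ h hN, treeRootSum_eq, map_neg, hσh, map_sum, neg_neg,
      ← Finset.sum_neg_distrib]
    refine Finset.sum_congr rfl fun ij hij => ?_
    rw [mem_antidiagonal] at hij
    rcases Nat.eq_zero_or_pos ij.1 with h0 | h0
    · simp [h0]
    rcases Nat.eq_zero_or_pos ij.2 with h0' | h0'
    · simp [h0']
    rw [ih ij.1 (by omega), ih ij.2 (by omega) (fun j => a (j + ij.1)), hσm]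
    simp

/-- The two ways of bracketing three subtrees cancel in the suspension. -/
lemma sum_treeRootSum_mul_treeSum (hσm : ∀ x y, σ (x * y) = σ x * σ y) (hσσ : ∀ x, σ (σ x) = x)
    (N : ℕ) (a : ℕ → A) :
    ∑ ij ∈ antidiagonal N, σ (treeRootSum σ h ij.1 a) * treeSum σ h ij.2 (fun j => a (j + ij.1)) =
      ∑ ij ∈ antidiagonal N,
        treeSum σ h ij.1 a * treeRootSum σ h ij.2 (fun j => a (j + ij.1)) := by
  simp only [treeRootSum_eq, map_sum, Finset.sum_mul, Finset.mul_sum, hσm, hσσ]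
  simp only [Finset.sum_sigma']
  refine Finset.sum_bij' (fun x _ => ⟨(x.2.1, x.2.2 + x.1.2), (x.2.2, x.1.2)⟩)
      (fun x _ => ⟨(x.1.1 + x.2.1, x.2.2), (x.1.1, x.2.1)⟩) ?_ ?_ ?_ ?_ ?_
  · rintro ⟨⟨i, j⟩, p, q⟩ hx
    simp only [Finset.mem_sigma, mem_antidiagonal, and_true] at hx ⊢
    omega
  · rintro ⟨⟨i, j⟩, p, q⟩ hx
    simp only [Finset.mem_sigma, mem_antidiagonal, and_true] at hx ⊢
    omega
  · rintro ⟨⟨i, j⟩, p, q⟩ hx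
    simp only [Finset.mem_sigma, mem_antidiagonal] at hx
    simp only [hx.2]
  · rintro ⟨⟨i, j⟩, p, q⟩ hx
    simp only [Finset.mem_sigma, mem_antidiagonal] at hx
    simp only [hx.2]
  · rintro ⟨⟨i, j⟩, p, q⟩ hx
    simp only [Finset.mem_sigma, mem_antidiagonal] at hx
    simp only [← hx.2, mul_assoc]
    congr 3
    funext l
    congr 1
    omega

/-- Splitting off the term in which the operation is applied to all inputs. -/
lemma insertionSum_treeSum (B : ℕ → (ℕ → A) → A) {N : ℕ} (hN : N ≠ 0) (a : ℕ → A) :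
    insertionSum σ B (treeSum σ h) N a =
      B N a - h (insertionSum σ B (treeRootSum σ h) N a) := by
  have key : ∀ r ∈ Finset.range N, ∀ s ∈ Finset.Icc 1 (N - r),
      treeSum σ h (r + 1 + (N - r - s)) (insertAt σ r s (B s fun j => a (r + j)) a) =
        (if r = 0 then if s = N then B N a else 0 else 0) -
        h (treeRootSum σ h (r + 1 + (N - r - s)) (insertAt σ r s (B s fun j => a (r + j)) a)) := by
    intro r hr s hs
    rw [Finset.mem_range] at hr
    rw [Finset.mem_Icc] at hs
    by_cases hrs : r = 0 ∧ s = N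
    · obtain ⟨rfl, rfl⟩ := hrs
      simp [insertAt]
    · rw [treeSum_eq σ h (by omega)]
      have : (if r = 0 then if s = N then B N a else 0 else 0) = 0 := by
        split_ifs <;> first | rfl | (exfalso; omega)
      rw [this, zero_sub]
  simp only [insertionSum]
  rw [Finset.sum_congr rfl fun r hr => Finset.sum_congr rfl (key r hr)]
  simp only [Finset.sum_sub_distrib, map_sum]
  congr 1
  rw [Finset.sum_eq_single_of_mem 0 (Finset.mem_range.2 (by omega))]
  · rw [Finset.sum_eq_single_of_mem N (Finset.mem_Icc.2 (by omega))]
    · simp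
    · intro s _ hs
      simp [hs]
  · intro r _ hr
    simp [hr]

/-- The tree sums form a morphism of `A_∞`-algebras, in the suspended picture: if all inputs are
cocycles, then the differential of a tree sum is the sum of the terms in which an induced operation
`p (treeRootSum …)` is applied first, minus the product of two tree sums. -/
lemma differential_treeRootSum (hσm : ∀ x y, σ (x * y) = σ x * σ y) (hσσ : ∀ x, σ (σ x) = x)
    (hσh : ∀ x, σ (h x) = -h (σ x)) (hdσ : ∀ x, d (σ x) = -σ (d x))
    (hdm : ∀ x y, d (x * y) = d x * y + σ x * d y) (hp : ∀ x, p x = x - (d (h x) + h (d x)))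
    (N : ℕ) (a : ℕ → A) (ha : ∀ j, d (a j) = 0) :
    d (treeRootSum σ h N a) =
      -insertionSum σ (fun s b => p (treeRootSum σ h s b)) (treeRootSum σ h) N a := by
  have key : ∀ N, ∀ a : ℕ → A, (∀ j, d (a j) = 0) →
      d (treeSum σ h N a) = insertionSum σ (fun s b => p (treeRootSum σ h s b)) (treeSum σ h) N a -
        treeRootSum σ h N a ∧
      d (treeRootSum σ h N a) =
        -insertionSum σ (fun s b => p (treeRootSum σ h s b)) (treeRootSum σ h) N a := by
    intro N
    induction N using Nat.strong_induction_on with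
    | _ N ih =>
      intro a ha
      have h2 : d (treeRootSum σ h N a) =
          -insertionSum σ (fun s b => p (treeRootSum σ h s b)) (treeRootSum σ h) N a := by
        have h3 : d (treeRootSum σ h N a) = ∑ ij ∈ antidiagonal N,
            (σ (treeRootSum σ h ij.1 a) * treeSum σ h ij.2 (fun j => a (j + ij.1)) -
              treeSum σ h ij.1 a * treeRootSum σ h ij.2 (fun j => a (j + ij.1)) -
            (σ (insertionSum σ (fun s b => p (treeRootSum σ h s b)) (treeSum σ h) ij.1 a) *
                treeSum σ h ij.2 (fun j => a (j + ij.1)) +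
              σ (treeSum σ h ij.1 (fun j => -σ (a j))) *
                insertionSum σ (fun s b => p (treeRootSum σ h s b)) (treeSum σ h) ij.2
                  (fun j => a (j + ij.1)))) := by
          rw [treeRootSum_eq, map_sum]
          refine Finset.sum_congr rfl fun ij hij => ?_
          rw [mem_antidiagonal] at hij
          rcases Nat.eq_zero_or_pos ij.1 with h0 | h0
          · simp [h0, insertionSum]
          rcases Nat.eq_zero_or_pos ij.2 with h0' | h0'
          · simp [h0', insertionSum]
          rw [hdm, hdσ, (ih ij.1 (by omega) a ha).1,
            (ih ij.2 (by omega) (fun j => a (j + ij.1)) (fun j => ha _)).1,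
            treeSum_neg_parity hσm hσh, map_neg, hσσ, map_sub]
          noncomm_ring
        rw [h3, Finset.sum_sub_distrib, Finset.sum_sub_distrib,
          sum_treeRootSum_mul_treeSum hσm hσσ, sub_self, zero_sub, insertionSum_treeRootSum]
      refine ⟨?_, h2⟩
      by_cases hN : N = 1
      · subst hN
        simp [ha, insertionSum, insertAt]
      rcases Nat.eq_zero_or_pos N with h0 | h0
      · subst h0; simp [insertionSum]
      rw [insertionSum_treeSum _ (by omega), hp, h2, treeSum_eq σ h hN]
      simp only [map_neg]
      abel
  exact (key N a ha).2

end Relations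

/-! ### Homotopy transfer for differential graded superalgebras -/

section Structure

variable {k : Type*} [Field k] {A : Type*} [Ring A] [Algebra k A]

/-- `A` with the homogeneous parts `𝒜`, the parity automorphism `σ` and the odd derivation `d` is a
differential `ℤ/2`-graded algebra. (The condition `d² = 0` is not needed here; it follows from the
existence of a contracting homotopy.) -/
structure IsSuperDGA (𝒜 : ZMod 2 → Submodule k A) (σ d : A →ₗ[k] A) : Prop where
  mul_mem : ∀ {s t a b}, a ∈ 𝒜 s → b ∈ 𝒜 t → a * b ∈ 𝒜 (s + t)
  exists_add : ∀ a, ∃ a₀ ∈ 𝒜 0, ∃ a₁ ∈ 𝒜 1, a = a₀ + a₁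
  parity_apply : ∀ {s a}, a ∈ 𝒜 s → σ a = (-1 : k) ^ s.val • a
  parity_mul : ∀ x y, σ (x * y) = σ x * σ y
  parity_parity : ∀ x, σ (σ x) = x
  d_mem : ∀ {s a}, a ∈ 𝒜 s → d a ∈ 𝒜 (s + 1)
  leibniz : ∀ x y, d (x * y) = d x * y + σ x * d y

namespace IsSuperDGA

variable {𝒜 : ZMod 2 → Submodule k A} {σ d : A →ₗ[k] A} (hA : IsSuperDGA 𝒜 σ d)
include hA

/-- Odd maps anticommute with the parity automorphism. -/
lemma parity_odd {f : A →ₗ[k] A} (hf : ∀ s, ∀ a ∈ 𝒜 s, f a ∈ 𝒜 (s + 1)) (x : A) :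
    σ (f x) = -f (σ x) := by
  obtain ⟨a, ha, b, hb, rfl⟩ := hA.exists_add x
  rw [map_add, map_add, map_add, map_add, hA.parity_apply ha, hA.parity_apply hb,
    hA.parity_apply (hf _ _ ha), hA.parity_apply (hf _ _ hb)]
  have h2 : ((1 : ZMod 2) + 1).val = 0 := rfl
  have h3 : (0 : ZMod 2).val = 0 := rfl
  have h4 : (1 : ZMod 2).val = 1 := rfl
  simp [h2, h3, h4, add_comm]

lemma parity_d (x : A) : d (σ x) = -σ (d x) := by
  rw [hA.parity_odd (fun _ _ h => hA.d_mem h), neg_neg]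

lemma parity_mem {s : ZMod 2} {a : A} (ha : a ∈ 𝒜 s) : σ a ∈ 𝒜 s := by
  rw [hA.parity_apply ha]
  exact Submodule.smul_mem _ _ ha

lemma parity_pow_mem {s : ZMod 2} {a : A} (ha : a ∈ 𝒜 s) (m : ℕ) : (σ ^ m) a ∈ 𝒜 s := by
  induction m with
  | zero => exact ha
  | succ m ih => rw [pow_succ', Module.End.mul_apply]; exact hA.parity_mem ih

lemma parity_pow_apply {s : ZMod 2} {a : A} (ha : a ∈ 𝒜 s) (m : ℕ) :
    (σ ^ m) a = (-1 : k) ^ (m * s.val) • a := by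
  induction m with
  | zero => simp
  | succ m ih =>
    rw [pow_succ', Module.End.mul_apply, ih, map_smul, hA.parity_apply ha, smul_smul, ← pow_add]
    congr 2
    ring

end IsSuperDGA

/-- The tree sums rescale when the inputs are rescaled. -/
lemma treeSum_smul (σ h : A →ₗ[k] A) (N : ℕ) (c : ℕ → k) (a : ℕ → A) :
    treeSum σ h N (fun j => c j • a j) = (∏ j ∈ Finset.range N, c j) • treeSum σ h N a ∧
    treeRootSum σ h N (fun j => c j • a j) =
      (∏ j ∈ Finset.range N, c j) • treeRootSum σ h N a := by
  induction N using Nat.strong_induction_on generalizing c a with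
  | _ N ih =>
    have h1 : treeRootSum σ h N (fun j => c j • a j) =
        (∏ j ∈ Finset.range N, c j) • treeRootSum σ h N a := by
      rw [treeRootSum_eq, treeRootSum_eq, Finset.smul_sum]
      refine Finset.sum_congr rfl fun ij hij => ?_
      rw [mem_antidiagonal] at hij
      rcases Nat.eq_zero_or_pos ij.1 with h0 | h0
      · simp [h0]
      rcases Nat.eq_zero_or_pos ij.2 with h0' | h0'
      · simp [h0']
      rw [(ih ij.1 (by omega) c a).1,
        (ih ij.2 (by omega) (fun j => c (j + ij.1)) (fun j => a (j + ij.1))).1, ← hij,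
        Finset.prod_range_add, map_smul, smul_mul_smul_comm]
      simp only [add_comm]
    refine ⟨?_, h1⟩
    by_cases hN : N = 1
    · subst hN; simp
    rw [treeSum_eq σ h hN, treeSum_eq σ h hN, h1, map_smul, smul_neg]

section Homogeneous

variable {𝒜 : ZMod 2 → Submodule k A} {σ d : A →ₗ[k] A}

lemma treeSum_mem (hA : IsSuperDGA 𝒜 σ d) {h : A →ₗ[k] A}
    (hh : ∀ s, ∀ a ∈ 𝒜 s, h a ∈ 𝒜 (s + 1)) (N : ℕ) (a : ℕ → A) (e : ℕ → ZMod 2)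
    (ha : ∀ j < N, a j ∈ 𝒜 (e j)) :
    treeSum σ h N a ∈ 𝒜 (∑ j ∈ Finset.range N, e j + (N : ZMod 2) + 1) ∧
      treeRootSum σ h N a ∈ 𝒜 (∑ j ∈ Finset.range N, e j + (N : ZMod 2)) := by
  have two : (1 : ZMod 2) + 1 = 0 := rfl
  induction N using Nat.strong_induction_on generalizing a e with
  | _ N ih =>
    have h1 : treeRootSum σ h N a ∈ 𝒜 (∑ j ∈ Finset.range N, e j + (N : ZMod 2)) := by
      rw [treeRootSum_eq]
      refine Submodule.sum_mem _ fun ij hij => ?_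
      rw [mem_antidiagonal] at hij
      rcases Nat.eq_zero_or_pos ij.1 with h0 | h0
      · simp [h0]
      rcases Nat.eq_zero_or_pos ij.2 with h0' | h0'
      · simp [h0']
      have h2 := hA.mul_mem
        (hA.parity_mem (ih ij.1 (by omega) a e (fun j hj => ha j (by omega))).1)
        (ih ij.2 (by omega) (fun j => a (j + ij.1)) (fun j => e (j + ij.1))
          (fun j hj => ha _ (by omega))).1
      convert h2 using 2
      rw [← hij, Finset.sum_range_add]
      simp only [add_comm ij.1]
      push_cast
      linear_combination -two
    refine ⟨?_, h1⟩
    by_cases hN : N = 1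
    · subst hN
      simpa [add_assoc, two] using ha 0 (by omega)
    rw [treeSum_eq σ h hN]
    exact Submodule.neg_mem _ (hh _ _ h1)

end Homogeneous

namespace ContractingHomotopy

variable {𝒜 : ZMod 2 → Submodule k A} {d : A →ₗ[k] A} (H : ContractingHomotopy 𝒜 d)

lemma proj_apply (x : A) : H.proj x = x - (d (H.h x) + H.h (d x)) := rfl

lemma proj_proj (x : A) : H.proj (H.proj x) = H.proj x := LinearMap.congr_fun H.idem x

lemma d_proj_apply (x : A) : d (H.proj x) = 0 := LinearMap.congr_fun H.d_proj x

lemma proj_d_apply (x : A) : H.proj (d x) = 0 := LinearMap.congr_fun H.proj_d x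

lemma incl_cohClass (z : LinearMap.ker d) : H.incl (cohClass d z) = H.proj z := rfl

lemma cohClass_eq_zero {z : LinearMap.ker d} (y : A) (hy : (z : A) = d y) :
    cohClass d z = 0 := by
  rw [cohClass, Submodule.mkQ_apply, Submodule.Quotient.mk_eq_zero]
  exact ⟨y, hy.symm⟩

lemma cohClass_eq {z z' : LinearMap.ker d} (y : A) (hy : (z : A) = z' + d y) :
    cohClass d z = cohClass d z' := by
  rw [← sub_eq_zero, ← map_sub]
  exact cohClass_eq_zero y (by simp [hy])

lemma toCohomology_apply (x : A) :
    H.toCohomology x = cohClass d ⟨H.proj x, H.d_proj_apply x⟩ := rfl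

lemma toCohomology_coe (z : LinearMap.ker d) : H.toCohomology z = cohClass d z := by
  rw [toCohomology_apply]
  refine cohClass_eq (-H.h z) ?_
  have hz : d (z : A) = 0 := z.2
  simp [proj_apply, hz, sub_eq_add_neg]

lemma toCohomology_d (x : A) : H.toCohomology (d x) = 0 := by
  rw [toCohomology_apply]
  exact cohClass_eq_zero 0 (by simp [proj_d_apply])

lemma incl_toCohomology (x : A) : H.incl (H.toCohomology x) = H.proj x := by
  rw [toCohomology_apply, incl_cohClass, proj_proj]

lemma toCohomology_incl (c : Cohomology d) : H.toCohomology (H.incl c) = c := by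
  obtain ⟨z, rfl⟩ := Submodule.mkQ_surjective _ c
  change H.toCohomology (H.proj z) = cohClass d z
  rw [← H.toCohomology_coe, toCohomology_apply, toCohomology_apply]
  simp only [proj_proj]

lemma d_incl (c : Cohomology d) : d (H.incl c) = 0 := by
  obtain ⟨z, rfl⟩ := Submodule.mkQ_surjective _ c
  exact H.d_proj_apply z

lemma proj_incl (c : Cohomology d) : H.proj (H.incl c) = H.incl c := by
  obtain ⟨z, rfl⟩ := Submodule.mkQ_surjective _ c
  exact H.proj_proj z

lemma incl_injective : Function.Injective H.incl :=
  Function.LeftInverse.injective H.toCohomology_incl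

variable {σ : A →ₗ[k] A} (hA : IsSuperDGA 𝒜 σ d)
include hA

lemma proj_mem {s : ZMod 2} {a : A} (ha : a ∈ 𝒜 s) : H.proj a ∈ 𝒜 s := by
  have two : (1 : ZMod 2) + 1 = 0 := rfl
  have h1 := hA.d_mem (H.h_odd _ _ ha)
  have h2 := H.h_odd _ _ (hA.d_mem ha)
  rw [add_assoc, two, add_zero] at h1 h2
  exact Submodule.sub_mem _ ha (Submodule.add_mem _ h1 h2)

lemma incl_mem {s : ZMod 2} {c : Cohomology d} (hc : c ∈ cohGrading 𝒜 d s) :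
    H.incl c ∈ 𝒜 s := by
  obtain ⟨z, hz, rfl⟩ := hc
  exact H.proj_mem hA hz

lemma toCohomology_mem {s : ZMod 2} {a : A} (ha : a ∈ 𝒜 s) :
    H.toCohomology a ∈ cohGrading 𝒜 d s :=
  ⟨⟨H.proj a, H.d_proj_apply a⟩, H.proj_mem hA ha, rfl⟩

lemma parity_proj (x : A) : σ (H.proj x) = H.proj (σ x) := by
  rw [proj_apply, proj_apply, map_sub, map_add, hA.parity_d, map_neg, hA.parity_odd H.h_odd,
    hA.parity_odd (fun _ _ h => hA.d_mem h), hA.parity_odd H.h_odd, map_neg, neg_neg]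

lemma parity_pow_proj (t : ℕ) (x : A) : (σ ^ t) (H.proj x) = H.proj ((σ ^ t) x) := by
  induction t with
  | zero => rfl
  | succ t ih => rw [pow_succ', Module.End.mul_apply, ih, H.parity_proj hA, Module.End.mul_apply]

/-- The parity automorphism and the products of tree sums: the sign is that of the suspension. -/
lemma parity_pow_treeRootSum (t N : ℕ) (a : ℕ → A) :
    (σ ^ t) (treeRootSum σ H.h N a) =
      (-1 : k) ^ (N * t) • treeRootSum σ H.h N (fun j => (σ ^ t) (a j)) := by
  have key : ∀ a : ℕ → A, σ (treeRootSum σ H.h N a) =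
      (-1 : k) ^ N • treeRootSum σ H.h N (fun j => σ (a j)) := by
    intro a
    have h1 := (treeSum_smul σ H.h N (fun _ => (-1 : k)) (fun j => σ (a j))).2
    rw [Finset.prod_const, Finset.card_range] at h1
    rw [← h1, treeRootSum_eq, treeRootSum_eq, map_sum]
    refine Finset.sum_congr rfl fun ij _ => ?_
    simp only [neg_smul, one_smul]
    rw [treeSum_neg_parity hA.parity_mul (hA.parity_odd H.h_odd),
      treeSum_neg_parity hA.parity_mul (hA.parity_odd H.h_odd) _ (fun j => a (j + ij.1)),
      hA.parity_mul]
    simp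
  induction t generalizing a with
  | zero => simp
  | succ t ih =>
    rw [pow_succ, Module.End.mul_apply, key, map_smul, ih, smul_smul, ← pow_add, mul_add, mul_one,
      add_comm]
    simp only [Module.End.mul_apply]

omit hA in
lemma transfer_eq (N : ℕ) (c : Fin N → Cohomology d) :
    H.transfer σ N c = H.toCohomology (treeRootSum σ H.h N (fun j =>
      if hj : j < N then (σ ^ (N - 1 - j)) (H.incl (c ⟨j, hj⟩)) else 0)) := rfl

omit hA in
/-- The same formula for a sequence of inputs. -/
lemma transfer_seq (N : ℕ) (c : ℕ → Cohomology d) :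
    H.transfer σ N (fun j => c j) =
      H.toCohomology (treeRootSum σ H.h N (fun j => (σ ^ (N - 1 - j)) (H.incl (c j)))) := by
  rw [transfer_eq, treeRootSum_congr]
  intro j hj
  rw [dif_pos hj]

/-- Each term of the `A_∞`-relation is, up to its sign, a term of the relation between tree sums. -/
lemma stasheff_term {N r s : ℕ} (hr : r < N) (hs : 1 ≤ s) (hrs : s ≤ N - r)
    (a : ℕ → Cohomology d) (e : ℕ → ZMod 2) (ha : ∀ j, a j ∈ cohGrading 𝒜 d (e j)) :
    (-1 : k) ^ (r + s * (N - r - s) + s * ∑ j ∈ Finset.range r, (e j).val) •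
      H.transfer σ (r + 1 + (N - r - s)) (fun j =>
          if (j : ℕ) < r then a j
          else if (j : ℕ) = r then H.transfer σ s (fun i => a (r + i))
          else a (j + s - 1)) =
      H.toCohomology (treeRootSum σ H.h (r + 1 + (N - r - s))
        (insertAt σ r s (H.proj (treeRootSum σ H.h s
          (fun j => (σ ^ (N - 1 - (r + j))) (H.incl (a (r + j))))))
            (fun j => (σ ^ (N - 1 - j)) (H.incl (a j))))) := by
  obtain ⟨t, ht⟩ : ∃ t, N - r - s = t := ⟨_, rfl⟩
  rw [ht]
  rw [H.transfer_seq (r + 1 + t) (fun j => if j < r then a j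
          else if j = r then H.transfer σ s (fun i => a (r + i))
          else a (j + s - 1)), ← map_smul]
  congr 1
  set c : ℕ → k := fun j =>
    if j < r then (-1) ^ (1 + s * (e j).val) else if j = r then (-1) ^ (s * t) else 1 with hc
  have hprod : ∏ j ∈ Finset.range (r + 1 + t), c j =
      (-1 : k) ^ (r + s * t + s * ∑ j ∈ Finset.range r, (e j).val) := by
    rw [Finset.prod_range_add, Finset.prod_range_succ,
      Finset.prod_congr rfl (g := fun j => (-1 : k) ^ (1 + s * (e j).val))
        (fun j hj => by simp only [hc]; rw [if_pos (Finset.mem_range.1 hj)]),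
      Finset.prod_eq_one (s := Finset.range t)
        (fun j _ => by simp only [hc]; rw [if_neg (by omega), if_neg (by omega)]),
      Finset.prod_pow_eq_pow_sum, Finset.sum_add_distrib, ← Finset.mul_sum]
    simp only [hc, lt_irrefl, if_false, if_true, mul_one, Finset.sum_const, Finset.card_range,
      smul_eq_mul, ← pow_add]
    congr 1
    ring
  rw [← hprod, ← (treeSum_smul σ H.h (r + 1 + t) c _).2]
  refine treeRootSum_congr _ _ _ fun j hj => ?_
  simp only [hc, insertAt]
  by_cases h1 : j < r
  · simp only [if_pos h1]
    have h5 : σ ((σ ^ (N - 1 - j)) (H.incl (a j))) =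
        (σ ^ s) ((σ ^ (r + 1 + t - 1 - j)) (H.incl (a j))) := by
      rw [← Module.End.mul_apply, ← Module.End.mul_apply, ← pow_succ', ← pow_add]
      congr 2
      omega
    rw [h5, hA.parity_pow_apply (hA.parity_pow_mem (H.incl_mem hA (ha j)) _) s, pow_add]
    simp
  · by_cases h2 : j = r
    · subst h2
      simp only [lt_irrefl, if_false, if_true]
      rw [H.transfer_seq s (fun i => a (j + i)), incl_toCohomology,
        show j + 1 + t - 1 - j = t by omega]
      rw [H.parity_pow_proj hA, H.parity_pow_treeRootSum hA, map_smul, smul_smul, ← mul_pow,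
        neg_mul_neg, one_mul, one_pow, one_smul]
      congr 1
      refine treeRootSum_congr _ _ _ fun i hi => ?_
      rw [← Module.End.mul_apply, ← pow_add]
      congr 2
      omega
    · simp only [if_neg h1, if_neg h2, one_smul]
      congr 2
      omega

/-- The tree formula turns a contracting homotopy into an `A_∞`-structure on the cohomology. -/
def aInfinity : AInfinityStructure (cohGrading 𝒜 d) where
  m N :=
    { toFun := H.transfer σ N
      map_update_add' := by
        intro _ c j x y
        have key : ∀ z, (fun i => if hi : i < N then
            (σ ^ (N - 1 - i)) (H.incl (Function.update c j z ⟨i, hi⟩)) else 0) =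
            Function.update (fun i => if hi : i < N then
              (σ ^ (N - 1 - i)) (H.incl (c ⟨i, hi⟩)) else 0) j
              ((σ ^ (N - 1 - (j : ℕ))) (H.incl z)) := by
          intro z
          funext i
          by_cases hij : i = j
          · subst hij; simp
          · rw [Function.update_of_ne hij]
            by_cases hi : i < N
            · rw [dif_pos hi, dif_pos hi, Function.update_of_ne (by rintro rfl; exact hij rfl)]
            · rw [dif_neg hi, dif_neg hi]
        simp only [transfer_eq, key, map_add]
        have := treeRootSum_update σ H.h N j j.2 (fun i => if hi : i < N then
              (σ ^ (N - 1 - i)) (H.incl (c ⟨i, hi⟩)) else 0) (1 : k)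
              ((σ ^ (N - 1 - (j : ℕ))) (H.incl x)) ((σ ^ (N - 1 - (j : ℕ))) (H.incl y))
        simp only [one_smul] at this
        rw [this, map_add]
      map_update_smul' := by
        intro _ c j b x
        have key : ∀ z, (fun i => if hi : i < N then
            (σ ^ (N - 1 - i)) (H.incl (Function.update c j z ⟨i, hi⟩)) else 0) =
            Function.update (fun i => if hi : i < N then
              (σ ^ (N - 1 - i)) (H.incl (c ⟨i, hi⟩)) else 0) j
              ((σ ^ (N - 1 - (j : ℕ))) (H.incl z)) := by
          intro z
          funext i
          by_cases hij : i = j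
          · subst hij; simp
          · rw [Function.update_of_ne hij]
            by_cases hi : i < N
            · rw [dif_pos hi, dif_pos hi, Function.update_of_ne (by rintro rfl; exact hij rfl)]
            · rw [dif_neg hi, dif_neg hi]
        simp only [transfer_eq, key, map_smul]
        have h0 := treeRootSum_update σ H.h N j j.2 (fun i => if hi : i < N then
              (σ ^ (N - 1 - i)) (H.incl (c ⟨i, hi⟩)) else 0) (1 : k) 0 0
        have := treeRootSum_update σ H.h N j j.2 (fun i => if hi : i < N then
              (σ ^ (N - 1 - i)) (H.incl (c ⟨i, hi⟩)) else 0) b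
              ((σ ^ (N - 1 - (j : ℕ))) (H.incl x)) 0
        simp only [one_smul, add_zero, left_eq_add] at h0 this
        rw [this, h0, add_zero, map_smul] }
  m_zero := by
    ext c
    change H.transfer σ 0 c = 0
    rw [transfer_eq, treeRootSum_zero, map_zero]
  m_degree := by
    intro N a e ha
    change H.transfer σ N a ∈ _
    rw [transfer_eq]
    refine H.toCohomology_mem hA ?_
    have := (treeSum_mem hA H.h_odd N (fun j =>
      if hj : j < N then (σ ^ (N - 1 - j)) (H.incl (a ⟨j, hj⟩)) else 0)
      (fun j => if hj : j < N then e ⟨j, hj⟩ else 0) ?_).2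
    · rw [Finset.sum_range] at this
      simpa using this
    · intro j hj
      simp only [dif_pos hj]
      exact hA.parity_pow_mem (H.incl_mem hA (ha _)) _
  stasheff := by
    intro N hN a e ha
    have key := differential_treeRootSum (p := H.proj) (σ := σ) (h := H.h) (d := d)
      hA.parity_mul hA.parity_parity
      (hA.parity_odd H.h_odd) hA.parity_d hA.leibniz (fun _ => rfl) N
      (fun j => (σ ^ (N - 1 - j)) (H.incl (a j))) (fun j => by
        rw [hA.parity_pow_apply (H.incl_mem hA (ha j)), map_smul, d_incl, smul_zero])
    have key2 := H.toCohomology_d (treeRootSum σ H.h N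
      (fun j => (σ ^ (N - 1 - j)) (H.incl (a j))))
    rw [key, map_neg, neg_eq_zero, insertionSum, map_sum] at key2
    rw [← key2]
    refine Finset.sum_congr rfl fun r hr => ?_
    rw [map_sum]
    refine Finset.sum_congr rfl fun s hs => ?_
    rw [Finset.mem_range] at hr
    rw [Finset.mem_Icc] at hs
    exact H.stasheff_term hA hr hs.1 hs.2 a e ha

omit hA in
lemma transfer_one (c : Fin 1 → Cohomology d) : H.transfer σ 1 c = 0 := by
  rw [transfer_eq, treeRootSum_one, map_zero]

lemma transfer_two (x y : Cohomology d) :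
    H.transfer σ 2 ![x, y] = H.toCohomology (H.incl x * H.incl y) := by
  rw [transfer_eq, treeRootSum_eq]
  simp [Finset.Nat.antidiagonal_succ, hA.parity_parity]

/-- The operation `m₂` is induced by the product of `A`. -/
lemma transfer_two_cohClass (x y z : LinearMap.ker d) (hz : (z : A) = x * y) :
    H.transfer σ 2 ![cohClass d x, cohClass d y] = cohClass d z := by
  rw [H.transfer_two hA, incl_cohClass, incl_cohClass, ← H.toCohomology_coe z, hz]
  have hx : d (x : A) = 0 := x.2
  have hy : d (y : A) = 0 := y.2
  have h1 : (x : A) * y = H.proj x * H.proj y + d (σ (H.proj x) * H.h y + H.h x * y) := by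
    rw [map_add, hA.leibniz, hA.leibniz, hA.parity_d, d_proj_apply, hA.parity_parity, hy]
    simp only [proj_apply, hx, hy, map_zero]
    noncomm_ring
  rw [h1, map_add, toCohomology_d, add_zero]

/-- If a contracting homotopy satisfies the side conditions, then trees with at least three leaves,
one of which carries the unit, contribute nothing. -/
lemma treeRootSum_unit_input (hhh : ∀ x, H.h (H.h x) = 0) (hph : ∀ x, H.proj (H.h x) = 0)
    (hσ1 : σ 1 = 1) (N : ℕ) (a : ℕ → A) (ha : ∀ j, H.h (a j) = 0) (j : ℕ) (hj : j < N)
    (haj : a j = 1) :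
    (2 ≤ N → treeSum σ H.h N a = 0) ∧ (3 ≤ N → H.proj (treeRootSum σ H.h N a) = 0) := by
  have hh : ∀ N, ∀ b : ℕ → A, (∀ j, H.h (b j) = 0) → H.h (treeSum σ H.h N b) = 0 := by
    intro N b hb
    by_cases hN : N = 1
    · subst hN; simpa using hb 0
    · rw [treeSum_eq σ _ hN, map_neg, hhh, neg_zero]
  have hp : ∀ N, ∀ b : ℕ → A, N ≠ 1 → H.proj (treeSum σ H.h N b) = 0 := by
    intro N b hN
    rw [treeSum_eq σ _ hN, map_neg, hph, neg_zero]
  have key : ∀ N, ∀ a : ℕ → A, (∀ j, H.h (a j) = 0) → ∀ j < N, a j = 1 →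
      (2 ≤ N → treeSum σ H.h N a = 0) := by
    intro N
    induction N using Nat.strong_induction_on with
    | _ N ih =>
      intro a ha j hj haj hN
      rw [treeSum_eq σ _ (by omega), treeRootSum_eq, map_sum, neg_eq_zero]
      refine Finset.sum_eq_zero fun ij hij => ?_
      rw [mem_antidiagonal] at hij
      rcases Nat.eq_zero_or_pos ij.1 with h0 | h0
      · simp [h0]
      rcases Nat.eq_zero_or_pos ij.2 with h0' | h0'
      · simp [h0']
      by_cases hl : j < ij.1
      · by_cases hi : ij.1 = 1
        · obtain rfl : j = 0 := by omega
          rw [hi, treeSum_one, haj, hσ1, one_mul]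
          exact hh _ _ fun _ => ha _
        · rw [ih ij.1 (by omega) a ha j hl haj (by omega)]
          simp
      · by_cases hi : ij.2 = 1
        · obtain rfl : j = ij.1 := by omega
          rw [hi, treeSum_one, zero_add, haj, mul_one, ← neg_eq_zero, ← hA.parity_odd H.h_odd,
            hh _ _ ha, map_zero]
        · rw [ih ij.2 (by omega) (fun l => a (l + ij.1)) (fun _ => ha _) (j - ij.1) (by omega)
            (by simp only [Nat.sub_add_cancel (not_lt.1 hl), haj]) (by omega)]
          simp
  refine ⟨key N a ha j hj haj, fun hN => ?_⟩
  rw [treeRootSum_eq, map_sum]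
  refine Finset.sum_eq_zero fun ij hij => ?_
  rw [mem_antidiagonal] at hij
  rcases Nat.eq_zero_or_pos ij.1 with h0 | h0
  · simp [h0]
  rcases Nat.eq_zero_or_pos ij.2 with h0' | h0'
  · simp [h0']
  by_cases hl : j < ij.1
  · by_cases hi : ij.1 = 1
    · obtain rfl : j = 0 := by omega
      rw [hi, treeSum_one, haj, hσ1, one_mul]
      exact hp _ _ (by omega)
    · rw [key ij.1 a ha j hl haj (by omega)]
      simp
  · by_cases hi : ij.2 = 1
    · obtain rfl : j = ij.1 := by omega
      rw [hi, treeSum_one, zero_add, haj, mul_one, ← H.parity_proj hA, hp _ _ (by omega),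
        map_zero]
    · rw [key ij.2 (fun l => a (l + ij.1)) (fun _ => ha _) (j - ij.1) (by omega)
        (by simp only [Nat.sub_add_cancel (not_lt.1 hl), haj]) (by omega)]
      simp

/-- The side conditions on a contracting homotopy imply strict unitality. -/
lemma isStrictlyUnital (hhh : ∀ x, H.h (H.h x) = 0) (hph : ∀ x, H.proj (H.h x) = 0)
    (hhp : ∀ x, H.h (H.proj x) = 0) (hσ1 : σ 1 = 1) (one : LinearMap.ker d)
    (hone : (one : A) = 1) (hp1 : H.proj 1 = 1) :
    (H.aInfinity hA).IsStrictlyUnital (cohClass d one) := by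
  have hincl : H.incl (cohClass d one) = 1 := by rw [incl_cohClass, hone, hp1]
  refine ⟨H.transfer_one _, fun v => ?_, fun v => ?_, fun N hN a j haj => ?_⟩
  · change H.transfer σ 2 _ = _
    rw [H.transfer_two hA, hincl, one_mul, toCohomology_incl]
  · change H.transfer σ 2 _ = _
    rw [H.transfer_two hA, hincl, mul_one, toCohomology_incl]
  · change H.transfer σ N _ = _
    have hσh : ∀ (m : ℕ) x, H.h x = 0 → H.h ((σ ^ m) x) = 0 := by
      intro m x hx
      induction m with
      | zero => simpa using hx
      | succ m ih =>
        rw [pow_succ', Module.End.mul_apply, ← neg_eq_zero, ← hA.parity_odd H.h_odd, ih, map_zero]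
    have hσ1' : ∀ m : ℕ, (σ ^ m) 1 = 1 := by
      intro m
      induction m with
      | zero => simp
      | succ m ih => rw [pow_succ', Module.End.mul_apply, ih, hσ1]
    rw [transfer_eq]
    apply H.incl_injective
    rw [incl_toCohomology, map_zero]
    refine (H.treeRootSum_unit_input hA hhh hph hσ1 N _ (fun i => ?_) j j.2 ?_).2 hN
    · split_ifs with hi
      · refine hσh _ _ ?_
        rw [← H.proj_incl, hhp]
      · exact map_zero _
    · simp [haj, hincl, hσ1']

end ContractingHomotopy

end Structure

/-! ### Division of power series by variables -/

section PowerSeries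

variable {k : Type*} [Field k] {n : ℕ}

/-- The `k`-linear operator `a ↦ (a' - a'(x_j = 0)) / x_j` on power series, where `a'` is obtained
from `a` by setting `x_l = 0` for all `l > j`. -/
def divX (j : Fin n) : R k n →ₗ[k] R k n where
  toFun a := fun α => if ∀ l, j < l → α l = 0 then
    MvPowerSeries.coeff (α + Finsupp.single j 1) a else 0
  map_add' a b := by
    funext α
    change (if ∀ l, j < l → α l = 0 then _ else (0 : k)) =
      (if ∀ l, j < l → α l = 0 then _ else (0 : k)) + (if ∀ l, j < l → α l = 0 then _ else (0 : k))
    rw [map_add]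
    split_ifs <;> simp
  map_smul' c a := by
    funext α
    change (if ∀ l, j < l → α l = 0 then _ else (0 : k)) =
      c • (if ∀ l, j < l → α l = 0 then _ else (0 : k))
    rw [map_smul]
    split_ifs <;> simp

/-- The power series obtained by setting `x_l = 0` for all `l ∈ S`. -/
def setZero (S : Finset (Fin n)) (a : R k n) : R k n :=
  fun α => if ∀ l ∈ S, α l = 0 then MvPowerSeries.coeff α a else 0

lemma coeff_divX (j : Fin n) (a : R k n) (α : Fin n →₀ ℕ) :
    MvPowerSeries.coeff α (divX j a) = if ∀ l, j < l → α l = 0 then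
      MvPowerSeries.coeff (α + Finsupp.single j 1) a else 0 := rfl

lemma coeff_setZero (S : Finset (Fin n)) (a : R k n) (α : Fin n →₀ ℕ) :
    MvPowerSeries.coeff α (setZero S a) =
      if ∀ l ∈ S, α l = 0 then MvPowerSeries.coeff α a else 0 := rfl

lemma coeff_add_X_mul (i : Fin n) (a : R k n) (α : Fin n →₀ ℕ) :
    MvPowerSeries.coeff (α + Finsupp.single i 1) (MvPowerSeries.X i * a) =
      MvPowerSeries.coeff α a := by
  rw [add_comm, MvPowerSeries.X, MvPowerSeries.coeff_add_monomial_mul, one_mul]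

lemma coeff_X_mul_of_eq_zero {i : Fin n} (a : R k n) {α : Fin n →₀ ℕ} (h : α i = 0) :
    MvPowerSeries.coeff α (MvPowerSeries.X i * a) = 0 := by
  rw [MvPowerSeries.X, MvPowerSeries.coeff_monomial_mul, if_neg]
  intro hle
  have := hle i
  simp [h] at this

lemma exists_eq_add_single {α : Fin n →₀ ℕ} {i : Fin n} (h : α i ≠ 0) :
    ∃ β, α = β + Finsupp.single i 1 :=
  ⟨α - Finsupp.single i 1, (tsub_add_cancel_of_le (by
    rw [Finsupp.single_le_iff]; omega)).symm⟩

lemma divX_X_mul_of_lt {i j : Fin n} (h : i < j) (a : R k n) :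
    divX j (MvPowerSeries.X i * a) = MvPowerSeries.X i * divX j a := by
  ext α
  rw [coeff_divX]
  by_cases hα : α i = 0
  · rw [coeff_X_mul_of_eq_zero _ hα, coeff_X_mul_of_eq_zero, ite_self]
    simp [hα, h.ne']
  · obtain ⟨β, rfl⟩ := exists_eq_add_single hα
    rw [coeff_add_X_mul, coeff_divX, add_right_comm, coeff_add_X_mul]
    congr 1
    refine propext (forall₂_congr fun l hl => ?_)
    simp [(h.trans hl).ne]

lemma divX_X_mul_self (j : Fin n) (a : R k n) :
    divX j (MvPowerSeries.X j * a) = setZero (Finset.univ.filter (j < ·)) a := by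
  ext α
  rw [coeff_divX, coeff_add_X_mul, coeff_setZero]
  simp

lemma divX_X_mul_of_gt {i j : Fin n} (h : j < i) (a : R k n) :
    divX j (MvPowerSeries.X i * a) = 0 := by
  ext α
  rw [coeff_divX, map_zero]
  split_ifs with hα
  · rw [coeff_X_mul_of_eq_zero]
    simp [hα i h, h.ne]
  · rfl

lemma divX_C (j : Fin n) (c : k) : divX j (MvPowerSeries.C c) = 0 := by
  ext α
  have h : α + Finsupp.single j 1 ≠ 0 := by
    intro h
    have := DFunLike.congr_fun h j
    simp at this
  rw [coeff_divX, MvPowerSeries.coeff_C, if_neg h, ite_self, map_zero]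

lemma coeff_X_mul_divX (j : Fin n) (a : R k n) (α : Fin n →₀ ℕ) :
    MvPowerSeries.coeff α (MvPowerSeries.X j * divX j a) =
      if α j ≠ 0 ∧ ∀ l, j < l → α l = 0 then MvPowerSeries.coeff α a else 0 := by
  by_cases hα : α j = 0
  · rw [coeff_X_mul_of_eq_zero _ hα, if_neg (by simp [hα])]
  · obtain ⟨β, rfl⟩ := exists_eq_add_single hα
    rw [coeff_add_X_mul, coeff_divX]
    congr 1
    refine propext ?_
    rw [and_iff_right hα]
    refine forall₂_congr fun l hl => ?_
    simp [hl.ne]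

/-- The expansion of a power series by the largest variable in `S` that occurs in a monomial. -/
lemma eq_setZero_add_sum (S : Finset (Fin n)) (hS : ∀ i ∈ S, ∀ j, i < j → j ∈ S) (a : R k n) :
    a = setZero S a + ∑ j ∈ S, MvPowerSeries.X j * divX j a := by
  ext α
  rw [map_add, map_sum, coeff_setZero]
  simp only [coeff_X_mul_divX]
  by_cases h : ∀ l ∈ S, α l = 0
  · rw [if_pos h, Finset.sum_eq_zero, add_zero]
    intro j hj
    exact if_neg fun h' => h'.1 (h j hj)
  · rw [if_neg h, zero_add]
    push Not at h
    obtain ⟨m, hm, hmax⟩ := (S.filter (fun l => α l ≠ 0)).exists_max_image id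
      (by obtain ⟨l, hl, hl'⟩ := h; exact ⟨l, Finset.mem_filter.2 ⟨hl, hl'⟩⟩)
    rw [Finset.mem_filter] at hm
    simp only [Finset.mem_filter, id, and_imp] at hmax
    rw [Finset.sum_eq_single_of_mem m hm.1]
    · refine (if_pos ⟨hm.2, fun l hl => ?_⟩).symm
      by_contra hl'
      exact absurd (hmax l (hS m hm.1 l hl) hl') (not_le.2 hl)
    · intro j hj hjm
      rw [if_neg]
      rintro ⟨h1, h2⟩
      rcases lt_trichotomy j m with h3 | h3 | h3
      · exact hm.2 (h2 m h3)
      · exact hjm h3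
      · exact absurd (hmax j hj h1) (not_le.2 h3)

lemma setZero_univ (a : R k n) :
    setZero Finset.univ a = MvPowerSeries.C (MvPowerSeries.constantCoeff a) := by
  ext α
  rw [coeff_setZero, MvPowerSeries.coeff_C]
  by_cases h : α = 0
  · subst h; simp
  · rw [if_neg h, if_neg]
    intro h'
    exact h (Finsupp.ext fun l => h' l (Finset.mem_univ l))

lemma eq_C_add_sum (a : R k n) :
    a = MvPowerSeries.C (MvPowerSeries.constantCoeff a) +
      ∑ j, MvPowerSeries.X j * divX j a := by
  rw [← setZero_univ]
  exact eq_setZero_add_sum _ (fun _ _ _ _ => Finset.mem_univ _) a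

/-- The power series in the variables `x_l` with `l ≤ j`. -/
def IsLow (j : Fin n) (a : R k n) : Prop :=
  ∀ α : Fin n →₀ ℕ, ∀ l, j < l → α l ≠ 0 → MvPowerSeries.coeff α a = 0

lemma isLow_divX (j : Fin n) (a : R k n) : IsLow j (divX j a) := by
  intro α l hl hα
  rw [coeff_divX, if_neg (fun h => hα (h l hl))]

lemma IsLow.mono {i j : Fin n} (hij : i ≤ j) {a : R k n} (ha : IsLow i a) : IsLow j a :=
  fun α l hl hα => ha α l (hij.trans_lt hl) hα

lemma IsLow.mul {j : Fin n} {a b : R k n} (ha : IsLow j a) (hb : IsLow j b) :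
    IsLow j (a * b) := by
  classical
  intro α l hl hα
  rw [MvPowerSeries.coeff_mul]
  refine Finset.sum_eq_zero fun βγ h => ?_
  rw [Finset.HasAntidiagonal.mem_antidiagonal] at h
  by_cases hβ : βγ.1 l = 0
  · rw [hb _ l hl, mul_zero]
    intro hγ
    rw [← h, Finsupp.add_apply, hβ, hγ] at hα
    exact hα rfl
  · rw [ha _ l hl hβ, zero_mul]

lemma IsLow.divX_eq_zero {j l : Fin n} (hjl : j < l) {a : R k n} (ha : IsLow j a) :
    divX l a = 0 := by
  ext α
  rw [coeff_divX, ha _ l hjl (by simp), ite_self, map_zero]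

lemma divX_divX_of_lt {i j : Fin n} (hij : i < j) (a : R k n) : divX j (divX i a) = 0 :=
  (isLow_divX i a).divX_eq_zero hij

/-- Reading off a coefficient one variable at a time, the smallest variable last. -/
lemma coeff_foldr_divX (l : List (Fin n)) (a : R k n) (hl : l.Pairwise (· ≤ ·))
    (α : Fin n →₀ ℕ) (hα : ∀ c ∈ l, ∀ m, c < m → α m = 0) :
    MvPowerSeries.coeff α (l.foldr (fun c g => divX c g) a) =
      MvPowerSeries.coeff (α + (l.map fun c => Finsupp.single c 1).sum) a := by
  induction l generalizing α with
  | nil => simp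
  | cons c l ih =>
    rw [List.pairwise_cons] at hl
    rw [List.foldr_cons, coeff_divX, if_pos (hα c (by simp)), ih hl.2]
    · simp [add_assoc]
    · intro c' hc' m hm
      have h1 := hl.1 c' hc'
      rw [Finsupp.add_apply, hα c' (by simp [hc']) m hm, Finsupp.single_eq_of_ne
        (h1.trans_lt hm).ne', add_zero]

/-- Exactness of the Koszul complex of `x_1, …, x_n` in degree one: a syzygy of the variables is a
combination of the trivial ones. -/
lemma exists_alternating_of_sum_X_mul_eq_zero (u : Fin n → R k n)
    (hu : ∑ i, MvPowerSeries.X i * u i = 0) :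
    ∃ a : Fin n → Fin n → R k n, (∀ i, a i i = 0) ∧ (∀ i j, a i j + a j i = 0) ∧
      ∀ i, u i = ∑ j, a i j * MvPowerSeries.X j := by
  refine ⟨fun i j => if i < j then divX j (u i) else if j < i then -divX i (u j) else 0,
    fun i => by simp, fun i j => ?_, fun i => ?_⟩
  · rcases lt_trichotomy i j with h | h | h
    · simp [h, h.not_gt]
    · simp [h]
    · simp [h, h.not_gt]
  · have h1 := congrArg (divX i) hu
    rw [map_sum, map_zero] at h1
    have h2 : ∀ j, divX i (MvPowerSeries.X j * u j) =
        (if j < i then MvPowerSeries.X j * divX i (u j) else 0) +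
        (if j = i then setZero (Finset.univ.filter (i < ·)) (u i) else 0) := by
      intro j
      rcases lt_trichotomy j i with h | h | h
      · rw [divX_X_mul_of_lt h, if_pos h, if_neg h.ne, add_zero]
      · subst h; simp [divX_X_mul_self]
      · rw [divX_X_mul_of_gt h, if_neg h.not_gt, if_neg h.ne', add_zero]
    rw [Finset.sum_congr rfl (fun j _ => h2 j), Finset.sum_add_distrib,
      Finset.sum_ite_eq' Finset.univ i, if_pos (Finset.mem_univ i)] at h1
    have h3 := eq_setZero_add_sum (Finset.univ.filter (i < ·))
      (fun a ha b hb => by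
        rw [Finset.mem_filter] at ha ⊢; exact ⟨Finset.mem_univ _, ha.2.trans hb⟩) (u i)
    rw [← neg_eq_of_add_eq_zero_right h1] at h3
    rw [h3, Finset.sum_filter, ← Finset.sum_neg_distrib, ← Finset.sum_add_distrib]
    refine Finset.sum_congr rfl fun j _ => ?_
    rcases lt_trichotomy i j with h | h | h
    · simp [h, h.not_gt, mul_comm]
    · simp [h]
    · simp [h, h.not_gt, mul_comm]

/-- The coefficients of the expressions `w_i = ∑_j f_{ij} x_j` can be chosen such that the
symmetrization of `f` is independent of the choice of the `w_i`. -/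
lemma exists_coefficients (w : R k n)
    (hw : ∀ i : Fin n →₀ ℕ, i.degree < 2 → MvPowerSeries.coeff i w = 0)
    (w' : Fin n → R k n) (hw' : w = ∑ i, MvPowerSeries.X i * w' i) :
    ∃ f : Fin n → Fin n → R k n, (∀ i, w' i = ∑ j, f i j * MvPowerSeries.X j) ∧
      (∀ i, f i i = divX i (divX i w)) ∧
      (∀ i j, i < j → f i j + f j i = divX i (divX j w)) := by
  have h0 : MvPowerSeries.constantCoeff w = 0 := by
    rw [← MvPowerSeries.coeff_zero_eq_constantCoeff_apply]
    exact hw 0 (by simp)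
  have h1 : ∀ i, MvPowerSeries.constantCoeff (divX i w) = 0 := by
    intro i
    rw [← MvPowerSeries.coeff_zero_eq_constantCoeff_apply, coeff_divX, zero_add,
      hw _ (by simp), ite_self]
  have h2 := eq_C_add_sum w
  rw [h0, map_zero, zero_add] at h2
  obtain ⟨a, ha0, ha1, ha⟩ := exists_alternating_of_sum_X_mul_eq_zero
    (fun i => w' i - divX i w) (by
      simp only [mul_sub, Finset.sum_sub_distrib]
      rw [← hw', ← h2, sub_self])
  refine ⟨fun i j => divX j (divX i w) + a i j, fun i => ?_, fun i => ?_, fun i j hij => ?_⟩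
  · have h3 := eq_C_add_sum (divX i w)
    rw [h1, map_zero, zero_add] at h3
    simp only [add_mul, Finset.sum_add_distrib]
    rw [← ha, Finset.sum_congr rfl (fun j _ => mul_comm (divX j (divX i w)) _), ← h3]
    abel
  · simp [ha0]
  · dsimp only
    rw [divX_divX_of_lt hij, zero_add]
    linear_combination ha1 i j

end PowerSeries

/-! ### Ordered products -/

section Monomials

/-- The product of the `v i` for `i ∈ I`, in decreasing order of `i`. -/
def orderedProd {B : Type*} [Monoid B] {n : ℕ} (v : Fin n → B) (I : Finset (Fin n)) : B :=
  ((I.sort (· ≥ ·)).map v).prod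

variable {B : Type*} {n : ℕ}

@[simp] lemma orderedProd_empty [Monoid B] (v : Fin n → B) : orderedProd v ∅ = 1 := by
  simp [orderedProd]

lemma orderedProd_insert [Monoid B] (v : Fin n → B) {I : Finset (Fin n)} {m : Fin n}
    (h : ∀ i ∈ I, i < m) : orderedProd v (insert m I) = v m * orderedProd v I := by
  rw [orderedProd, Finset.sort_insert (r := (· ≥ ·)) (fun b hb => (h b hb).le)
    (fun hm => (h m hm).false), List.map_cons, List.prod_cons, orderedProd]

variable {S : Type*} [CommRing S] [Ring B] [Algebra S B]

/-- The span of the decreasing products is stable under multiplication from the left if the factors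
satisfy Clifford relations. -/
lemma mul_orderedProd_mem_span (v : Fin n → B)
    (hv : ∀ i j, ∃ c : S, v i * v j + v j * v i = algebraMap S B c)
    (hv' : ∀ i, ∃ c : S, v i * v i = algebraMap S B c)
    (j : Fin n) {x : B} (hx : x ∈ Submodule.span S (Set.range (orderedProd v))) :
    v j * x ∈ Submodule.span S (Set.range (orderedProd v)) := by
  have key : ∀ I : Finset (Fin n), ∀ m : ℕ, (∀ i ∈ I, (i : ℕ) < m) → ∀ j : Fin n, (j : ℕ) < m →
      v j * orderedProd v I ∈
        Submodule.span S (orderedProd v '' {I | ∀ i ∈ I, (i : ℕ) < m}) := by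
    intro I
    induction I using Finset.induction_on_max with
    | empty =>
      intro m _ j hj
      refine Submodule.subset_span ⟨{j}, by simpa using hj, ?_⟩
      rw [← insert_empty_eq, orderedProd_insert v (by simp)]
    | insert i I hi ih =>
      intro m hm j hj
      have hI : ∀ l ∈ I, (l : ℕ) < m := fun l hl => hm l (Finset.mem_insert_of_mem hl)
      rcases lt_trichotomy j i with h | h | h
      · obtain ⟨c, hc⟩ := hv j i
        rw [orderedProd_insert v hi, ← mul_assoc, eq_sub_of_add_eq hc, sub_mul,
          ← Algebra.smul_def, mul_assoc]
        refine Submodule.sub_mem _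
          (Submodule.smul_mem _ _ (Submodule.subset_span ⟨I, hI, rfl⟩)) ?_
        have h1 := ih i (fun l hl => hi l hl) j h
        generalize v j * orderedProd v I = x at h1 ⊢
        induction h1 using Submodule.span_induction with
        | mem x hx =>
          obtain ⟨I', hI', rfl⟩ := hx
          rw [← orderedProd_insert v hI']
          refine Submodule.subset_span ⟨insert i I', fun l hl => ?_, rfl⟩
          rcases Finset.mem_insert.1 hl with rfl | hl
          · exact hm _ (Finset.mem_insert_self _ _)
          · exact (hI' l hl).trans (hm _ (Finset.mem_insert_self _ _))
        | zero => simp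
        | add x y _ _ hx hy => rw [mul_add]; exact Submodule.add_mem _ hx hy
        | smul c x _ hx => rw [mul_smul_comm]; exact Submodule.smul_mem _ _ hx
      · subst h
        obtain ⟨c, hc⟩ := hv' j
        rw [orderedProd_insert v hi, ← mul_assoc, hc, ← Algebra.smul_def]
        exact Submodule.smul_mem _ _ (Submodule.subset_span ⟨I, hI, rfl⟩)
      · have h1 : ∀ l ∈ insert i I, l < j := by
          intro l hl
          rcases Finset.mem_insert.1 hl with rfl | hl
          · exact h
          · exact (hi l hl).trans h
        rw [← orderedProd_insert v h1]
        refine Submodule.subset_span ⟨_, fun l hl => ?_, rfl⟩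
        rcases Finset.mem_insert.1 hl with rfl | hl
        · exact hj
        · exact hm l hl
  induction hx using Submodule.span_induction with
  | mem x hx =>
    obtain ⟨I, rfl⟩ := hx
    exact Submodule.span_mono (Set.image_subset_range _ _) (key I n (fun i _ => i.2) j j.2)
  | zero => simp
  | add x y _ _ hx hy => rw [mul_add]; exact Submodule.add_mem _ hx hy
  | smul c x _ hx => rw [mul_smul_comm]; exact Submodule.smul_mem _ _ hx

/-- A submodule that contains `1` and is stable under left multiplication by the elements of `s`
contains the subalgebra generated by `s`. -/
lemma mem_of_mem_adjoin {s : Set B} (N : Submodule S B) (h1 : (1 : B) ∈ N)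
    (hN : ∀ x ∈ s, ∀ y ∈ N, x * y ∈ N) {x : B} (hx : x ∈ Algebra.adjoin S s) : x ∈ N := by
  have key : ∀ y ∈ N, x * y ∈ N := by
    induction hx using Algebra.adjoin_induction with
    | mem x hx => exact hN x hx
    | algebraMap r => intro y hy; rw [← Algebra.smul_def]; exact N.smul_mem _ hy
    | add x y _ _ hx hy => intro z hz; rw [add_mul]; exact N.add_mem (hx z hz) (hy z hz)
    | mul x y _ _ hx hy => intro z hz; rw [mul_assoc]; exact hx _ (hy z hz)
  have := key 1 h1
  rwa [mul_one] at this

lemma eq_top_of_mul_mem {s : Set B} (hs : Algebra.adjoin S s = ⊤) (N : Submodule S B)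
    (h1 : (1 : B) ∈ N) (hN : ∀ x ∈ s, ∀ y ∈ N, x * y ∈ N) : N = ⊤ :=
  eq_top_iff.2 fun _ _ => mem_of_mem_adjoin N h1 hN (hs ▸ Algebra.mem_top)

end Monomials

/-! ### Creation and annihilation operators -/

section Fermions

variable {S : Type*} [CommRing S] {B : Type*} [Ring B] [Algebra S B] {n : ℕ}

/-- The canonical anticommutation relations between creation operators `θ i` and annihilation
operators `δ i`. -/
structure IsFermionic (θ δ : Fin n → B) : Prop where
  theta_sq : ∀ i, θ i * θ i = 0
  theta_anticomm : ∀ i j, θ i * θ j + θ j * θ i = 0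
  del_sq : ∀ i, δ i * δ i = 0
  del_anticomm : ∀ i j, δ i * δ j + δ j * δ i = 0
  del_theta : ∀ i j, δ i * θ j + θ j * δ i = if i = j then 1 else 0

namespace IsFermionic

variable {θ δ : Fin n → B} (h : IsFermionic θ δ)
include h

lemma del_mul_list_prod {m : Fin n} {l : List (Fin n)} (hm : m ∉ l) :
    δ m * (l.map fun i => δ i * θ i).prod = (l.map fun i => δ i * θ i).prod * δ m := by
  induction l with
  | nil => simp
  | cons i l ih =>
    rw [List.mem_cons, not_or] at hm
    have h2 := h.del_theta m i
    rw [if_neg hm.1] at h2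
    have h3 : δ m * (δ i * θ i) = δ i * θ i * δ m := by
      rw [← mul_assoc, eq_neg_of_add_eq_zero_left (h.del_anticomm m i), neg_mul, mul_assoc,
        eq_neg_of_add_eq_zero_left h2, mul_neg, neg_neg, mul_assoc]
    rw [List.map_cons, List.prod_cons, ← mul_assoc, h3, mul_assoc, ih hm.2, mul_assoc (δ i * θ i)]

lemma theta_mul_list_prod {m : Fin n} {l : List (Fin n)} (hm : m ∉ l) :
    θ m * (l.map fun i => δ i * θ i).prod = (l.map fun i => δ i * θ i).prod * θ m := by
  induction l with
  | nil => simp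
  | cons i l ih =>
    rw [List.mem_cons, not_or] at hm
    have h2 := h.del_theta i m
    rw [if_neg (Ne.symm hm.1)] at h2
    have h3 : θ m * (δ i * θ i) = δ i * θ i * θ m := by
      rw [← mul_assoc, eq_neg_of_add_eq_zero_right h2, neg_mul, mul_assoc,
        eq_neg_of_add_eq_zero_left (h.theta_anticomm m i), mul_neg, neg_neg, mul_assoc]
    rw [List.map_cons, List.prod_cons, ← mul_assoc, h3, mul_assoc, ih hm.2, mul_assoc (δ i * θ i)]

/-- The product of the `δ i * θ i` kills the image of all creation operators. -/
lemma list_prod_mul_theta {l : List (Fin n)} (hl : l.Nodup) {j : Fin n} (hj : j ∈ l) :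
    (l.map fun i => δ i * θ i).prod * θ j = 0 := by
  induction l with
  | nil => simp at hj
  | cons i l ih =>
    rw [List.nodup_cons] at hl
    rw [List.map_cons, List.prod_cons]
    by_cases hjl : j ∈ l
    · rw [mul_assoc, ih hl.2 hjl, mul_zero]
    · obtain rfl : j = i := by simpa [hjl] using hj
      rw [mul_assoc, ← h.theta_mul_list_prod hjl, mul_assoc, ← mul_assoc (θ j),
        h.theta_sq, zero_mul, mul_zero]

/-- If a subalgebra contains the annihilation operators and all multiples `f * P` of the product `P`
of the `δ i * θ i`, then it is everything. The factors of `P` are removed one at a time, by means of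
`P' = δ θ P' + θ (δ θ P') δ`, where `δ θ` is the first factor of `P` and `P'` the product of the
others. -/
lemma mem_of_mul_list_prod_mem (N : Subalgebra S B) (hδ : ∀ i, δ i ∈ N) {l : List (Fin n)}
    (hl : l.Nodup) (hN : ∀ f : B, f * (l.map fun i => δ i * θ i).prod ∈ N) (f : B) : f ∈ N := by
  induction l generalizing f with
  | nil => simpa using hN f
  | cons m l ih =>
    rw [List.nodup_cons] at hl
    refine ih hl.2 (fun f => ?_) f
    set P := (l.map fun i => δ i * θ i).prod with hP
    have hc : δ m * P = P * δ m := h.del_mul_list_prod hl.1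
    have h2 := h.del_theta m m
    rw [if_pos rfl] at h2
    simp only [List.map_cons, List.prod_cons, ← hP] at hN
    have h1 : f * P = f * (δ m * θ m * P) + f * θ m * (δ m * θ m * P) * δ m := by
      have h3 : θ m * (δ m * θ m) * δ m = θ m * δ m := by
        rw [eq_sub_of_add_eq h2, mul_sub, mul_one, ← mul_assoc, h.theta_sq, zero_mul, sub_zero]
      have h4 : f * θ m * (δ m * θ m * P) * δ m = f * (θ m * (δ m * θ m) * δ m) * P := by
        simp only [mul_assoc, hc]
      rw [h4, h3, mul_assoc f, ← mul_add, ← add_mul, h2, one_mul]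
    rw [h1]
    exact N.add_mem (hN f) (N.mul_mem (hN _) (hδ m))

lemma sum_mul_theta (x w : Fin n → S) (i : Fin n) :
    (∑ j, (x j • δ j + w j • θ j)) * θ i - (-θ i) * (∑ j, (x j • δ j + w j • θ j)) =
      x i • (1 : B) := by
  rw [neg_mul, sub_neg_eq_add, Finset.sum_mul, Finset.mul_sum, ← Finset.sum_add_distrib]
  have h1 : ∀ j, (x j • δ j + w j • θ j) * θ i + θ i * (x j • δ j + w j • θ j) =
      x j • (δ j * θ i + θ i * δ j) + w j • (θ j * θ i + θ i * θ j) := by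
    intro j
    simp only [add_mul, mul_add, smul_mul_assoc, mul_smul_comm]
    module
  simp [h1, h.del_theta, h.theta_anticomm]

lemma sum_mul_del (x w : Fin n → S) (i : Fin n) :
    (∑ j, (x j • δ j + w j • θ j)) * δ i - (-δ i) * (∑ j, (x j • δ j + w j • θ j)) =
      w i • (1 : B) := by
  rw [neg_mul, sub_neg_eq_add, Finset.sum_mul, Finset.mul_sum, ← Finset.sum_add_distrib]
  have h1 : ∀ j, (x j • δ j + w j • θ j) * δ i + δ i * (x j • δ j + w j • θ j) =
      x j • (δ j * δ i + δ i * δ j) + w j • (δ i * θ j + θ j * δ i) := by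
    intro j
    simp only [add_mul, mul_add, smul_mul_assoc, mul_smul_comm]
    module
  simp [h1, h.del_theta, h.del_anticomm]

end IsFermionic

/-- An algebra generated by odd elements is the sum of its even and its odd part. -/
lemma exists_add_of_adjoin_eq_top {k : Type*} [Field k] [Algebra k B] {s : Set B}
    (hs : Algebra.adjoin S s = ⊤) (𝒜 : ZMod 2 → Submodule k B)
    (hsmul : ∀ (t) (r : S) (b), b ∈ 𝒜 t → r • b ∈ 𝒜 t)
    (hmul : ∀ t u, ∀ b ∈ 𝒜 t, ∀ c ∈ 𝒜 u, b * c ∈ 𝒜 (t + u))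
    (hone : (1 : B) ∈ 𝒜 0) (hodd : ∀ b ∈ s, b ∈ 𝒜 1) (f : B) :
    ∃ f₀ ∈ 𝒜 0, ∃ f₁ ∈ 𝒜 1, f = f₀ + f₁ := by
  let N : Submodule S B :=
    { carrier := {f | ∃ f₀ ∈ 𝒜 0, ∃ f₁ ∈ 𝒜 1, f = f₀ + f₁}
      add_mem' := by
        rintro _ _ ⟨a, ha, b, hb, rfl⟩ ⟨c, hc, e, he, rfl⟩
        exact ⟨a + c, Submodule.add_mem _ ha hc, b + e, Submodule.add_mem _ hb he,
          add_add_add_comm _ _ _ _⟩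
      zero_mem' := ⟨0, Submodule.zero_mem _, 0, Submodule.zero_mem _, (add_zero 0).symm⟩
      smul_mem' := by
        rintro r _ ⟨a, ha, b, hb, rfl⟩
        exact ⟨_, hsmul _ r _ ha, _, hsmul _ r _ hb, smul_add _ _ _⟩ }
  have hN : N = ⊤ := by
    refine eq_top_of_mul_mem hs N ⟨1, hone, 0, Submodule.zero_mem _, (add_zero _).symm⟩ ?_
    rintro x hx _ ⟨a, ha, b, hb, rfl⟩
    exact ⟨x * b, hmul 1 1 x (hodd x hx) b hb, x * a, hmul 1 0 x (hodd x hx) a ha,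
      by rw [mul_add, add_comm]⟩
  exact (hN ▸ Submodule.mem_top : f ∈ N)

lemma graded_commutator_mul (e x y x' y' : B) :
    e * (x * y) - x' * y' * e = (e * x - x' * e) * y + x' * (e * y - y' * e) := by
  noncomm_ring

lemma neg_one_pow_odd_smul {k M : Type*} [Field k] [AddCommGroup M] [Module k M] (x : M) :
    (-1 : k) ^ (1 : ZMod 2).val • x = -x := by
  have : (1 : ZMod 2).val = 1 := rfl
  rw [this, pow_one, neg_one_smul]

lemma commutator_of_odd {k : Type*} [Field k] [Algebra k B] {e x x' r : B}
    (hx : x' = (-1 : k) ^ (1 : ZMod 2).val • x) (h : e * x - -x * e = r) :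
    e * x - x' * e = r := by
  rw [hx, neg_one_pow_odd_smul, h]

lemma zmod_two_eq (t : ZMod 2) : t = 0 ∨ t = 1 := by decide +revert

end Fermions

/-! ### Generators of the endomorphism algebra -/

section Endomorphisms

variable {k : Type*} [Field k] {n : ℕ}

lemma theta_apply (i : Fin n) (v : Lam k n) :
    theta i v = ExteriorAlgebra.ι (R k n) (Pi.single i (1 : R k n)) * v := rfl

/-- The operators `θ_i` and `∂_i` satisfy the canonical anticommutation relations. -/
lemma isFermionic_theta_del : IsFermionic (theta : Fin n → Alg k n) del where
  theta_sq i := by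
    refine LinearMap.ext fun v => ?_
    simp only [Module.End.mul_apply, theta_apply, LinearMap.zero_apply]
    rw [← mul_assoc, ExteriorAlgebra.ι_sq_zero, zero_mul]
  theta_anticomm i j := by
    refine LinearMap.ext fun v => ?_
    simp only [Module.End.mul_apply, theta_apply, LinearMap.zero_apply, LinearMap.add_apply]
    rw [← mul_assoc, ← mul_assoc, ← add_mul, ExteriorAlgebra.ι_add_mul_swap, zero_mul]
  del_sq i := by
    refine LinearMap.ext fun v => ?_
    exact CliffordAlgebra.contractLeft_contractLeft _ v
  del_anticomm i j := by
    refine LinearMap.ext fun v => ?_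
    simp only [Module.End.mul_apply, LinearMap.zero_apply, LinearMap.add_apply, del]
    rw [CliffordAlgebra.contractLeft_comm, neg_add_cancel]
  del_theta i j := by
    refine LinearMap.ext fun v => ?_
    have h1 : del i (theta j v) = (if i = j then (1 : R k n) else 0) • v - theta j (del i v) := by
      refine (CliffordAlgebra.contractLeft_ι_mul _ _ v).trans ?_
      rw [LinearMap.proj_apply, Pi.single_apply]
      rfl
    simp only [Module.End.mul_apply, LinearMap.add_apply, h1]
    by_cases h : i = j
    · simp [h]
    · simp [h]

lemma del_one (i : Fin n) : del i (1 : Lam k n) = 0 := CliffordAlgebra.contractLeft_one _ _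

lemma mulLeft_ι_eq (m : Fin n → R k n) :
    LinearMap.mulLeft (R k n) (ExteriorAlgebra.ι (R k n) m) = ∑ i, m i • (theta i : Alg k n) := by
  have h : m = ∑ i, m i • (Pi.single i (1 : R k n) : Fin n → R k n) := by
    ext1 j
    simp [Finset.sum_apply, Pi.single_apply]
  refine LinearMap.ext fun v => ?_
  conv_lhs => rw [h]
  simp [theta_apply, Finset.sum_mul]

/-- The algebra of endomorphisms of the exterior algebra is generated by the operators `θ_i` and
`∂_i`. The product `P` of all `∂_i θ_i` is the projection to the constants, so that
`f P = (f 1) P` is in the subalgebra for every `f`, and `1` is in the ideal generated by `P`. -/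
lemma adjoin_theta_del :
    Algebra.adjoin (R k n) (Set.range theta ∪ Set.range del : Set (Alg k n)) = ⊤ := by
  set S := Algebra.adjoin (R k n) (Set.range theta ∪ Set.range del : Set (Alg k n)) with hS
  have hθ : ∀ i, theta i ∈ S := fun i => Algebra.subset_adjoin (Or.inl ⟨i, rfl⟩)
  have hδ : ∀ i, del i ∈ S := fun i => Algebra.subset_adjoin (Or.inr ⟨i, rfl⟩)
  let P : List (Fin n) → Alg k n := fun l => (l.map fun i => del i * theta i).prod
  have hPS : P (List.finRange n) ∈ S := by
    refine Subalgebra.list_prod_mem _ fun x hx => ?_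
    obtain ⟨i, _, rfl⟩ := List.mem_map.1 hx
    exact S.mul_mem (hδ i) (hθ i)
  have hPθ : ∀ j, P (List.finRange n) * theta j = 0 := fun j =>
    isFermionic_theta_del.list_prod_mul_theta (List.nodup_finRange n) (List.mem_finRange j)
  have hP1 : ∀ l, P l (1 : Lam k n) = 1 := by
    intro l
    induction l with
    | nil => simp [P]
    | cons i l ih =>
      have h1 := LinearMap.congr_fun ((isFermionic_theta_del (k := k)).del_theta i i) 1
      rw [if_pos rfl, LinearMap.add_apply, Module.End.mul_apply (theta i : Alg k n), del_one,
        map_zero, add_zero] at h1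
      have h2 : P (i :: l) = del i * theta i * P l := by simp [P]
      rw [h2, Module.End.mul_apply, ih, h1, Module.End.one_apply]
  have hvac : ∀ v : Lam k n, ∃ r : R k n, P (List.finRange n) v = r • 1 := by
    intro v
    induction v using CliffordAlgebra.left_induction with
    | algebraMap r => exact ⟨r, by rw [Algebra.algebraMap_eq_smul_one, map_smul, hP1]⟩
    | add x y hx hy =>
      obtain ⟨r, hr⟩ := hx
      obtain ⟨s, hs⟩ := hy
      exact ⟨r + s, by rw [map_add, hr, hs, add_smul]⟩
    | ι_mul x m _ =>
      refine ⟨0, ?_⟩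
      have h1 : CliffordAlgebra.ι _ m * x =
          LinearMap.mulLeft (R k n) (ExteriorAlgebra.ι (R k n) m) x := rfl
      rw [h1, mulLeft_ι_eq, ← Module.End.mul_apply, Finset.mul_sum, Finset.sum_eq_zero]
      · simp
      · intro i _
        rw [mul_smul_comm, hPθ, smul_zero]
  have hmul : ∀ ω : Lam k n, LinearMap.mulLeft (R k n) ω ∈ S := by
    intro ω
    induction ω using CliffordAlgebra.induction with
    | algebraMap r =>
      have h1 : LinearMap.mulLeft (R k n) (algebraMap (R k n) (Lam k n) r) =
          algebraMap (R k n) (Alg k n) r := by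
        refine LinearMap.ext fun v => ?_
        rw [LinearMap.mulLeft_apply, ← Algebra.smul_def, Module.algebraMap_end_apply]
      exact h1 ▸ S.algebraMap_mem r
    | ι m =>
      have h1 := mulLeft_ι_eq (k := k) m
      refine (h1 : LinearMap.mulLeft (R k n) (CliffordAlgebra.ι _ m) = _) ▸ ?_
      exact S.sum_mem fun i _ => S.smul_mem (hθ i) _
    | mul x y hx hy =>
      rw [LinearMap.mulLeft_mul]
      exact S.mul_mem hx hy
    | add x y hx hy =>
      have h1 : LinearMap.mulLeft (R k n) (x + y) =
          LinearMap.mulLeft (R k n) x + LinearMap.mulLeft (R k n) y := by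
        refine LinearMap.ext fun v => ?_
        simp [add_mul]
      rw [h1]
      exact S.add_mem hx hy
  have hfull : ∀ f : Alg k n, f * P (List.finRange n) ∈ S := by
    intro f
    have h1 : f * P (List.finRange n) =
        LinearMap.mulLeft (R k n) (f 1) * P (List.finRange n) := by
      refine LinearMap.ext fun v => ?_
      obtain ⟨r, hr⟩ := hvac v
      rw [Module.End.mul_apply, Module.End.mul_apply, hr, map_smul, map_smul,
        LinearMap.mulLeft_apply, mul_one]
    rw [h1]
    exact S.mul_mem (hmul _) hPS
  rw [eq_top_iff]
  exact fun f _ => isFermionic_theta_del.mem_of_mul_list_prod_mem S hδ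
    (List.nodup_finRange n) hfull f

lemma finrank_alg : Module.finrank (R k n) (Alg k n) =
    Fintype.card (Finset (Fin n) × Finset (Fin n)) := by
  have b := (Pi.basisFun (R k n) (Fin n)).ExteriorAlgebra
  have := Module.Free.of_basis b
  have := Module.Finite.of_basis b
  rw [Module.finrank_linearMap, Module.finrank_eq_card_basis b, Fintype.card_prod]

/-! ### Parity of endomorphisms -/

lemma evenOdd_exists_add (v : Lam k n) :
    ∃ v₀ ∈ CliffordAlgebra.evenOdd (0 : QuadraticForm (R k n) (Fin n → R k n)) 0,
    ∃ v₁ ∈ CliffordAlgebra.evenOdd (0 : QuadraticForm (R k n) (Fin n → R k n)) 1,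
      v = v₀ + v₁ := by
  have h := (CliffordAlgebra.evenOdd_isCompl
    (Q := (0 : QuadraticForm (R k n) (Fin n → R k n)))).sup_eq_top
  have hv : v ∈ (⊤ : Submodule (R k n) (Lam k n)) := Submodule.mem_top
  rw [← h] at hv
  obtain ⟨x, hx, y, hy, rfl⟩ := Submodule.mem_sup.1 hv
  exact ⟨x, hx, y, hy, rfl⟩

/-- Endomorphisms are determined by their values on homogeneous elements. -/
lemma alg_ext {f g : Alg k n}
    (h : ∀ t, ∀ v ∈ CliffordAlgebra.evenOdd (0 : QuadraticForm (R k n) (Fin n → R k n)) t,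
      f v = g v) : f = g := by
  refine LinearMap.ext fun v => ?_
  obtain ⟨x, hx, y, hy, rfl⟩ := evenOdd_exists_add v
  rw [map_add, map_add, h _ _ hx, h _ _ hy]

lemma involute_of_mem_evenOdd {t : ZMod 2} {v : Lam k n}
    (hv : v ∈ CliffordAlgebra.evenOdd (0 : QuadraticForm (R k n) (Fin n → R k n)) t) :
    CliffordAlgebra.involute v = (-1 : k) ^ t.val • v := by
  have ht := zmod_two_eq t
  rcases ht with rfl | rfl
  · rw [CliffordAlgebra.involute_eq_of_mem_even hv]
    simp
  · rw [CliffordAlgebra.involute_eq_of_mem_odd hv]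
    have : (1 : ZMod 2).val = 1 := rfl
    simp [this]

lemma sgn_apply (f : Alg k n) (v : Lam k n) :
    sgn f v = CliffordAlgebra.involute (f (CliffordAlgebra.involute v)) := rfl

lemma sgn_sgn (f : Alg k n) : sgn (sgn f) = f := by
  refine LinearMap.ext fun v => ?_
  simp only [sgn_apply, CliffordAlgebra.involute_involute]

lemma sgn_mul (f g : Alg k n) : sgn (f * g) = sgn f * sgn g := by
  refine LinearMap.ext fun v => ?_
  simp only [sgn_apply, CliffordAlgebra.involute_involute, Module.End.mul_apply]

lemma sgn_smul (r : R k n) (f : Alg k n) : sgn (r • f) = r • sgn f := by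
  refine LinearMap.ext fun v => ?_
  simp only [sgn_apply, LinearMap.smul_apply, map_smul]

lemma sgn_of_mem_parity {s : ZMod 2} {f : Alg k n} (hf : f ∈ parity (k := k) s) :
    sgn f = (-1 : k) ^ s.val • f := by
  refine alg_ext fun t v hv => ?_
  have h1 : ∀ s t : ZMod 2, (-1 : k) ^ t.val * (-1 : k) ^ (t + s).val = (-1 : k) ^ s.val := by
    intro s t
    have hs := zmod_two_eq s
    have ht := zmod_two_eq t
    have e0 : (0 : ZMod 2).val = 0 := rfl
    have e1 : (1 : ZMod 2).val = 1 := rfl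
    have e2 : ((1 : ZMod 2) + 1).val = 0 := rfl
    rcases hs with rfl | rfl <;> rcases ht with rfl | rfl <;> simp [e0, e1, e2]
  rw [sgn_apply, involute_of_mem_evenOdd hv, LinearMap.map_smul_of_tower,
    ← AlgHom.toLinearMap_apply, LinearMap.map_smul_of_tower, AlgHom.toLinearMap_apply,
    involute_of_mem_evenOdd (hf t v hv), smul_smul, h1, LinearMap.smul_apply]

lemma mul_mem_parity {s t : ZMod 2} {f g : Alg k n} (hf : f ∈ parity (k := k) s)
    (hg : g ∈ parity (k := k) t) : f * g ∈ parity (k := k) (s + t) := by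
  intro u v hv
  have := hf _ _ (hg u v hv)
  rwa [add_assoc, add_comm t s] at this

lemma smul_mem_parity {s : ZMod 2} {f : Alg k n} (r : R k n) (hf : f ∈ parity (k := k) s) :
    r • f ∈ parity (k := k) s :=
  fun u v hv => Submodule.smul_mem _ r (hf u v hv)

lemma one_mem_parity : (1 : Alg k n) ∈ parity (k := k) 0 := by
  intro u v hv
  rwa [add_zero]

lemma theta_mem_parity (i : Fin n) : (theta i : Alg k n) ∈ parity (k := k) 1 := by
  intro u v hv
  rw [add_comm]
  exact CliffordAlgebra.evenOdd_mul_le _ _ _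
    (Submodule.mul_mem_mul (CliffordAlgebra.ι_mem_evenOdd_one _ _) hv)

lemma del_mem_parity (i : Fin n) : (del i : Alg k n) ∈ parity (k := k) 1 := by
  intro u v hv
  induction v, hv using CliffordAlgebra.evenOdd_induction with
  | range_ι_pow v h =>
    have hu := zmod_two_eq u
    rcases hu with rfl | rfl
    · rw [show (0 : ZMod 2).val = 0 from rfl, pow_zero] at h
      obtain ⟨r, rfl⟩ := Submodule.mem_one.1 h
      rw [show del i (algebraMap (R k n) _ r) = 0 from
        CliffordAlgebra.contractLeft_algebraMap _ _ r]
      exact Submodule.zero_mem _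
    · have h1 : (1 : ZMod 2).val = 1 := rfl
      rw [h1, pow_one] at h
      obtain ⟨m, rfl⟩ := h
      rw [show del i (CliffordAlgebra.ι _ m) = algebraMap (R k n) _ (m i) from
        CliffordAlgebra.contractLeft_ι _ _ m]
      exact CliffordAlgebra.one_le_evenOdd_zero _ (Submodule.mem_one.2 ⟨_, rfl⟩)
  | add x y hx hy h1 h2 => rw [map_add]; exact Submodule.add_mem _ h1 h2
  | ι_mul_ι_mul m₁ m₂ x hx ih =>
    have e : ∀ (m : Fin n → R k n) (y : Lam k n), del i (CliffordAlgebra.ι _ m * y) =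
        m i • y - CliffordAlgebra.ι _ m * del i y :=
      fun m y => CliffordAlgebra.contractLeft_ι_mul _ m y
    rw [mul_assoc, e, e]
    have mem : ∀ (m : Fin n → R k n) {t : ZMod 2} {y : Lam k n},
        y ∈ CliffordAlgebra.evenOdd (0 : QuadraticForm (R k n) (Fin n → R k n)) t →
        CliffordAlgebra.ι _ m * y ∈
          CliffordAlgebra.evenOdd (0 : QuadraticForm (R k n) (Fin n → R k n)) (t + 1) := by
      intro m t y hy
      rw [add_comm]
      exact CliffordAlgebra.evenOdd_mul_le _ _ _
        (Submodule.mul_mem_mul (CliffordAlgebra.ι_mem_evenOdd_one _ _) hy)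
    have two : ∀ t : ZMod 2, t + 1 + 1 = t := by decide
    refine Submodule.sub_mem _ (Submodule.smul_mem _ _ (mem m₂ hx)) ?_
    rw [← two (u + 1)]
    refine mem m₁ ?_
    rw [two]
    refine Submodule.sub_mem _ (Submodule.smul_mem _ _ hx) ?_
    have := mem m₂ ih
    rwa [two] at this

lemma parity_exists_add (f : Alg k n) :
    ∃ f₀ ∈ parity (k := k) 0, ∃ f₁ ∈ parity (k := k) 1, f = f₀ + f₁ :=
  exists_add_of_adjoin_eq_top (adjoin_theta_del (k := k) (n := n)) parity
    (fun _ r _ hb => smul_mem_parity r hb) (fun _ _ _ hb _ hc => mul_mem_parity hb hc)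
    one_mem_parity (by
      rintro _ (⟨i, rfl⟩ | ⟨i, rfl⟩)
      · exact theta_mem_parity i
      · exact del_mem_parity i) f

lemma eq_zero_of_mem_parity {f : Alg k n} (h0 : f ∈ parity (k := k) 0)
    (h1 : f ∈ parity (k := k) 1) : f = 0 := by
  refine alg_ext fun t v hv => ?_
  have hd := (CliffordAlgebra.evenOdd_isCompl
    (Q := (0 : QuadraticForm (R k n) (Fin n → R k n)))).disjoint
  have e0 := h0 t v hv
  have e1 := h1 t v hv
  rw [add_zero] at e0
  have ht := zmod_two_eq t
  rcases ht with rfl | rfl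
  · exact Submodule.disjoint_def.1 hd _ e0 e1
  · exact Submodule.disjoint_def.1 hd _ e1 e0

/-! ### The differential -/

variable (w' : Fin n → R k n)

lemma diff_apply (f : Alg k n) : diff w' f = delta w' * f - sgn f * delta w' := rfl

lemma delta_mem_parity : delta w' ∈ parity (k := k) 1 :=
  Submodule.sum_mem _ fun i _ => Submodule.add_mem _ (smul_mem_parity _ (del_mem_parity i))
    (smul_mem_parity _ (theta_mem_parity i))

lemma isSuperDGA : IsSuperDGA (parity (k := k) (n := n)) sgn (diff w') where
  mul_mem := mul_mem_parity
  exists_add := parity_exists_add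
  parity_apply := sgn_of_mem_parity
  parity_mul := sgn_mul
  parity_parity := sgn_sgn
  d_mem := by
    intro s f hf
    rw [diff_apply]
    refine Submodule.sub_mem _ ?_ ?_
    · rw [add_comm]; exact mul_mem_parity (delta_mem_parity w') hf
    · rw [sgn_of_mem_parity hf]
      exact mul_mem_parity (Submodule.smul_mem _ _ hf) (delta_mem_parity w')
  leibniz x y := by
    rw [diff_apply, diff_apply, diff_apply, sgn_mul]
    exact graded_commutator_mul _ _ _ _ _

lemma diff_smul (r : R k n) (f : Alg k n) : diff w' (r • f) = r • diff w' f := by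
  rw [diff_apply, diff_apply, sgn_smul, mul_smul_comm, smul_mul_assoc, smul_sub]

lemma diff_theta (i : Fin n) :
    diff w' (theta i) = (MvPowerSeries.X i : R k n) • (1 : Alg k n) := by
  have h := (isFermionic_theta_del (k := k) (n := n)).sum_mul_theta (S := R k n)
    MvPowerSeries.X w' i
  exact commutator_of_odd (sgn_of_mem_parity (theta_mem_parity i)) h

lemma diff_del (i : Fin n) : diff w' (del i) = w' i • (1 : Alg k n) := by
  have h := (isFermionic_theta_del (k := k) (n := n)).sum_mul_del (S := R k n)
    MvPowerSeries.X w' i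
  exact commutator_of_odd (sgn_of_mem_parity (del_mem_parity i)) h

end Endomorphisms

/-! ### The contraction of the Koszul complex -/

section KoszulDGA

variable {k : Type*} [Field k] {n : ℕ} {B : Type*} [Ring B] [Algebra k B] [Algebra (R k n) B]

/-- A differential `ℤ/2`-graded algebra `B` that is, as a complex, the Koszul complex of
`x_1, …, x_n` on the elements `θ_j`, tensored with the span of the products of the cocycles `D_j`.
As an algebra, `B` is the Clifford algebra over `R` with the given relations; it is free with basis
the ordered monomials, which is expressed by the conditions on generators and on the rank. -/
structure IsKoszulDGA (𝒜 : ZMod 2 → Submodule k B) (σ d : B →ₗ[k] B) (θ D : Fin n → B)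
    (f : Fin n → Fin n → R k n) : Prop extends IsSuperDGA 𝒜 σ d where
  theta_sq : ∀ i, θ i * θ i = 0
  theta_anticomm : ∀ i j, θ i * θ j + θ j * θ i = 0
  D_theta : ∀ i j, D i * θ j + θ j * D i = if i = j then 1 else 0
  D_sq : ∀ i, D i * D i = -algebraMap (R k n) B (f i i)
  D_D : ∀ i j, D i * D j + D j * D i = -algebraMap (R k n) B (f i j + f j i)
  d_theta : ∀ i, d (θ i) = (MvPowerSeries.X i : R k n) • (1 : B)
  d_D : ∀ i, d (D i) = 0
  d_smul : ∀ (r : R k n) b, d (r • b) = r • d b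
  theta_mem : ∀ i, θ i ∈ 𝒜 1
  D_mem : ∀ i, D i ∈ 𝒜 1
  one_mem : (1 : B) ∈ 𝒜 0
  smul_mem : ∀ (s) (r : R k n) b, b ∈ 𝒜 s → r • b ∈ 𝒜 s
  eq_zero_of_mem : ∀ b, b ∈ 𝒜 0 → b ∈ 𝒜 1 → b = 0
  adjoin_eq_top : Algebra.adjoin (R k n) (Set.range θ ∪ Set.range D) = ⊤
  finrank_eq : Module.finrank (R k n) B = Fintype.card (Finset (Fin n) × Finset (Fin n))

/-- The indices larger than all elements of `I`. -/
def above (I : Finset (Fin n)) : Finset (Fin n) := Finset.univ.filter fun j => ∀ i ∈ I, i < j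

lemma mem_above {I : Finset (Fin n)} {j : Fin n} : j ∈ above I ↔ ∀ i ∈ I, i < j := by
  simp [above]

lemma above_empty : above (∅ : Finset (Fin n)) = Finset.univ := by simp [above]

lemma above_insert {I : Finset (Fin n)} {m : Fin n} (h : ∀ i ∈ I, i < m) :
    above (insert m I) = Finset.univ.filter (m < ·) := by
  ext j
  simp only [mem_above, Finset.mem_insert, forall_eq_or_imp, Finset.mem_filter, Finset.mem_univ,
    true_and]
  exact ⟨fun h' => h'.1, fun h' => ⟨h', fun i hi => (h i hi).trans h'⟩⟩

/-- The monomials `θ_I D_J`, where `θ_I` and `D_J` are products in decreasing order. -/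
def monomial (θ D : Fin n → B) (I J : Finset (Fin n)) : B := orderedProd θ I * orderedProd D J

omit [Algebra k B] [Algebra (R k n) B] in
lemma monomial_insert (θ D : Fin n → B) {I : Finset (Fin n)} {m : Fin n} (h : ∀ i ∈ I, i < m)
    (J : Finset (Fin n)) : monomial θ D (insert m I) J = θ m * monomial θ D I J := by
  rw [monomial, orderedProd_insert θ h, mul_assoc, monomial]

namespace IsKoszulDGA

variable {𝒜 : ZMod 2 → Submodule k B} {σ d : B →ₗ[k] B} {θ D : Fin n → B}
  {f : Fin n → Fin n → R k n} (hK : IsKoszulDGA 𝒜 σ d θ D f)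
include hK

lemma D_mul_theta (i j : Fin n) : D i * θ j = (if i = j then 1 else 0) - θ j * D i :=
  eq_sub_of_add_eq (hK.D_theta i j)

lemma sigma_theta (i : Fin n) : σ (θ i) = -θ i := by
  rw [hK.parity_apply (hK.theta_mem i), neg_one_pow_odd_smul]

lemma sigma_D (i : Fin n) : σ (D i) = -D i := by
  rw [hK.parity_apply (hK.D_mem i), neg_one_pow_odd_smul]

lemma d_theta_mul (i : Fin n) (b : B) :
    d (θ i * b) = (MvPowerSeries.X i : R k n) • b - θ i * d b := by
  rw [hK.leibniz, hK.d_theta, smul_mul_assoc, one_mul, hK.sigma_theta, neg_mul, sub_eq_add_neg]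

lemma d_one : d 1 = 0 := by
  have h := hK.leibniz 1 1
  rw [hK.parity_apply hK.one_mem] at h
  simpa using h

lemma d_orderedProd_D (J : Finset (Fin n)) : d (orderedProd D J) = 0 := by
  induction J using Finset.induction_on_max with
  | empty => rw [orderedProd_empty, hK.d_one]
  | insert i J hi ih =>
    rw [orderedProd_insert D hi, hK.leibniz, hK.d_D, ih, zero_mul, mul_zero, add_zero]

lemma orderedProd_mem (v : Fin n → B) (hv : ∀ i, v i ∈ 𝒜 1) (I : Finset (Fin n)) :
    orderedProd v I ∈ 𝒜 (I.card : ZMod 2) := by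
  induction I using Finset.induction_on_max with
  | empty => simpa using hK.one_mem
  | insert m I hm ih =>
    rw [orderedProd_insert v hm, Finset.card_insert_of_notMem (fun h => (hm m h).false),
      Nat.cast_add, Nat.cast_one, add_comm]
    exact hK.mul_mem (hv m) ih

lemma monomial_mem (I J : Finset (Fin n)) :
    monomial θ D I J ∈ 𝒜 ((I.card : ZMod 2) + (J.card : ZMod 2)) :=
  hK.mul_mem (hK.orderedProd_mem θ hK.theta_mem I) (hK.orderedProd_mem D hK.D_mem J)

lemma span_monomial : Submodule.span (R k n)
    (Set.range fun IJ : Finset (Fin n) × Finset (Fin n) => monomial θ D IJ.1 IJ.2) = ⊤ := by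
  set N := Submodule.span (R k n)
    (Set.range fun IJ : Finset (Fin n) × Finset (Fin n) => monomial θ D IJ.1 IJ.2) with hN
  have hmem : ∀ x ∈ Submodule.span (R k n) (Set.range (orderedProd θ)),
      ∀ y ∈ Submodule.span (R k n) (Set.range (orderedProd D)), x * y ∈ N := by
    intro x hx y hy
    have h1 := Submodule.mul_mem_mul hx hy
    rw [Submodule.span_mul_span] at h1
    refine Submodule.span_mono ?_ h1
    rintro _ ⟨_, ⟨I, rfl⟩, _, ⟨J, rfl⟩, rfl⟩
    exact ⟨(I, J), rfl⟩
  have hθ : ∀ i, ∀ y ∈ N, θ i * y ∈ N := by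
    intro i y hy
    induction hy using Submodule.span_induction with
    | mem y hy =>
      obtain ⟨⟨I, J⟩, rfl⟩ := hy
      simp only [monomial]
      rw [← mul_assoc]
      refine hmem _ (mul_orderedProd_mem_span θ (fun i j => ⟨0, ?_⟩) (fun i => ⟨0, ?_⟩) i
        (Submodule.subset_span ⟨I, rfl⟩)) _ (Submodule.subset_span ⟨J, rfl⟩)
      · rw [map_zero, hK.theta_anticomm]
      · rw [map_zero, hK.theta_sq]
    | zero => simp
    | add x y _ _ hx hy => rw [mul_add]; exact N.add_mem hx hy
    | smul c x _ hx => rw [mul_smul_comm]; exact N.smul_mem _ hx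
  have hD : ∀ i (I : Finset (Fin n)), ∀ y ∈ Submodule.span (R k n) (Set.range (orderedProd D)),
      D i * (orderedProd θ I * y) ∈ N := by
    intro i I y hy
    induction I using Finset.induction_on_max with
    | empty =>
      rw [orderedProd_empty, one_mul, ← one_mul (D i * y)]
      refine hmem _ (Submodule.subset_span ⟨∅, orderedProd_empty θ⟩) _
        (mul_orderedProd_mem_span D (fun i j => ⟨-(f i j + f j i), ?_⟩) (fun i => ⟨-f i i, ?_⟩)
          i hy)
      · rw [map_neg, hK.D_D]
      · rw [map_neg, hK.D_sq]
    | insert m I hm ih =>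
      rw [orderedProd_insert θ hm, mul_assoc, ← mul_assoc, hK.D_mul_theta, sub_mul, mul_assoc]
      refine N.sub_mem ?_ (hθ _ _ ih)
      split_ifs
      · rw [one_mul]; exact hmem _ (Submodule.subset_span ⟨I, rfl⟩) _ hy
      · rw [zero_mul]; exact N.zero_mem
  refine eq_top_of_mul_mem hK.adjoin_eq_top N
    (Submodule.subset_span ⟨(∅, ∅), by simp [monomial]⟩) ?_
  rintro _ (⟨i, rfl⟩ | ⟨i, rfl⟩) y hy
  · exact hθ i y hy
  · induction hy using Submodule.span_induction with
    | mem y hy =>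
      obtain ⟨⟨I, J⟩, rfl⟩ := hy
      exact hD i I _ (Submodule.subset_span ⟨J, rfl⟩)
    | zero => simp
    | add x y _ _ hx hy => rw [mul_add]; exact N.add_mem hx hy
    | smul c x _ hx => rw [mul_smul_comm]; exact N.smul_mem _ hx

/-- The basis of ordered monomials. -/
def basis : Module.Basis (Finset (Fin n) × Finset (Fin n)) (R k n) B :=
  basisOfTopLeSpanOfCardEqFinrank (fun IJ => monomial θ D IJ.1 IJ.2) hK.span_monomial.ge
    hK.finrank_eq.symm

lemma basis_apply (I J : Finset (Fin n)) : hK.basis (I, J) = monomial θ D I J := by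
  simp [basis]

/-- Linear maps over `k` are determined by their values on multiples of the monomials. -/
lemma linearMap_ext {M : Type*} [AddCommGroup M] [Module k M] {g g' : B →ₗ[k] M}
    (h : ∀ (a : R k n) I J, g (a • monomial θ D I J) = g' (a • monomial θ D I J)) : g = g' := by
  refine LinearMap.ext fun b => ?_
  rw [← hK.basis.sum_repr b, map_sum, map_sum]
  refine Finset.sum_congr rfl fun IJ _ => ?_
  obtain ⟨I, J⟩ := IJ
  rw [hK.basis_apply, h]

/-- The differential of a monomial is a combination of monomials times variables `x_i`, in which all
indices of variables and of factors `θ_i` are small. -/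
lemma d_monomial_mem_span (J I : Finset (Fin n)) (m : Fin n) (hm : ∀ i ∈ I, i < m) :
    d (monomial θ D I J) ∈ Submodule.span k {b | ∃ i I', i < m ∧ (∀ l ∈ I', l < m) ∧
      b = (MvPowerSeries.X i : R k n) • monomial θ D I' J} := by
  induction I using Finset.induction_on_max generalizing m with
  | empty =>
    rw [monomial, orderedProd_empty, one_mul, hK.d_orderedProd_D]
    exact Submodule.zero_mem _
  | insert i I hi ih =>
    have him := hm i (Finset.mem_insert_self _ _)
    rw [monomial_insert θ D hi, hK.d_theta_mul]
    refine Submodule.sub_mem _ (Submodule.subset_span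
      ⟨i, I, him, fun l hl => hm l (Finset.mem_insert_of_mem hl), rfl⟩) ?_
    have h1 := ih i hi
    generalize d (monomial θ D I J) = y at h1 ⊢
    induction h1 using Submodule.span_induction with
    | mem y hy =>
      obtain ⟨l, I', hl, hI', rfl⟩ := hy
      rw [mul_smul_comm, ← monomial_insert θ D hI']
      refine Submodule.subset_span ⟨l, _, hl.trans him, fun j hj => ?_, rfl⟩
      rcases Finset.mem_insert.1 hj with rfl | hj
      · exact him
      · exact (hI' j hj).trans him
    | zero => simp
    | add x y _ _ hx hy => rw [mul_add]; exact Submodule.add_mem _ hx hy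
    | smul c x _ hx => rw [mul_smul_comm]; exact Submodule.smul_mem _ _ hx

/-- A homogeneous element is a combination of monomials of the same parity. -/
lemma homogeneous_induction {s : ZMod 2} (N : AddSubgroup B)
    (hN : ∀ (a : R k n) (I J : Finset (Fin n)), (I.card : ZMod 2) + (J.card : ZMod 2) = s →
      a • monomial θ D I J ∈ N) {b : B} (hb : b ∈ 𝒜 s) : b ∈ N := by
  have two : ∀ s t : ZMod 2, t ≠ s → t = s + 1 := by decide
  have h1 := hK.basis.sum_repr b
  rw [← Finset.sum_filter_add_sum_filter_not _
    (fun IJ => (IJ.1.card : ZMod 2) + (IJ.2.card : ZMod 2) = s)] at h1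
  set b₀ := ∑ IJ ∈ Finset.univ.filter (fun IJ : Finset (Fin n) × Finset (Fin n) =>
    (IJ.1.card : ZMod 2) + (IJ.2.card : ZMod 2) = s), hK.basis.repr b IJ • hK.basis IJ with hb₀
  set b₁ := ∑ IJ ∈ Finset.univ.filter (fun IJ : Finset (Fin n) × Finset (Fin n) =>
    ¬(IJ.1.card : ZMod 2) + (IJ.2.card : ZMod 2) = s), hK.basis.repr b IJ • hK.basis IJ with hb₁
  have h2 : b₀ ∈ 𝒜 s := by
    refine Submodule.sum_mem _ fun IJ hIJ => ?_
    rw [Finset.mem_filter] at hIJ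
    have := hK.smul_mem _ (hK.basis.repr b IJ) _ (hK.monomial_mem IJ.1 IJ.2)
    rwa [hIJ.2, ← hK.basis_apply] at this
  have h3 : b₁ ∈ 𝒜 (s + 1) := by
    refine Submodule.sum_mem _ fun IJ hIJ => ?_
    rw [Finset.mem_filter] at hIJ
    have := hK.smul_mem _ (hK.basis.repr b IJ) _ (hK.monomial_mem IJ.1 IJ.2)
    rwa [two _ _ hIJ.2, ← hK.basis_apply] at this
  have h4 : b₁ ∈ 𝒜 s := by
    rw [show b₁ = b - b₀ from eq_sub_of_add_eq' h1]
    exact Submodule.sub_mem _ hb h2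
  have h5 : b₁ = 0 := by
    rcases zmod_two_eq s with rfl | rfl
    · exact hK.eq_zero_of_mem _ h4 (by simpa using h3)
    · exact hK.eq_zero_of_mem _ h3 h4
  rw [← h1, h5, add_zero]
  refine N.sum_mem fun IJ hIJ => ?_
  have := hN (hK.basis.repr b IJ) IJ.1 IJ.2 (Finset.mem_filter.1 hIJ).2
  rwa [← hK.basis_apply] at this

variable [IsScalarTower k (R k n) B]

/-- The contracting homotopy of the Koszul complex, in which the variables are eliminated one after
the other, starting with the last one. -/
def homotopy : B →ₗ[k] B :=
  ∑ IJ : Finset (Fin n) × Finset (Fin n), ∑ j ∈ above IJ.1,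
    ((LinearMap.toSpanSingleton (R k n) B (θ j * monomial θ D IJ.1 IJ.2)).restrictScalars k) ∘ₗ
      divX j ∘ₗ ((hK.basis.coord IJ).restrictScalars k)

lemma homotopy_smul_monomial (a : R k n) (I J : Finset (Fin n)) :
    hK.homotopy (a • monomial θ D I J) =
      ∑ j ∈ above I, divX j a • (θ j * monomial θ D I J) := by
  rw [homotopy, LinearMap.sum_apply, Finset.sum_eq_single_of_mem (I, J) (Finset.mem_univ _)]
  · rw [LinearMap.sum_apply]
    refine Finset.sum_congr rfl fun j _ => ?_
    rw [LinearMap.comp_apply, LinearMap.comp_apply, ← hK.basis_apply]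
    simp
  · rintro ⟨I', J'⟩ _ h
    rw [LinearMap.sum_apply]
    refine Finset.sum_eq_zero fun j _ => ?_
    rw [LinearMap.comp_apply, LinearMap.comp_apply, ← hK.basis_apply I J]
    simp [Finsupp.single_eq_of_ne h]

lemma homotopy_theta_mul {J : Finset (Fin n)} {m : Fin n} {y : B}
    (hy : y ∈ Submodule.span k {b | ∃ i I', i < m ∧ (∀ l ∈ I', l < m) ∧
      b = (MvPowerSeries.X i : R k n) • monomial θ D I' J}) (a : R k n) :
    hK.homotopy (a • (θ m * y)) =
      ∑ j ∈ Finset.univ.filter (m < ·), divX j a • (θ j * (θ m * y)) := by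
  induction hy using Submodule.span_induction with
  | mem y hy =>
    obtain ⟨i, I, him, hI, rfl⟩ := hy
    rw [mul_smul_comm, smul_smul, mul_comm, ← monomial_insert θ D hI, hK.homotopy_smul_monomial,
      above_insert hI]
    refine Finset.sum_congr rfl fun j hj => ?_
    rw [divX_X_mul_of_lt (him.trans (Finset.mem_filter.1 hj).2), mul_smul_comm, smul_smul,
      mul_comm]
  | zero => simp
  | add x y _ _ hx hy =>
    simp only [mul_add, smul_add, map_add, Finset.sum_add_distrib, hx, hy]
  | smul c x _ hx =>
    have h1 : a • (θ m * c • x) = c • a • (θ m * x) := by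
      rw [mul_smul_comm, smul_comm]
    rw [h1, map_smul, hx, Finset.smul_sum]
    refine Finset.sum_congr rfl fun j _ => ?_
    rw [mul_smul_comm, mul_smul_comm, smul_comm]

/-- The projection `id - (d h + h d)` sets all `x_j` and all `θ_j` to zero. -/
lemma proj_smul_monomial (a : R k n) (I J : Finset (Fin n)) :
    (LinearMap.id - (d ∘ₗ hK.homotopy + hK.homotopy ∘ₗ d) : B →ₗ[k] B) (a • monomial θ D I J) =
      if I = ∅ then (MvPowerSeries.C (MvPowerSeries.constantCoeff a) : R k n) • monomial θ D ∅ J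
        else 0 := by
  have hmax : I = ∅ ∨ ∃ m I₀, (∀ i ∈ I₀, i < m) ∧ I = insert m I₀ := by
    induction I using Finset.induction_on_max with
    | empty => exact Or.inl rfl
    | insert m I₀ hm _ => exact Or.inr ⟨m, I₀, hm, rfl⟩
  simp only [LinearMap.sub_apply, LinearMap.add_apply, LinearMap.comp_apply, LinearMap.id_apply]
  rw [hK.homotopy_smul_monomial, map_sum, hK.d_smul]
  simp only [hK.d_smul, hK.d_theta_mul]
  rcases hmax with rfl | ⟨m, I₀, hm, rfl⟩
  · have h0 : d (monomial θ D ∅ J) = 0 := by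
      rw [monomial, orderedProd_empty, one_mul, hK.d_orderedProd_D]
    simp only [h0, smul_zero, mul_zero, sub_zero, map_zero, add_zero, if_true, above_empty,
      smul_smul]
    rw [← Finset.sum_smul, ← sub_smul]
    congr 1
    conv_lhs => rw [eq_C_add_sum a]
    rw [sub_eq_iff_eq_add]
    congr 1
    refine Finset.sum_congr rfl fun j _ => ?_
    rw [← eq_C_add_sum a, mul_comm]
  · rw [if_neg (Finset.insert_ne_empty _ _), sub_eq_zero, above_insert hm,
      monomial_insert θ D hm, hK.d_theta_mul]
    have hy := hK.d_monomial_mem_span J I₀ m hm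
    set y := d (monomial θ D I₀ J) with hy_def
    set b := monomial θ D I₀ J with hb
    have h1 : hK.homotopy ((a * MvPowerSeries.X m : R k n) • b) =
        setZero (Finset.univ.filter (m < ·)) a • (θ m * b) +
          ∑ j ∈ Finset.univ.filter (m < ·),
            (MvPowerSeries.X m * divX j a : R k n) • (θ j * b) := by
      rw [mul_comm, hb, hK.homotopy_smul_monomial, ← divX_X_mul_self m a]
      have h2 : insert m (Finset.univ.filter (m < ·)) ⊆ above I₀ := by
        intro j hj
        rw [mem_above]
        rcases Finset.mem_insert.1 hj with rfl | hj
        · exact hm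
        · exact fun i hi => (hm i hi).trans (Finset.mem_filter.1 hj).2
      rw [← Finset.sum_subset h2, Finset.sum_insert (by simp)]
      · congr 1
        refine Finset.sum_congr rfl fun j hj => ?_
        rw [divX_X_mul_of_lt (Finset.mem_filter.1 hj).2]
      · intro j _ hj
        rw [divX_X_mul_of_gt, zero_smul]
        simp only [Finset.mem_insert, Finset.mem_filter, Finset.mem_univ, true_and, not_or,
          not_lt] at hj
        exact lt_of_le_of_ne hj.2 hj.1
    have h3 := hK.homotopy_theta_mul hy a
    rw [smul_sub, map_sub, smul_smul, h1, h3]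
    conv_lhs => rw [eq_setZero_add_sum (Finset.univ.filter (m < ·))
      (fun i hi j hj => by
        rw [Finset.mem_filter] at hi ⊢; exact ⟨Finset.mem_univ _, hi.2.trans hj⟩) a]
    rw [add_smul, Finset.sum_smul]
    have h4 : ∀ j, divX j a • ((MvPowerSeries.X j : R k n) • (θ m * b) -
          θ j * ((MvPowerSeries.X m : R k n) • b - θ m * y)) =
        (MvPowerSeries.X j * divX j a : R k n) • (θ m * b) -
          (MvPowerSeries.X m * divX j a : R k n) • (θ j * b) + divX j a • (θ j * (θ m * y)) := by
      intro j
      rw [mul_sub, mul_smul_comm, smul_sub, smul_sub, smul_smul, smul_smul,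
        mul_comm (divX j a), mul_comm (divX j a)]
      abel
    simp only [h4, Finset.sum_add_distrib, Finset.sum_sub_distrib]
    abel

/-- The contraction of the Koszul complex onto the span of the products of the `D_j`. -/
def contraction : ContractingHomotopy 𝒜 d where
  h := hK.homotopy
  h_odd s b hb := by
    refine hK.homogeneous_induction (s := s)
      ((𝒜 (s + 1)).comap hK.homotopy).toAddSubgroup (fun a I J hIJ => ?_) hb
    change hK.homotopy _ ∈ 𝒜 (s + 1)
    rw [hK.homotopy_smul_monomial]
    refine Submodule.sum_mem _ fun j _ => hK.smul_mem _ _ _ ?_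
    rw [← hIJ, add_comm]
    exact hK.mul_mem (hK.theta_mem j) (hK.monomial_mem I J)
  idem := by
    refine hK.linearMap_ext fun a I J => ?_
    rw [LinearMap.comp_apply, hK.proj_smul_monomial]
    split_ifs
    · rw [hK.proj_smul_monomial, if_pos rfl, MvPowerSeries.constantCoeff_C]
    · exact map_zero _
  d_proj := by
    refine hK.linearMap_ext fun a I J => ?_
    rw [LinearMap.comp_apply, hK.proj_smul_monomial]
    split_ifs
    · rw [hK.d_smul, monomial, orderedProd_empty, one_mul, hK.d_orderedProd_D, smul_zero]
      rfl
    · rw [map_zero]; rfl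
  proj_d := by
    refine hK.linearMap_ext fun a I J => ?_
    rw [LinearMap.comp_apply, LinearMap.zero_apply]
    have hmax : I = ∅ ∨ ∃ m I₀, (∀ i ∈ I₀, i < m) ∧ I = insert m I₀ := by
      induction I using Finset.induction_on_max with
      | empty => exact Or.inl rfl
      | insert m I₀ hm _ => exact Or.inr ⟨m, I₀, hm, rfl⟩
    rcases hmax with rfl | ⟨m, I₀, hm, rfl⟩
    · rw [hK.d_smul, monomial, orderedProd_empty, one_mul, hK.d_orderedProd_D, smul_zero, map_zero]
    · rw [hK.d_smul, monomial_insert θ D hm, hK.d_theta_mul, smul_sub, map_sub, smul_smul,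
        hK.proj_smul_monomial]
      have h1 : MvPowerSeries.constantCoeff (a * MvPowerSeries.X m : R k n) = 0 := by simp
      rw [h1, map_zero, zero_smul, ite_self, zero_sub, neg_eq_zero]
      have hy := hK.d_monomial_mem_span J I₀ m hm
      generalize d (monomial θ D I₀ J) = y at hy ⊢
      induction hy using Submodule.span_induction with
      | mem y hy =>
        obtain ⟨i, I', him, hI', rfl⟩ := hy
        rw [mul_smul_comm, ← monomial_insert θ D hI', smul_smul, hK.proj_smul_monomial,
          if_neg (Finset.insert_ne_empty _ _)]
      | zero => simp
      | add x y _ _ hx hy => rw [mul_add, smul_add, map_add, hx, hy, add_zero]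
      | smul c x _ hx => rw [mul_smul_comm, smul_comm, map_smul, hx, smul_zero]

lemma contraction_h : hK.contraction.h = hK.homotopy := rfl

lemma contraction_proj (a : R k n) (I J : Finset (Fin n)) :
    hK.contraction.proj (a • monomial θ D I J) =
      if I = ∅ then (MvPowerSeries.C (MvPowerSeries.constantCoeff a) : R k n) • monomial θ D ∅ J
        else 0 := hK.proj_smul_monomial a I J

end IsKoszulDGA

end KoszulDGA

/-! ### Side conditions -/

section KoszulDGA

variable {k : Type*} [Field k] {n : ℕ} {B : Type*} [Ring B] [Algebra k B] [Algebra (R k n) B]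
  [IsScalarTower k (R k n) B]

namespace IsKoszulDGA

variable {𝒜 : ZMod 2 → Submodule k B} {σ d : B →ₗ[k] B} {θ D : Fin n → B}
  {f : Fin n → Fin n → R k n} (hK : IsKoszulDGA 𝒜 σ d θ D f)
include hK

lemma homotopy_of_isLow {a : R k n} {m : Fin n} (ha : IsLow m a) {I : Finset (Fin n)}
    (hm : ∀ i ∈ I, i < m) (J : Finset (Fin n)) :
    hK.homotopy (a • monomial θ D (insert m I) J) = 0 := by
  rw [hK.homotopy_smul_monomial, above_insert hm]
  refine Finset.sum_eq_zero fun j hj => ?_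
  rw [ha.divX_eq_zero (Finset.mem_filter.1 hj).2, zero_smul]

lemma proj_of_insert (a : R k n) (m : Fin n) (I J : Finset (Fin n)) :
    hK.contraction.proj (a • monomial θ D (insert m I) J) = 0 := by
  rw [hK.contraction_proj, if_neg (Finset.insert_ne_empty _ _)]

lemma homotopy_homotopy (x : B) : hK.homotopy (hK.homotopy x) = 0 := by
  refine LinearMap.congr_fun (f := hK.homotopy ∘ₗ hK.homotopy) (g := 0)
    (hK.linearMap_ext fun a I J => ?_) x
  rw [LinearMap.comp_apply, hK.homotopy_smul_monomial, map_sum, LinearMap.zero_apply]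
  refine Finset.sum_eq_zero fun j hj => ?_
  rw [← monomial_insert θ D (mem_above.1 hj),
    hK.homotopy_of_isLow (isLow_divX j a) (mem_above.1 hj)]

lemma proj_homotopy (x : B) : hK.contraction.proj (hK.homotopy x) = 0 := by
  refine LinearMap.congr_fun (f := hK.contraction.proj ∘ₗ hK.homotopy) (g := 0)
    (hK.linearMap_ext fun a I J => ?_) x
  rw [LinearMap.comp_apply, hK.homotopy_smul_monomial, map_sum, LinearMap.zero_apply]
  refine Finset.sum_eq_zero fun j hj => ?_
  rw [← monomial_insert θ D (mem_above.1 hj), hK.proj_of_insert]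

lemma homotopy_C_smul (c : k) (J : Finset (Fin n)) :
    hK.homotopy ((MvPowerSeries.C c : R k n) • monomial θ D ∅ J) = 0 := by
  rw [hK.homotopy_smul_monomial]
  exact Finset.sum_eq_zero fun j _ => by rw [divX_C, zero_smul]

lemma homotopy_monomial_empty (J : Finset (Fin n)) : hK.homotopy (monomial θ D ∅ J) = 0 := by
  have := hK.homotopy_C_smul 1 J
  rwa [map_one, one_smul] at this

lemma homotopy_proj (x : B) : hK.homotopy (hK.contraction.proj x) = 0 := by
  refine LinearMap.congr_fun (f := hK.homotopy ∘ₗ hK.contraction.proj) (g := 0)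
    (hK.linearMap_ext fun a I J => ?_) x
  rw [LinearMap.comp_apply, hK.contraction_proj, LinearMap.zero_apply]
  split_ifs
  · exact hK.homotopy_C_smul _ _
  · exact map_zero _

lemma proj_monomial_empty (J : Finset (Fin n)) :
    hK.contraction.proj (monomial θ D ∅ J) = monomial θ D ∅ J := by
  have := hK.contraction_proj 1 ∅ J
  rwa [if_pos rfl, one_smul, map_one, map_one, one_smul] at this

omit hK [IsScalarTower k (R k n) B] [Algebra k B] [Algebra (R k n) B] in
lemma monomial_empty_empty : monomial θ D ∅ ∅ = 1 := by simp [monomial]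

omit hK [IsScalarTower k (R k n) B] [Algebra k B] [Algebra (R k n) B] in
lemma orderedProd_singleton (v : Fin n → B) (i : Fin n) : orderedProd v {i} = v i := by
  rw [← insert_empty_eq, orderedProd_insert v (by simp), orderedProd_empty, mul_one]

lemma proj_one : hK.contraction.proj 1 = 1 := by
  have := hK.proj_monomial_empty ∅
  rwa [monomial_empty_empty] at this

omit hK in
lemma C_smul (c : k) (b : B) : (MvPowerSeries.C c : R k n) • b = c • b :=
  algebraMap_smul (R k n) c b

/-- The projection evaluates coefficients at the origin. -/
lemma proj_smul (a : R k n) (b : B) :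
    hK.contraction.proj (a • b) = MvPowerSeries.constantCoeff a • hK.contraction.proj b := by
  refine LinearMap.congr_fun (f := hK.contraction.proj ∘ₗ
      ((LinearMap.lsmul (R k n) B a).restrictScalars k))
    (g := MvPowerSeries.constantCoeff a • hK.contraction.proj)
    (hK.linearMap_ext fun a' I J => ?_) b
  simp only [LinearMap.comp_apply, LinearMap.smul_apply, LinearMap.restrictScalars_apply,
    LinearMap.lsmul_apply]
  rw [smul_smul, hK.contraction_proj, hK.contraction_proj]
  split_ifs
  · rw [C_smul, C_smul, smul_smul, map_mul]
  · rw [smul_zero]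

/-! ### Products of the generators -/

lemma homotopy_smul_one (g : R k n) :
    hK.homotopy (g • 1) = ∑ j, divX j g • θ j := by
  have := hK.homotopy_smul_monomial g ∅ ∅
  rw [monomial_empty_empty, above_empty] at this
  simpa using this

lemma sigma_homotopy_smul_one (g : R k n) :
    σ (hK.homotopy (g • 1)) = -hK.homotopy (g • 1) := by
  have h1 := hK.parity_odd hK.contraction.h_odd (g • 1)
  rw [hK.parity_apply (hK.smul_mem 0 g 1 hK.one_mem)] at h1
  simpa [contraction_h] using h1

omit hK [IsScalarTower k (R k n) B] [Algebra k B] [Algebra (R k n) B] in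
lemma monomial_singleton_left (j : Fin n) (J : Finset (Fin n)) :
    monomial θ D (insert j ∅) J = θ j * orderedProd D J := by
  rw [monomial_insert θ D (by simp), monomial, orderedProd_empty, one_mul]

/-- Elements of `B` that are killed by the homotopy and by the projection. -/
def nullSubmodule : Submodule k B :=
  LinearMap.ker hK.homotopy ⊓ LinearMap.ker hK.contraction.proj

lemma mem_nullSubmodule {x : B} :
    x ∈ hK.nullSubmodule ↔ hK.homotopy x = 0 ∧ hK.contraction.proj x = 0 := by
  simp [nullSubmodule]

lemma smul_theta_mul_mem_null (g : R k n) (j : Fin n) (J : Finset (Fin n)) :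
    divX j g • (θ j * orderedProd D J) ∈ hK.nullSubmodule := by
  rw [← monomial_singleton_left, hK.mem_nullSubmodule]
  exact ⟨hK.homotopy_of_isLow (isLow_divX j g) (by simp) J, hK.proj_of_insert _ _ _ _⟩

lemma homotopy_mul_D_mem_null (g : R k n) (c : Fin n) :
    hK.homotopy (g • 1) * D c ∈ hK.nullSubmodule := by
  rw [hK.homotopy_smul_one, Finset.sum_mul]
  refine Submodule.sum_mem _ fun j _ => ?_
  rw [smul_mul_assoc, ← orderedProd_singleton D c]
  exact hK.smul_theta_mul_mem_null g j {c}

/-- The image of the homotopy in the Koszul complex is closed under products. -/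
lemma homotopy_mul_homotopy_mem_null (g g' : R k n) :
    hK.homotopy (g • 1) * hK.homotopy (g' • 1) ∈ hK.nullSubmodule := by
  rw [hK.homotopy_smul_one, hK.homotopy_smul_one, Finset.sum_mul_sum]
  refine Submodule.sum_mem _ fun j _ => Submodule.sum_mem _ fun l _ => ?_
  rw [smul_mul_smul_comm]
  have key : ∀ j l : Fin n, l < j → ∀ a : R k n, IsLow j a →
      a • (θ j * θ l) ∈ hK.nullSubmodule := by
    intro j l hjl a ha
    have h1 : θ j * θ l = monomial θ D (insert j {l}) ∅ := by
      rw [monomial_insert θ D (by simpa using hjl), monomial, orderedProd_singleton,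
        orderedProd_empty, mul_one]
    rw [h1, hK.mem_nullSubmodule]
    exact ⟨hK.homotopy_of_isLow ha (by simpa using hjl) _, hK.proj_of_insert _ _ _ _⟩
  rcases lt_trichotomy j l with h | h | h
  · rw [eq_neg_of_add_eq_zero_left (hK.theta_anticomm j l), smul_neg]
    exact Submodule.neg_mem _ (key l j h _
      (((isLow_divX j g).mono h.le).mul (isLow_divX l g')))
  · subst h
    rw [hK.theta_sq, smul_zero]
    exact Submodule.zero_mem _
  · exact key j l h _ ((isLow_divX j g).mul ((isLow_divX l g').mono h.le))

lemma D_mul_homotopy (c : Fin n) (g : R k n) :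
    D c * hK.homotopy (g • 1) - divX c g • 1 ∈ hK.nullSubmodule := by
  have h1 : D c * hK.homotopy (g • 1) - divX c g • 1 = -(hK.homotopy (g • 1) * D c) := by
    rw [hK.homotopy_smul_one, Finset.mul_sum, Finset.sum_mul, sub_eq_iff_eq_add',
      ← sub_eq_add_neg, eq_sub_iff_add_eq, ← Finset.sum_add_distrib]
    simp only [mul_smul_comm, smul_mul_assoc, ← smul_add, hK.D_theta]
    simp
  rw [h1]
  exact Submodule.neg_mem _ (hK.homotopy_mul_D_mem_null g c)

lemma homotopy_D_mul_homotopy (c : Fin n) (g : R k n) :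
    hK.homotopy (D c * hK.homotopy (g • 1)) = hK.homotopy (divX c g • 1) := by
  have := (hK.mem_nullSubmodule.1 (hK.D_mul_homotopy c g)).1
  rwa [map_sub, sub_eq_zero] at this

lemma proj_D_mul_homotopy (c : Fin n) (g : R k n) :
    hK.contraction.proj (D c * hK.homotopy (g • 1)) =
      MvPowerSeries.constantCoeff (divX c g) • (1 : B) := by
  have := (hK.mem_nullSubmodule.1 (hK.D_mul_homotopy c g)).2
  rwa [map_sub, sub_eq_zero, hK.proj_smul, hK.proj_one] at this

section Words

variable {w : R k n} (hf : ∀ i, f i i = divX i (divX i w))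
  (hf' : ∀ i j, i < j → f i j + f j i = divX i (divX j w))
include hf hf'

lemma homotopy_D_mul_D {a b : Fin n} (hab : a ≤ b) :
    hK.homotopy (D a * D b) = -hK.homotopy (divX a (divX b w) • 1) := by
  rcases hab.eq_or_lt with rfl | h
  · rw [hK.D_sq, hf, Algebra.algebraMap_eq_smul_one, map_neg]
  · have h1 : D b * D a = monomial θ D ∅ (insert b {a}) := by
      rw [monomial, orderedProd_empty, one_mul, orderedProd_insert D (by simpa using h),
        orderedProd_singleton]
    rw [eq_sub_of_add_eq (hK.D_D a b), hf' a b h, Algebra.algebraMap_eq_smul_one, map_sub, h1,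
      hK.homotopy_monomial_empty, sub_zero, map_neg]

/-- The tree sums of a sorted word in the `D_i`, with arbitrary signs: only the right comb
contributes, and it divides `w` by the letters of the word, one after the other. For two different
letters, `p (D_c D_{c'})` has in addition a term `D_{c'} D_c`. -/
lemma treeRootSum_word (N : ℕ) : ∀ l : List (Fin n), l.length = N → l.Pairwise (· ≤ ·) →
    ∀ a : ℕ → B, (∀ (j : ℕ) (hj : j < l.length), a j = D l[j] ∨ a j = -D l[j]) →
    (2 ≤ N → ∃ ε : k, (ε = 1 ∨ ε = -1) ∧ treeSum σ hK.homotopy N a =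
      ε • hK.homotopy (l.foldr (fun c g => divX c g) w • 1)) ∧
    (2 ≤ N → (N = 2 → ∀ x ∈ l, ∀ y ∈ l, x = y) →
      ∃ ε : k, (ε = 1 ∨ ε = -1) ∧ hK.contraction.proj (treeRootSum σ hK.homotopy N a) =
      ε • MvPowerSeries.constantCoeff (l.foldr (fun c g => divX c g) w) • (1 : B)) := by
  have hneg : ∀ ε : k, (ε = 1 ∨ ε = -1) → (-ε = 1 ∨ -ε = -1) := by
    rintro ε (rfl | rfl) <;> simp
  induction N using Nat.strong_induction_on with
  | _ N ih =>
    intro l hlen hl a ha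
    match l, hlen with
    | [], hlen => exact ⟨fun h => by simp at hlen; omega, fun h => by simp at hlen; omega⟩
    | [c], hlen => exact ⟨fun h => by simp at hlen; omega, fun h => by simp at hlen; omega⟩
    | [c, c'], hlen =>
      obtain rfl : N = 2 := by simpa using hlen.symm
      have hc : c ≤ c' := by simpa using hl
      have h2 : ∃ ε : k, (ε = 1 ∨ ε = -1) ∧
          treeRootSum σ hK.homotopy 2 a = ε • (D c * D c') := by
        have h0 := ha 0 (by simp)
        have h1 := ha 1 (by simp)
        have h3 : treeRootSum σ hK.homotopy 2 a = σ (a 0) * a 1 := by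
          rw [treeRootSum_eq]
          simp [Finset.Nat.antidiagonal_succ]
        rw [h3]
        simp only [List.getElem_cons_zero, List.getElem_cons_succ] at h0 h1
        rcases h0 with h0 | h0 <;> rcases h1 with h1 | h1 <;> rw [h0, h1]
        · exact ⟨-1, by simp, by simp [hK.sigma_D]⟩
        · exact ⟨1, by simp, by simp [hK.sigma_D]⟩
        · exact ⟨1, by simp, by simp [hK.sigma_D]⟩
        · exact ⟨-1, by simp, by simp [hK.sigma_D]⟩
      obtain ⟨ε, hε, h2⟩ := h2
      constructor
      · intro _
        refine ⟨ε, hε, ?_⟩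
        rw [treeSum_eq σ _ (by omega), h2, map_smul, hK.homotopy_D_mul_D hf hf' hc, smul_neg,
          neg_neg]
        rfl
      · intro _ hcc
        obtain rfl : c = c' := hcc rfl c (by simp) c' (by simp)
        refine ⟨-ε, hneg ε hε, ?_⟩
        rw [h2, map_smul, hK.D_sq, Algebra.algebraMap_eq_smul_one, map_neg, hK.proj_smul,
          hK.proj_one, hf, smul_neg, neg_smul]
        rfl
    | c :: c' :: c'' :: l', hlen =>
      set l := c' :: c'' :: l' with hldef
      have hlen' : l.length + 1 = N := by simpa using hlen
      have hl2 : 2 ≤ l.length := by simp [hldef]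
      have hlS : l.Pairwise (· ≤ ·) := (List.pairwise_cons.1 hl).2
      obtain ⟨ε, hε, hcomb⟩ := (ih l.length (by omega) l rfl hlS (fun j => a (j + 1))
        (fun j hj => ha (j + 1) (Nat.succ_lt_succ hj))).1 hl2
      set g := l.foldr (fun c g => divX c g) w with hg
      -- the trees whose root has a left subtree with a vertex do not contribute
      have hnull : treeRootSum σ hK.homotopy N a -
          σ (a 0) * treeSum σ hK.homotopy l.length (fun j => a (j + 1)) ∈ hK.nullSubmodule := by
        have hmem : ((1, l.length) : ℕ × ℕ) ∈ antidiagonal N := by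
          rw [mem_antidiagonal]; omega
        rw [treeRootSum_eq, ← Finset.add_sum_erase _ _ hmem]
        simp only [treeSum_one, add_sub_cancel_left]
        refine Submodule.sum_mem _ fun ij hij => ?_
        obtain ⟨hne, hij⟩ := Finset.mem_erase.1 hij
        rw [mem_antidiagonal] at hij
        have hne1 : ij.1 ≠ 1 := by
          intro h
          exact hne (Prod.ext h (by simp only; omega))
        rcases Nat.eq_zero_or_pos ij.1 with h0 | h0
        · simp [h0]
        rcases Nat.eq_zero_or_pos ij.2 with h0' | h0'
        · simp [h0']
        -- the left subtree has a vertex, so its value is in the image of the homotopy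
        obtain ⟨ε₁, hε₁, h1⟩ := (ih ij.1 (by omega) ((c :: l).take ij.1)
          (by rw [List.length_take]; omega) (hl.sublist (List.take_sublist _ _)) a
          (fun j hj => by
            rw [List.length_take] at hj
            simpa using ha j (by omega))).1 (by omega)
        rw [h1, map_smul, hK.sigma_homotopy_smul_one, smul_mul_assoc, neg_mul]
        refine Submodule.smul_mem _ _ (Submodule.neg_mem _ ?_)
        by_cases h2 : ij.2 = 1
        · rw [h2, treeSum_one]
          rcases ha (0 + ij.1) (by omega) with h3 | h3
          · rw [h3]; exact hK.homotopy_mul_D_mem_null _ _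
          · rw [h3, mul_neg]; exact Submodule.neg_mem _ (hK.homotopy_mul_D_mem_null _ _)
        · obtain ⟨ε₂, hε₂, h4⟩ := (ih ij.2 (by omega) ((c :: l).drop ij.1)
            (by rw [List.length_drop]; omega) (hl.sublist (List.drop_sublist _ _))
            (fun j => a (j + ij.1)) (fun j hj => by
              rw [List.length_drop] at hj
              simpa [add_comm j] using ha (j + ij.1) (by omega))).1 (by omega)
          rw [h4, mul_smul_comm]
          exact Submodule.smul_mem _ _ (hK.homotopy_mul_homotopy_mem_null _ _)
      have hfirst : ∃ ε' : k, (ε' = 1 ∨ ε' = -1) ∧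
          σ (a 0) * treeSum σ hK.homotopy l.length (fun j => a (j + 1)) =
            ε' • (D c * hK.homotopy (g • 1)) := by
        rw [hcomb]
        rcases ha 0 (by simp) with h3 | h3
        · refine ⟨-ε, hneg ε hε, ?_⟩
          rw [h3, hK.sigma_D, mul_smul_comm, neg_mul, smul_neg, neg_smul]
          rfl
        · refine ⟨ε, hε, ?_⟩
          rw [h3, map_neg, hK.sigma_D, mul_smul_comm, neg_neg]
          rfl
      obtain ⟨ε', hε', hfirst⟩ := hfirst
      rw [hfirst, hK.mem_nullSubmodule, map_sub, map_sub, sub_eq_zero, sub_eq_zero] at hnull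
      constructor
      · intro _
        refine ⟨-ε', hneg ε' hε', ?_⟩
        rw [treeSum_eq σ _ (by omega), hnull.1, map_smul, hK.homotopy_D_mul_homotopy, neg_smul]
        rfl
      · intro _ _
        refine ⟨ε', hε', ?_⟩
        rw [hnull.2, map_smul, hK.proj_D_mul_homotopy]
        rfl

end Words

end IsKoszulDGA

end KoszulDGA

/-! ### The Clifford algebra acting on the cohomology -/

/-- Alternating functions of two indices pair to zero with symmetric ones. -/
lemma sum_sum_smul_eq_zero_of_alternating {S M ι : Type*} [CommRing S] [AddCommGroup M] [Module S M]
    [Fintype ι] [DecidableEq ι] (G : ι → ι → M) (h0 : ∀ i, G i i = 0)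
    (h1 : ∀ i j, G i j + G j i = 0) (v : ι → S) : ∑ i, ∑ j, (v i * v j) • G i j = 0 := by
  rw [← Finset.sum_product']
  refine Finset.sum_involution (fun ij _ => ij.swap) (fun ij _ => ?_) (fun ij _ h => ?_)
    (fun _ _ => by simp) (fun _ _ => Prod.swap_swap _)
  · simp only [Prod.fst_swap, Prod.snd_swap]
    rw [mul_comm (v ij.2), ← smul_add, h1, smul_zero]
  · intro h'
    apply h
    have : ij.2 = ij.1 := congrArg Prod.fst h'
    rw [this, h0, smul_zero]

section KoszulDGA

variable {k : Type*} [Field k] {n : ℕ} {B : Type*} [Ring B] [Algebra k B] [Algebra (R k n) B]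
  [IsScalarTower k (R k n) B]

namespace IsKoszulDGA

variable {𝒜 : ZMod 2 → Submodule k B} {σ d : B →ₗ[k] B} {θ D : Fin n → B}
  {f : Fin n → Fin n → R k n} (hK : IsKoszulDGA 𝒜 σ d θ D f)

omit [Algebra (R k n) B] [IsScalarTower k (R k n) B] in
lemma linearCombination_mem (hD : ∀ i, D i ∈ 𝒜 1) (v : Fin n → k) :
    Fintype.linearCombination k D v ∈ 𝒜 1 := by
  rw [Fintype.linearCombination_apply]
  exact Submodule.sum_mem _ fun i _ => Submodule.smul_mem _ _ (hD i)

include hK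

omit [IsScalarTower k (R k n) B] in
lemma d_linearCombination (v : Fin n → k) : d (Fintype.linearCombination k D v) = 0 := by
  rw [Fintype.linearCombination_apply, map_sum]
  exact Finset.sum_eq_zero fun i _ => by rw [map_smul, hK.d_D, smul_zero]

lemma linearCombination_mul_self (v : Fin n → k) :
    Fintype.linearCombination k D v * Fintype.linearCombination k D v =
      -((∑ i, ∑ j, (v i * v j) • f i j) • (1 : B)) := by
  have h := sum_sum_smul_eq_zero_of_alternating (fun i j => D i * D j + f i j • (1 : B))
    (fun i => by rw [hK.D_sq, Algebra.algebraMap_eq_smul_one, neg_add_cancel])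
    (fun i j => by
      rw [add_add_add_comm, hK.D_D, ← add_smul, Algebra.algebraMap_eq_smul_one, neg_add_cancel]) v
  rw [eq_neg_iff_add_eq_zero, ← h, Fintype.linearCombination_apply, Finset.sum_mul_sum,
    Finset.sum_smul, ← Finset.sum_add_distrib]
  refine Finset.sum_congr rfl fun i _ => ?_
  rw [Finset.sum_smul, ← Finset.sum_add_distrib]
  refine Finset.sum_congr rfl fun j _ => ?_
  rw [smul_add, smul_mul_smul_comm, smul_assoc]

/-- Products of cocycles may be computed before projecting to representatives. -/
lemma toCohomology_proj_mul_proj {x y : B} (hx : d x = 0) (hy : d y = 0) :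
    hK.contraction.toCohomology (hK.contraction.proj x * hK.contraction.proj y) =
      hK.contraction.toCohomology (x * y) := by
  have hxy : d (x * y) = 0 := by rw [hK.leibniz, hx, hy, zero_mul, mul_zero, add_zero]
  have h := hK.contraction.transfer_two_cohClass hK.toIsSuperDGA ⟨x, hx⟩ ⟨y, hy⟩ ⟨x * y, hxy⟩ rfl
  rw [hK.contraction.transfer_two hK.toIsSuperDGA] at h
  exact h.trans (hK.contraction.toCohomology_coe ⟨x * y, hxy⟩).symm

lemma toCohomology_mul_proj {x y : B} (hx : d x = 0) (hy : d y = 0) :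
    hK.contraction.toCohomology (x * hK.contraction.proj y) =
      hK.contraction.toCohomology (x * y) := by
  rw [← hK.toCohomology_proj_mul_proj hx (hK.contraction.d_proj_apply y),
    ContractingHomotopy.proj_proj, hK.toCohomology_proj_mul_proj hx hy]

lemma toCohomology_proj_mul {x y : B} (hx : d x = 0) (hy : d y = 0) :
    hK.contraction.toCohomology (hK.contraction.proj x * y) =
      hK.contraction.toCohomology (x * y) := by
  rw [← hK.toCohomology_proj_mul_proj (hK.contraction.d_proj_apply x) hy,
    ContractingHomotopy.proj_proj, hK.toCohomology_proj_mul_proj hx hy]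

omit [IsScalarTower k (R k n) B] in
lemma d_sigma {x : B} (hx : d x = 0) : d (σ x) = 0 := by
  rw [hK.parity_d, hx, map_zero, neg_zero]

/-- Right multiplication of the cohomology by the classes of the cocycles `∑ v_i D_i`, with the
sign of the opposite superalgebra. -/
def cliffordAction : (Fin n → k) →ₗ[k] Module.End k (Cohomology d) where
  toFun v := hK.contraction.toCohomology ∘ₗ
    LinearMap.mulRight k (Fintype.linearCombination k D v) ∘ₗ σ ∘ₗ hK.contraction.incl
  map_add' v v' := by
    refine LinearMap.ext fun c => ?_
    simp [mul_add]
  map_smul' r v := by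
    refine LinearMap.ext fun c => ?_
    simp

lemma cliffordAction_apply (v : Fin n → k) (c : Cohomology d) :
    hK.cliffordAction v c = hK.contraction.toCohomology
      (σ (hK.contraction.incl c) * Fintype.linearCombination k D v) := rfl

lemma cliffordAction_toCohomology (v : Fin n → k) {z : B} (hz : d z = 0) :
    hK.cliffordAction v (hK.contraction.toCohomology z) =
      hK.contraction.toCohomology (σ z * Fintype.linearCombination k D v) := by
  rw [cliffordAction_apply, ContractingHomotopy.incl_toCohomology,
    hK.contraction.parity_proj hK.toIsSuperDGA,
    hK.toCohomology_proj_mul (hK.d_sigma hz) (hK.d_linearCombination v)]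

lemma toCohomology_smul (a : R k n) (b : B) :
    hK.contraction.toCohomology (a • b) =
      MvPowerSeries.constantCoeff a • hK.contraction.toCohomology b := by
  apply hK.contraction.incl_injective
  rw [map_smul hK.contraction.incl, ContractingHomotopy.incl_toCohomology,
    ContractingHomotopy.incl_toCohomology, hK.proj_smul]

variable {Q : QuadraticForm k (Fin n → k)}
  (hQ : ∀ v, Q v = ∑ i, ∑ j, v i * v j * MvPowerSeries.constantCoeff (f i j))
include hQ

lemma cliffordAction_sq (v : Fin n → k) :
    hK.cliffordAction v * hK.cliffordAction v = algebraMap k _ (Q v) := by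
  refine LinearMap.ext fun c => ?_
  rw [Module.End.mul_apply, cliffordAction_apply hK v c, hK.cliffordAction_toCohomology,
    hK.parity_mul, hK.parity_parity,
    hK.parity_apply (linearCombination_mem hK.D_mem v), neg_one_pow_odd_smul,
    mul_neg, neg_mul, mul_assoc, hK.linearCombination_mul_self, mul_neg, neg_neg,
    mul_smul_comm, mul_one, hK.toCohomology_smul, ContractingHomotopy.toCohomology_incl,
    Module.algebraMap_end_apply, hQ]
  · congr 1
    simp only [map_sum]
    refine Finset.sum_congr rfl fun i _ => Finset.sum_congr rfl fun j _ => ?_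
    rw [← smul_eq_mul, ← C_smul (n := n), smul_eq_mul, map_mul, MvPowerSeries.constantCoeff_C,
      smul_eq_mul]
  · rw [hK.leibniz, hK.d_linearCombination, hK.d_sigma (hK.contraction.d_incl c), zero_mul,
      mul_zero, add_zero]

/-- The action of the Clifford algebra on the class of `1`. -/
def ofClifford : CliffordAlgebra Q →ₗ[k] Cohomology d :=
  LinearMap.applyₗ (hK.contraction.toCohomology 1) ∘ₗ
    (CliffordAlgebra.lift Q ⟨hK.cliffordAction, hK.cliffordAction_sq hQ⟩).toLinearMap

lemma ofClifford_one : hK.ofClifford hQ 1 = hK.contraction.toCohomology 1 := by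
  simp [ofClifford]

lemma ofClifford_ι_mul (v : Fin n → k) (a : CliffordAlgebra Q) :
    hK.ofClifford hQ (CliffordAlgebra.ι Q v * a) = hK.cliffordAction v (hK.ofClifford hQ a) := by
  simp [ofClifford]

lemma ofClifford_algebraMap (r : k) :
    hK.ofClifford hQ (algebraMap k _ r) = r • hK.contraction.toCohomology 1 := by
  rw [Algebra.algebraMap_eq_smul_one, map_smul, ofClifford_one]

omit hQ [IsScalarTower k (R k n) B] in
lemma sigma_one : σ 1 = 1 := by
  rw [hK.parity_apply hK.one_mem]
  simp

lemma ofClifford_ι (v : Fin n → k) :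
    hK.ofClifford hQ (CliffordAlgebra.ι Q v) =
      hK.contraction.toCohomology (Fintype.linearCombination k D v) := by
  rw [← mul_one (CliffordAlgebra.ι Q v), ofClifford_ι_mul, ofClifford_one,
    hK.cliffordAction_toCohomology v hK.d_one, hK.sigma_one, one_mul]

/-- Acting on `x` amounts to multiplying `x` from the right. The sign by which an element
of the Clifford algebra passes `x` is encoded by `J`. -/
lemma lift_cliffordAction_apply {ε : k} (J : CliffordAlgebra Q →ₐ[k] CliffordAlgebra Q)
    (hJ : ∀ v, J (CliffordAlgebra.ι Q v) = ε • CliffordAlgebra.ι Q v) {x : Cohomology d}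
    (hx : σ (hK.contraction.incl x) = ε • hK.contraction.incl x) (a : CliffordAlgebra Q) :
    CliffordAlgebra.lift Q ⟨hK.cliffordAction, hK.cliffordAction_sq hQ⟩ a x =
      hK.contraction.toCohomology
        (hK.contraction.incl x * hK.contraction.incl (hK.ofClifford hQ (J a))) := by
  induction a using CliffordAlgebra.left_induction with
  | algebraMap r =>
    rw [AlgHom.commutes, AlgHom.commutes, ofClifford_algebraMap, Module.algebraMap_end_apply,
      map_smul, ContractingHomotopy.incl_toCohomology, hK.proj_one, mul_smul_comm, mul_one,
      map_smul, ContractingHomotopy.toCohomology_incl]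
  | add a b ha hb =>
    simp only [map_add, LinearMap.add_apply, mul_add, ha, hb]
  | ι_mul a v ih =>
    have hy : d (hK.contraction.incl (hK.ofClifford hQ (J a))) = 0 := hK.contraction.d_incl _
    have hxy : d (hK.contraction.incl x * hK.contraction.incl (hK.ofClifford hQ (J a))) = 0 := by
      rw [hK.leibniz, hy, hK.contraction.d_incl, zero_mul, mul_zero, add_zero]
    rw [map_mul, Module.End.mul_apply, ih, CliffordAlgebra.lift_ι_apply,
      hK.cliffordAction_toCohomology v hxy, hK.parity_mul, hx, map_mul J, hJ]
    simp only [smul_mul_assoc, map_smul, mul_smul_comm]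
    rw [ofClifford_ι_mul, cliffordAction_apply, ContractingHomotopy.incl_toCohomology,
      hK.toCohomology_mul_proj (hK.contraction.d_incl x), mul_assoc]
    rw [hK.leibniz, hK.d_linearCombination, hK.d_sigma hy, zero_mul, mul_zero, add_zero]

lemma ofClifford_mul {ε : k} (J : CliffordAlgebra Q →ₐ[k] CliffordAlgebra Q)
    (hJ : ∀ v, J (CliffordAlgebra.ι Q v) = ε • CliffordAlgebra.ι Q v) (a b : CliffordAlgebra Q)
    (hb : σ (hK.contraction.incl (hK.ofClifford hQ b)) =
      ε • hK.contraction.incl (hK.ofClifford hQ b)) :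
    hK.ofClifford hQ (a * b) = hK.contraction.toCohomology
      (hK.contraction.incl (hK.ofClifford hQ b) *
        hK.contraction.incl (hK.ofClifford hQ (J a))) := by
  rw [← hK.lift_cliffordAction_apply hQ J hJ hb]
  simp [ofClifford]

omit hQ in
lemma cliffordAction_mem (v : Fin n → k) {s : ZMod 2} {c : Cohomology d}
    (hc : c ∈ cohGrading 𝒜 d s) : hK.cliffordAction v c ∈ cohGrading 𝒜 d (s + 1) :=
  hK.contraction.toCohomology_mem hK.toIsSuperDGA (hK.mul_mem
    (hK.parity_mem (hK.contraction.incl_mem hK.toIsSuperDGA hc))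
    (linearCombination_mem hK.D_mem v))

lemma ofClifford_mem {s : ZMod 2} {a : CliffordAlgebra Q}
    (ha : a ∈ CliffordAlgebra.evenOdd Q s) : hK.ofClifford hQ a ∈ cohGrading 𝒜 d s := by
  have h1 : hK.contraction.toCohomology 1 ∈ cohGrading 𝒜 d 0 :=
    hK.contraction.toCohomology_mem hK.toIsSuperDGA hK.one_mem
  induction a, ha using CliffordAlgebra.evenOdd_induction with
  | range_ι_pow v h =>
    rcases zmod_two_eq s with rfl | rfl
    · rw [show (0 : ZMod 2).val = 0 from rfl, pow_zero] at h
      obtain ⟨r, rfl⟩ := Submodule.mem_one.1 h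
      rw [ofClifford_algebraMap]
      exact Submodule.smul_mem _ _ h1
    · rw [show (1 : ZMod 2).val = 1 from rfl, pow_one] at h
      obtain ⟨m, rfl⟩ := h
      rw [ofClifford_ι]
      exact hK.contraction.toCohomology_mem hK.toIsSuperDGA (linearCombination_mem hK.D_mem m)
  | add x y hx hy h1 h2 => rw [map_add]; exact Submodule.add_mem _ h1 h2
  | ι_mul_ι_mul m₁ m₂ x hx ih =>
    rw [mul_assoc, ofClifford_ι_mul, ofClifford_ι_mul]
    have := hK.cliffordAction_mem m₁ (hK.cliffordAction_mem m₂ ih)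
    rwa [add_assoc, show (1 : ZMod 2) + 1 = 0 from rfl, add_zero] at this

lemma ofClifford_mul_of_mem {s t : ZMod 2} {a b : CliffordAlgebra Q}
    (ha : a ∈ CliffordAlgebra.evenOdd Q s) (hb : b ∈ CliffordAlgebra.evenOdd Q t) :
    hK.ofClifford hQ (a * b) = (-1 : k) ^ (s.val * t.val) • hK.contraction.toCohomology
      (hK.contraction.incl (hK.ofClifford hQ b) *
        hK.contraction.incl (hK.ofClifford hQ a)) := by
  have h1 := hK.parity_apply (hK.contraction.incl_mem hK.toIsSuperDGA (hK.ofClifford_mem hQ hb))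
  have v0 : (0 : ZMod 2).val = 0 := rfl
  have v1 : (1 : ZMod 2).val = 1 := rfl
  rcases zmod_two_eq t with rfl | rfl
  · rw [v0, pow_zero] at h1
    rw [v0, mul_zero, pow_zero, one_smul]
    exact hK.ofClifford_mul hQ (AlgHom.id k _) (fun v => (one_smul _ _).symm) a b h1
  · rw [v1, pow_one] at h1
    rw [v1, mul_one, hK.ofClifford_mul hQ CliffordAlgebra.involute (fun v => by simp) a b h1]
    rcases zmod_two_eq s with rfl | rfl
    · rw [CliffordAlgebra.involute_eq_of_mem_even ha, v0, pow_zero, one_smul]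
    · rw [CliffordAlgebra.involute_eq_of_mem_odd ha, v1, pow_one, neg_one_smul, map_neg, map_neg,
        mul_neg, map_neg]

lemma ofClifford_surjective : Function.Surjective (hK.ofClifford hQ) := by
  have hD : ∀ J : Finset (Fin n), hK.contraction.toCohomology (orderedProd D J) ∈
      LinearMap.range (hK.ofClifford hQ) := by
    intro J
    induction J using Finset.induction_on_max with
    | empty => exact ⟨1, by rw [ofClifford_one, orderedProd_empty]⟩
    | insert m J hm ih =>
      obtain ⟨a, ha⟩ := ih
      refine ⟨CliffordAlgebra.involute a * CliffordAlgebra.ι Q (Pi.single m 1), ?_⟩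
      have hm1 : hK.ofClifford hQ (CliffordAlgebra.ι Q (Pi.single m 1)) =
          hK.contraction.toCohomology (D m) := by
        rw [ofClifford_ι, Fintype.linearCombination_apply_single, one_smul]
      rw [hK.ofClifford_mul hQ (ε := -1) CliffordAlgebra.involute (fun v => by simp), hm1,
        CliffordAlgebra.involute_involute, ha, ContractingHomotopy.incl_toCohomology,
        ContractingHomotopy.incl_toCohomology, hK.toCohomology_proj_mul_proj (hK.d_D m)
          (hK.d_orderedProd_D J), orderedProd_insert D hm]
      rw [hm1, ContractingHomotopy.incl_toCohomology, hK.contraction.parity_proj hK.toIsSuperDGA,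
        hK.sigma_D, map_neg, neg_one_smul]
  rw [← LinearMap.range_eq_top, eq_top_iff]
  intro c _
  rw [← hK.contraction.toCohomology_incl c,
    ← Submodule.ker_mkQ (LinearMap.range (hK.ofClifford hQ))]
  refine LinearMap.congr_fun (f := Submodule.mkQ _ ∘ₗ hK.contraction.toCohomology) (g := 0)
    (hK.linearMap_ext fun a I J => ?_) _
  have h1 : hK.contraction.toCohomology (monomial θ D I J) ∈
      LinearMap.range (hK.ofClifford hQ) := by
    by_cases hI : I = ∅
    · rw [hI, monomial, orderedProd_empty, one_mul]
      exact hD J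
    · have h2 := hK.contraction_proj 1 I J
      rw [if_neg hI, one_smul] at h2
      rw [← hK.contraction.toCohomology_incl (hK.contraction.toCohomology _),
        ContractingHomotopy.incl_toCohomology, h2, map_zero]
      exact Submodule.zero_mem _
  have h2 : Submodule.mkQ (LinearMap.range (hK.ofClifford hQ))
      (hK.contraction.toCohomology (monomial θ D I J)) = 0 :=
    (Submodule.Quotient.mk_eq_zero _).2 h1
  rw [LinearMap.comp_apply, hK.toCohomology_smul, map_smul, LinearMap.zero_apply, h2, smul_zero]

omit hK hQ in
lemma span_orderedProd_clifford : Submodule.span k (Set.range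
    (orderedProd fun i : Fin n => CliffordAlgebra.ι Q (Pi.single i 1))) = ⊤ := by
  refine eq_top_of_mul_mem (CliffordAlgebra.adjoin_range_ι (Q := Q)) _
    (Submodule.subset_span ⟨∅, orderedProd_empty _⟩) ?_
  rintro _ ⟨v, rfl⟩ y hy
  have hv : CliffordAlgebra.ι Q v = ∑ i, v i • CliffordAlgebra.ι Q (Pi.single i 1) := by
    conv_lhs => rw [pi_eq_sum_univ' v]
    simp [map_sum, Pi.single]
  rw [hv, Finset.sum_mul]
  refine Submodule.sum_mem _ fun i _ => ?_
  rw [smul_mul_assoc]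
  exact Submodule.smul_mem _ _ (mul_orderedProd_mem_span _
    (fun i j => ⟨_, CliffordAlgebra.ι_mul_ι_add_swap _ _⟩)
    (fun i => ⟨_, CliffordAlgebra.ι_sq_scalar _ _⟩) i hy)

omit hQ in
lemma linearIndependent_toCohomology : LinearIndependent k
    (fun J : Finset (Fin n) => hK.contraction.toCohomology (monomial θ D ∅ J)) := by
  refine LinearIndependent.of_comp hK.contraction.incl ?_
  have h1 : (hK.contraction.incl ∘ fun J : Finset (Fin n) =>
      hK.contraction.toCohomology (monomial θ D ∅ J)) = hK.basis ∘ fun J => (∅, J) := by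
    funext J
    simp only [Function.comp_apply]
    rw [ContractingHomotopy.incl_toCohomology, hK.proj_monomial_empty, hK.basis_apply]
  rw [h1]
  exact (hK.basis.linearIndependent.restrict_scalars' k).comp _
    fun J J' h => (Prod.ext_iff.1 h).2

/-- The Clifford algebra has dimension at most `2 ^ n`, the cohomology at least that. -/
lemma ofClifford_bijective : Function.Bijective (hK.ofClifford hQ) := by
  have hs := hK.ofClifford_surjective hQ
  have hfin : Module.Finite k (CliffordAlgebra Q) :=
    ⟨by rw [← span_orderedProd_clifford]; exact Submodule.fg_span (Set.finite_range _)⟩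
  have hfin' : Module.Finite k (Cohomology d) := Module.Finite.of_surjective _ hs
  have h1 : Module.finrank k (CliffordAlgebra Q) ≤ Fintype.card (Finset (Fin n)) := by
    rw [← finrank_top k (CliffordAlgebra Q), ← span_orderedProd_clifford (Q := Q)]
    exact finrank_range_le_card _
  have h2 := hK.linearIndependent_toCohomology.fintype_card_le_finrank
  have h3 := LinearMap.finrank_le_finrank_of_surjective hs
  exact ⟨(LinearMap.injective_iff_surjective_of_finrank_eq_finrank
    (le_antisymm (h1.trans h2) h3)).2 hs, hs⟩

lemma map_evenOdd_ofClifford (s : ZMod 2) :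
    (CliffordAlgebra.evenOdd Q s).map (hK.ofClifford hQ) = cohGrading 𝒜 d s := by
  apply le_antisymm
  · rintro _ ⟨a, ha, rfl⟩
    exact hK.ofClifford_mem hQ ha
  · intro c hc
    obtain ⟨a, rfl⟩ := hK.ofClifford_surjective hQ c
    obtain ⟨a₀, h0, a₁, h1, rfl⟩ : ∃ a₀ ∈ CliffordAlgebra.evenOdd Q s,
        ∃ a₁ ∈ CliffordAlgebra.evenOdd Q (s + 1), a = a₀ + a₁ := by
      have h := (CliffordAlgebra.evenOdd_isCompl (Q := Q)).codisjoint.eq_top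
      have ha : a ∈ CliffordAlgebra.evenOdd Q 0 ⊔ CliffordAlgebra.evenOdd Q 1 :=
        h ▸ Submodule.mem_top
      obtain ⟨x, hx, y, hy, rfl⟩ := Submodule.mem_sup.1 ha
      rcases zmod_two_eq s with rfl | rfl
      · exact ⟨x, hx, y, hy, rfl⟩
      · exact ⟨y, hy, x, hx, add_comm _ _⟩
    have h2 : hK.ofClifford hQ a₁ ∈ cohGrading 𝒜 d s := by
      have := Submodule.sub_mem _ hc (hK.ofClifford_mem hQ h0)
      rwa [map_add, add_sub_cancel_left] at this
    have h3 : hK.ofClifford hQ a₁ = 0 := by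
      apply hK.contraction.incl_injective
      rw [map_zero]
      have h4 := hK.contraction.incl_mem hK.toIsSuperDGA h2
      have h5 := hK.contraction.incl_mem hK.toIsSuperDGA (hK.ofClifford_mem hQ h1)
      rcases zmod_two_eq s with rfl | rfl
      · exact hK.eq_zero_of_mem _ h4 h5
      · exact hK.eq_zero_of_mem _ h5 h4
    exact ⟨a₀, h0, by rw [map_add, h3, add_zero]⟩

omit hQ in
/-- In one variable, the homotopy does not depend on whether `D_j` or `δ = D_j + g θ_j` is used as
the second generator. -/
lemma homotopy_smul_of_forall_eq {j : Fin n} (hj : ∀ i, i = j) {δ : B} {g : R k n}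
    (hδθ : δ * θ j + θ j * δ = 1) (hδδ : δ * δ = 0) (hD : D j = δ - g • θ j) (c : k) (b : R k n)
    {ω : B} (hω : ω ∈ Algebra.adjoin k {θ j, δ}) :
    hK.homotopy ((MvPowerSeries.C c + MvPowerSeries.X j * b : R k n) • ω) = b • (θ j * ω) := by
  have hθθ := hK.theta_sq j
  have huniv : (Finset.univ : Finset (Fin n)) = {j} :=
    Finset.eq_singleton_iff_unique_mem.2 ⟨Finset.mem_univ _, fun i _ => hj i⟩
  have hδ : δ * θ j = 1 - θ j * δ := eq_sub_of_add_eq hδθ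
  have hspan : ω ∈ Submodule.span k {1, θ j, δ, θ j * δ} := by
    have m1 : (1 : B) ∈ Submodule.span k {1, θ j, δ, θ j * δ} := Submodule.subset_span (by simp)
    have m2 : θ j ∈ Submodule.span k {1, θ j, δ, θ j * δ} := Submodule.subset_span (by simp)
    have m3 : δ ∈ Submodule.span k {1, θ j, δ, θ j * δ} := Submodule.subset_span (by simp)
    have m4 : θ j * δ ∈ Submodule.span k {1, θ j, δ, θ j * δ} := Submodule.subset_span (by simp)
    refine mem_of_mem_adjoin _ m1 (fun x hx y hy => ?_) hω
    induction hy using Submodule.span_induction with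
    | mem y hy =>
      rcases hx with rfl | rfl <;> rcases hy with rfl | rfl | rfl | rfl
      · rwa [mul_one]
      · rw [hθθ]; exact Submodule.zero_mem _
      · exact m4
      · rw [← mul_assoc, hθθ, zero_mul]; exact Submodule.zero_mem _
      · rwa [mul_one]
      · rw [hδ]; exact Submodule.sub_mem _ m1 m4
      · rw [hδδ]; exact Submodule.zero_mem _
      · rw [← mul_assoc, hδ, sub_mul, one_mul, mul_assoc, hδδ, mul_zero, sub_zero]; exact m3
    | zero => simp
    | add x y _ _ hx hy => rw [mul_add]; exact Submodule.add_mem _ hx hy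
    | smul c x _ hx => rw [mul_smul_comm]; exact Submodule.smul_mem _ _ hx
  set r : R k n := MvPowerSeries.C c + MvPowerSeries.X j * b with hr
  have hdiv : divX j r = b := by
    rw [hr, map_add, divX_C, zero_add, divX_X_mul_self]
    ext α
    rw [coeff_setZero, if_pos]
    intro l hl
    exact absurd (Finset.mem_filter.1 hl).2 (by rw [hj l]; exact lt_irrefl _)
  have habove : above ({j} : Finset (Fin n)) = ∅ := by
    rw [above, huniv]
    exact Finset.filter_singleton _ _ |>.trans (by simp)
  have hempty : ∀ (a : R k n) J, hK.homotopy (a • orderedProd D J) =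
      divX j a • (θ j * orderedProd D J) := by
    intro a J
    have := hK.homotopy_smul_monomial a ∅ J
    rw [above_empty, huniv, Finset.sum_singleton] at this
    simpa [monomial] using this
  have hone : ∀ (a : R k n) J, hK.homotopy (a • (θ j * orderedProd D J)) = 0 := by
    intro a J
    have := hK.homotopy_smul_monomial a {j} J
    rwa [habove, Finset.sum_empty, monomial, orderedProd_singleton] at this
  have hθD : θ j * D j = θ j * δ := by
    rw [hD, mul_sub, mul_smul_comm, hθθ, smul_zero, sub_zero]
  have e1 := fun a => hempty a ∅
  have e2 := fun a => hempty a {j}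
  have e3 := fun a => hone a ∅
  have e4 := fun a => hone a {j}
  simp only [orderedProd_empty, orderedProd_singleton, mul_one] at e1 e2 e3 e4
  rw [hθD] at e2 e4
  clear hω
  induction hspan using Submodule.span_induction with
  | mem y hy =>
    rcases hy with h | h | h | h
    · rw [h, e1, hdiv, mul_one]
    · rw [h, e3, hθθ, smul_zero]
    · have h1 : δ = D j + g • θ j := by rw [hD, sub_add_cancel]
      have h2 : r • δ = r • D j + (r * g) • θ j := by rw [h1, smul_add, smul_smul]
      rw [h, h2, map_add, e2, e3, add_zero, hdiv]
    · rw [h, e4, ← mul_assoc, hθθ, zero_mul, smul_zero]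
  | zero => simp
  | add x y _ _ hx hy => rw [smul_add, map_add, hx, hy, mul_add, smul_add]
  | smul c x _ hx => rw [smul_comm, map_smul, hx, mul_smul_comm, smul_comm]

end IsKoszulDGA

end KoszulDGA

/-! ### Change of generators -/

section Fermions

variable {S B : Type*} [CommRing S] [Ring B] [Algebra S B] {n : ℕ} {θ δ : Fin n → B}

namespace IsFermionic

variable (hF : IsFermionic θ δ) (g : Fin n → Fin n → S)
include hF

lemma sum_mul_sum_self (i : Fin n) : (∑ j, g i j • θ j) * (∑ j, g i j • θ j) = 0 := by
  rw [Finset.sum_mul_sum]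
  simp only [smul_mul_smul_comm]
  exact sum_sum_smul_eq_zero_of_alternating (fun i j => θ i * θ j) hF.theta_sq hF.theta_anticomm _

lemma sum_mul_sum_anticomm (i l : Fin n) : (∑ j, g i j • θ j) * (∑ j, g l j • θ j) +
    (∑ j, g l j • θ j) * (∑ j, g i j • θ j) = 0 := by
  rw [Finset.sum_mul_sum, Finset.sum_mul_sum, Finset.sum_comm, ← Finset.sum_add_distrib]
  refine Finset.sum_eq_zero fun a _ => ?_
  rw [← Finset.sum_add_distrib]
  refine Finset.sum_eq_zero fun b _ => ?_
  rw [smul_mul_smul_comm, smul_mul_smul_comm, mul_comm (g l a), ← smul_add, hF.theta_anticomm,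
    smul_zero]

lemma del_mul_sum (i l : Fin n) :
    δ i * (∑ j, g l j • θ j) + (∑ j, g l j • θ j) * δ i = algebraMap S B (g l i) := by
  rw [Finset.mul_sum, Finset.sum_mul, ← Finset.sum_add_distrib]
  simp only [mul_smul_comm, smul_mul_assoc, ← smul_add, hF.del_theta]
  simp [Algebra.algebraMap_eq_smul_one]

lemma sum_mul_theta_anticomm (i l : Fin n) :
    (∑ j, g i j • θ j) * θ l + θ l * (∑ j, g i j • θ j) = 0 := by
  rw [Finset.mul_sum, Finset.sum_mul, ← Finset.sum_add_distrib]
  simp only [mul_smul_comm, smul_mul_assoc, ← smul_add, hF.theta_anticomm]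
  simp

lemma shift_theta (i l : Fin n) : (δ i - ∑ j, g i j • θ j) * θ l + θ l * (δ i - ∑ j, g i j • θ j) =
    if i = l then 1 else 0 := by
  rw [← hF.del_theta, ← sub_zero (δ i * θ l + θ l * δ i), ← hF.sum_mul_theta_anticomm g i l]
  noncomm_ring

lemma shift_shift (i l : Fin n) :
    (δ i - ∑ j, g i j • θ j) * (δ l - ∑ j, g l j • θ j) +
      (δ l - ∑ j, g l j • θ j) * (δ i - ∑ j, g i j • θ j) = -algebraMap S B (g i l + g l i) := by
  have h : ∀ a b s t : B, (a - s) * (b - t) + (b - t) * (a - s) =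
      (a * b + b * a) + (s * t + t * s) - ((b * s + s * b) + (a * t + t * a)) := by
    intro a b s t
    noncomm_ring
  rw [h, hF.del_anticomm, hF.sum_mul_sum_anticomm, hF.del_mul_sum, hF.del_mul_sum, map_add,
    add_zero, zero_sub]

lemma shift_sq (i : Fin n) :
    (δ i - ∑ j, g i j • θ j) * (δ i - ∑ j, g i j • θ j) = -algebraMap S B (g i i) := by
  have h : ∀ a s : B, (a - s) * (a - s) = a * a + s * s - (a * s + s * a) := by
    intro a s
    noncomm_ring
  rw [h, hF.del_sq, hF.sum_mul_sum_self, hF.del_mul_sum, add_zero, zero_sub]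

omit hF in
lemma adjoin_shift (h : Algebra.adjoin S (Set.range θ ∪ Set.range δ) = ⊤) :
    Algebra.adjoin S (Set.range θ ∪ Set.range fun i => δ i - ∑ j, g i j • θ j) = ⊤ := by
  rw [eq_top_iff, ← h, Algebra.adjoin_le_iff]
  have hθ : ∀ i, θ i ∈
      Algebra.adjoin S (Set.range θ ∪ Set.range fun i => δ i - ∑ j, g i j • θ j) :=
    fun i => Algebra.subset_adjoin (Or.inl ⟨i, rfl⟩)
  rintro _ (⟨i, rfl⟩ | ⟨i, rfl⟩)
  · exact hθ i
  · have h1 : δ i - ∑ j, g i j • θ j ∈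
        Algebra.adjoin S (Set.range θ ∪ Set.range fun i => δ i - ∑ j, g i j • θ j) :=
      Algebra.subset_adjoin (Or.inr ⟨i, rfl⟩)
    rw [← sub_add_cancel (δ i) (∑ j, g i j • θ j)]
    exact Subalgebra.add_mem _ h1 (Subalgebra.sum_mem _ fun j _ => Subalgebra.smul_mem _ (hθ j) _)

end IsFermionic

end Fermions

/-! ### Multi-indices and words -/

section Words

variable {n : ℕ}

lemma pairwise_blocks (i : Fin n →₀ ℕ) : (blocks i).Pairwise (· ≤ ·) := by
  rw [blocks, List.pairwise_flatMap]
  refine ⟨fun a _ => List.pairwise_replicate.2 (Or.inr le_rfl), ?_⟩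
  refine (List.pairwise_lt_finRange n).imp fun {a b} hab x hx y hy => ?_
  rw [List.eq_of_mem_replicate hx, List.eq_of_mem_replicate hy]
  exact hab.le

lemma sum_map_single_blocks (i : Fin n →₀ ℕ) :
    ((blocks i).map fun c => Finsupp.single c 1).sum = i := by
  rw [blocks, List.map_flatMap, List.flatMap, List.sum_flatten, List.map_map]
  have h1 : (List.sum ∘ fun a => (List.replicate (i a) a).map fun c => Finsupp.single c 1) =
      fun a => Finsupp.single a (i a) := by
    funext a
    simp
  rw [h1, ← List.ofFn_eq_map, List.sum_ofFn]
  exact Finsupp.univ_sum_single i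

lemma degree_sum_map_single (l : List (Fin n)) :
    ((l.map fun c => Finsupp.single c 1).sum : Fin n →₀ ℕ).degree = l.length := by
  induction l with
  | nil => simp
  | cons c l ih => rw [List.map_cons, List.sum_cons, map_add, ih, List.length_cons]; simp [add_comm]

end Words

/-! ### The quadratic part -/

section QuadraticPart

variable {k : Type*} [Field k] {n : ℕ}

lemma constantCoeff_divX_divX {i j : Fin n} (hij : i ≤ j) (w : R k n) :
    MvPowerSeries.constantCoeff (divX i (divX j w)) =
      MvPowerSeries.coeff (Finsupp.single i 1 + Finsupp.single j 1) w := by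
  have := coeff_foldr_divX [i, j] w (by simpa using hij) 0 (by simp)
  simpa using this

/-- The quadratic part of `w = ∑ f_{ij} x_i x_j` has the constant terms of the `f_{ij}` as
coefficients. -/
lemma quadraticPart_apply {w : R k n} {f : Fin n → Fin n → R k n}
    (hf : ∀ i, f i i = divX i (divX i w))
    (hf' : ∀ i j, i < j → f i j + f j i = divX i (divX j w)) (v : Fin n → k) :
    quadraticPart w v = ∑ i, ∑ j, v i * v j * MvPowerSeries.constantCoeff (f i j) := by
  have hlt : ∀ i j, i < j → MvPowerSeries.constantCoeff (f i j) +
      MvPowerSeries.constantCoeff (f j i) =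
      MvPowerSeries.coeff (Finsupp.single i 1 + Finsupp.single j 1) w := fun i j hij => by
    rw [← map_add, hf' i j hij, constantCoeff_divX_divX hij.le]
  have h := sum_sum_smul_eq_zero_of_alternating (fun i j : Fin n =>
    (if i ≤ j then MvPowerSeries.coeff (Finsupp.single i 1 + Finsupp.single j 1) w else 0) -
      MvPowerSeries.constantCoeff (f i j))
    (fun i => by simp only [le_refl, if_true]; rw [hf, constantCoeff_divX_divX le_rfl, sub_self])
    (fun i j => by
      rcases lt_trichotomy i j with hij | hij | hij
      · rw [if_pos hij.le, if_neg hij.not_ge]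
        linear_combination -hlt i j hij
      · subst hij
        rw [if_pos le_rfl, hf, constantCoeff_divX_divX le_rfl, sub_self, add_zero]
      · rw [if_pos hij.le, if_neg hij.not_ge]
        linear_combination -hlt j i hij) v
  simp only [smul_eq_mul, mul_sub, Finset.sum_sub_distrib, sub_eq_zero] at h
  rw [← h, quadraticPart, Matrix.toQuadraticForm', LinearMap.BilinMap.toQuadraticMap_apply,
    Matrix.toLinearMap₂'_apply]
  refine Finset.sum_congr rfl fun i _ => Finset.sum_congr rfl fun j _ => ?_
  simp only [smul_eq_mul, Matrix.of_apply, mul_assoc]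

end QuadraticPart

/-! ### The induced operations -/

section KoszulDGA

variable {k : Type*} [Field k] {n : ℕ} {B : Type*} [Ring B] [Algebra k B] [Algebra (R k n) B]
  [IsScalarTower k (R k n) B]
  {𝒜 : ZMod 2 → Submodule k B} {σ d : B →ₗ[k] B} {θ D : Fin n → B}
  {f : Fin n → Fin n → R k n}

/-- The induced operations on sorted words in the classes of the `D_i`. -/
lemma IsKoszulDGA.transfer_word (hK : IsKoszulDGA 𝒜 σ d θ D f) {w : R k n}
    (hf : ∀ i, f i i = divX i (divX i w))
    (hf' : ∀ i j, i < j → f i j + f j i = divX i (divX j w)) (one : LinearMap.ker d)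
    (hone : (one : B) = 1) (dbar : Fin n → LinearMap.ker d) (hdbar : ∀ i, (dbar i : B) = D i)
    (l : List (Fin n)) (hl : l.Pairwise (· ≤ ·)) (h2 : 2 ≤ l.length)
    (hl2 : l.length = 2 → ∀ x ∈ l, ∀ y ∈ l, x = y) :
    ∃ ε : k, (ε = 1 ∨ ε = -1) ∧
      hK.contraction.transfer σ l.length (fun j => cohClass d (dbar (l.get j))) =
        ε • MvPowerSeries.coeff (l.map fun c => Finsupp.single c 1).sum w • cohClass d one := by
  -- the `D_i` are the representatives of their classes, and `σ` changes only their signs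
  have hproj : ∀ i, hK.contraction.proj (D i) = D i := fun i => by
    have := hK.proj_monomial_empty {i}
    rwa [monomial, orderedProd_empty, one_mul, orderedProd_singleton] at this
  have hsign : ∀ m : ℕ, (-1 : k) ^ m = 1 ∨ (-1 : k) ^ m = -1 := neg_one_pow_eq_or k
  obtain ⟨ε, hε, h⟩ := (hK.treeRootSum_word hf hf' l.length l rfl hl
    (fun j => if hj : j < l.length then (σ ^ (l.length - 1 - j))
      (hK.contraction.incl (cohClass d (dbar (l.get ⟨j, hj⟩)))) else 0) (fun j hj => by
        rw [dif_pos hj, ContractingHomotopy.incl_cohClass, hdbar, hproj,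
          hK.parity_pow_apply (hK.D_mem _)]
        rcases hsign ((l.length - 1 - j) * (1 : ZMod 2).val) with h | h
        · left; rw [h, one_smul]; rfl
        · right; rw [h, neg_one_smul]; rfl)).2 h2 hl2
  refine ⟨ε, hε, ?_⟩
  rw [ContractingHomotopy.transfer_eq]
  apply hK.contraction.incl_injective
  rw [ContractingHomotopy.incl_toCohomology, hK.contraction_h, h, map_smul, map_smul,
    ContractingHomotopy.incl_cohClass, hone, hK.proj_one]
  have h1 := coeff_foldr_divX l w hl 0 (by simp)
  rw [zero_add, MvPowerSeries.coeff_zero_eq_constantCoeff_apply] at h1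
  rw [h1]

lemma IsKoszulDGA.transfer_blocks (hK : IsKoszulDGA 𝒜 σ d θ D f) {w : R k n}
    (hf : ∀ i, f i i = divX i (divX i w))
    (hf' : ∀ i j, i < j → f i j + f j i = divX i (divX j w)) (one : LinearMap.ker d)
    (hone : (one : B) = 1) (dbar : Fin n → LinearMap.ker d) (hdbar : ∀ i, (dbar i : B) = D i)
    (i : Fin n →₀ ℕ) (hi : 2 ≤ i.degree)
    (hne : ∀ a b : Fin n, a ≠ b → i ≠ Finsupp.single a 1 + Finsupp.single b 1) :
    hK.contraction.transfer σ (blocks i).length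
        (fun j => cohClass d (dbar ((blocks i).get j))) =
          MvPowerSeries.coeff i w • cohClass d one ∨
      hK.contraction.transfer σ (blocks i).length
        (fun j => cohClass d (dbar ((blocks i).get j))) =
          -(MvPowerSeries.coeff i w • cohClass d one) := by
  have hsum := sum_map_single_blocks i
  have hlen : (blocks i).length = i.degree := by rw [← degree_sum_map_single, hsum]
  obtain ⟨ε, hε, h⟩ := hK.transfer_word hf hf' one hone dbar hdbar (blocks i)
    (pairwise_blocks i) (hlen ▸ hi) (fun h2 => by
      obtain ⟨a, b, hab⟩ := List.length_eq_two.1 h2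
      -- a word of two different letters belongs to an excluded monomial
      have : a = b := by
        by_contra hne'
        refine hne a b hne' ?_
        rw [← hsum, hab]
        simp
      rw [hab, this]
      simp)
  rw [hsum] at h
  rcases hε with rfl | rfl
  · exact Or.inl (h.trans (one_smul _ _))
  · exact Or.inr (h.trans (neg_one_smul _ _))

lemma IsKoszulDGA.aInfinity_one (hK : IsKoszulDGA 𝒜 σ d θ D f) :
    (hK.contraction.aInfinity hK.toIsSuperDGA).m 1 = 0 :=
  MultilinearMap.ext fun c => hK.contraction.transfer_one c

lemma IsKoszulDGA.isStrictlyUnital (hK : IsKoszulDGA 𝒜 σ d θ D f) (one : LinearMap.ker d)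
    (hone : (one : B) = 1) :
    (hK.contraction.aInfinity hK.toIsSuperDGA).IsStrictlyUnital (cohClass d one) :=
  hK.contraction.isStrictlyUnital hK.toIsSuperDGA hK.homotopy_homotopy hK.proj_homotopy
    hK.homotopy_proj hK.sigma_one one hone hK.proj_one

/-- The opposite superalgebra of the cohomology is the Clifford algebra. -/
lemma IsKoszulDGA.exists_cliffordEquiv (hK : IsKoszulDGA 𝒜 σ d θ D f)
    {Q : QuadraticForm k (Fin n → k)}
    (hQ : ∀ v, Q v = ∑ i, ∑ j, v i * v j * MvPowerSeries.constantCoeff (f i j))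
    (one : LinearMap.ker d) (hone : (one : B) = 1) (dbar : Fin n → LinearMap.ker d)
    (hdbar : ∀ i, (dbar i : B) = D i) :
    ∃ φ : CliffordAlgebra Q ≃ₗ[k] Cohomology d, φ 1 = cohClass d one ∧
      (∀ i, φ (CliffordAlgebra.ι Q (Pi.single i 1)) = cohClass d (dbar i)) ∧
      (∀ s, (CliffordAlgebra.evenOdd Q s).map (φ : _ →ₗ[k] _) = cohGrading 𝒜 d s) ∧
      (∀ s t, ∀ a ∈ CliffordAlgebra.evenOdd Q s, ∀ b ∈ CliffordAlgebra.evenOdd Q t,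
        φ (a * b) = (-1 : k) ^ (s.val * t.val) • hK.contraction.transfer σ 2 ![φ b, φ a]) := by
  refine ⟨LinearEquiv.ofBijective (hK.ofClifford hQ) (hK.ofClifford_bijective hQ), ?_, fun i => ?_,
    hK.map_evenOdd_ofClifford hQ, fun s t a ha b hb => ?_⟩
  · rw [LinearEquiv.ofBijective_apply, ofClifford_one, ← hone]
    exact hK.contraction.toCohomology_coe one
  · rw [LinearEquiv.ofBijective_apply, ofClifford_ι, Fintype.linearCombination_apply_single,
      one_smul, ← hdbar]
    exact hK.contraction.toCohomology_coe (dbar i)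
  · rw [hK.contraction.transfer_two hK.toIsSuperDGA]
    exact hK.ofClifford_mul_of_mem hQ ha hb

end KoszulDGA

/-! ### The endomorphism algebra as a Koszul complex -/

section Endomorphisms

variable {k : Type*} [Field k] {n : ℕ}

/-- The dg algebra of endomorphisms, with the cocycles `∂_i - ∑_j f_{ij} θ_j`. -/
lemma isKoszulDGA {w' : Fin n → R k n} {f : Fin n → Fin n → R k n}
    (hf : ∀ i, w' i = ∑ j, f i j * MvPowerSeries.X j) :
    IsKoszulDGA (parity (k := k) (n := n)) sgn (diff w') theta
      (fun i => del i - ∑ j, f i j • theta j) f where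
  toIsSuperDGA := isSuperDGA w'
  theta_sq := isFermionic_theta_del.theta_sq
  theta_anticomm := isFermionic_theta_del.theta_anticomm
  D_theta := isFermionic_theta_del.shift_theta f
  D_sq := isFermionic_theta_del.shift_sq f
  D_D := isFermionic_theta_del.shift_shift f
  d_theta := diff_theta w'
  d_D i := by
    rw [map_sub, map_sum, diff_del, hf, Finset.sum_smul, sub_eq_zero]
    refine Finset.sum_congr rfl fun j _ => ?_
    rw [diff_smul, diff_theta, mul_smul]
  d_smul := diff_smul w'
  theta_mem := theta_mem_parity
  D_mem i := Submodule.sub_mem _ (del_mem_parity i)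
    (Submodule.sum_mem _ fun j _ => smul_mem_parity _ (theta_mem_parity j))
  one_mem := one_mem_parity
  smul_mem _ r _ hb := smul_mem_parity r hb
  eq_zero_of_mem _ h0 h1 := eq_zero_of_mem_parity h0 h1
  adjoin_eq_top := IsFermionic.adjoin_shift f adjoin_theta_del
  finrank_eq := finrank_alg

end Endomorphisms

end MFKoszul

end

open MFKoszul in
theorem mainTheorem12 {k : Type*} [Field k] (n : ℕ) (w : MvPowerSeries (Fin n) k)
    (hw : ∀ i : Fin n →₀ ℕ, i.degree < 2 → MvPowerSeries.coeff i w = 0)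
    (w' : Fin n → MvPowerSeries (Fin n) k) (hw' : w = ∑ i, MvPowerSeries.X i * w' i) :
    ∃ (H : ContractingHomotopy (parity (k := k) (n := n)) (diff w'))
      (M : AInfinityStructure (cohGrading (parity (k := k) (n := n)) (diff w')))
      (one : LinearMap.ker (diff w')) (dbar : Fin n → LinearMap.ker (diff w')),
      -- `M` is the structure induced by `H` through the tree formula
      (∀ (N : ℕ) (c : Fin N → Cohomology (diff w')), M.m N c = H.transfer sgn N c) ∧
      -- the cocycle `1` and the cocycles `∂̄_i = ∂_i - ∑_j f_{ij} θ_j`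
      (one : Alg k n) = 1 ∧
      (∀ i, ∃ f : Fin n → MvPowerSeries (Fin n) k,
        (dbar i : Alg k n) = del i - ∑ j, f j • theta j) ∧
      -- `M` is minimal
      M.m 1 = 0 ∧
      -- the opposite superalgebra of `(H^*(A), m_2)` is the Clifford algebra of the quadratic part
      (∃ φ : CliffordAlgebra (quadraticPart w) ≃ₗ[k] Cohomology (diff w'),
        φ 1 = cohClass (diff w') one ∧
        (∀ i, φ (CliffordAlgebra.ι (quadraticPart w) (Pi.single i 1)) =
          cohClass (diff w') (dbar i)) ∧
        (∀ s, (CliffordAlgebra.evenOdd (quadraticPart w) s).map (φ : _ →ₗ[k] _) =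
          cohGrading parity (diff w') s) ∧
        (∀ s t, ∀ a ∈ CliffordAlgebra.evenOdd (quadraticPart w) s,
          ∀ b ∈ CliffordAlgebra.evenOdd (quadraticPart w) t,
          φ (a * b) = (-1 : k) ^ (s.val * t.val) • M.m 2 ![φ b, φ a])) ∧
      -- the products of the generators
      (∀ i : Fin n →₀ ℕ, 2 ≤ i.degree →
        (∀ a b : Fin n, a ≠ b → i ≠ Finsupp.single a 1 + Finsupp.single b 1) →
        M.m (blocks i).length (fun j => cohClass (diff w') (dbar ((blocks i).get j))) =
            MvPowerSeries.coeff i w • cohClass (diff w') one ∨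
          M.m (blocks i).length (fun j => cohClass (diff w') (dbar ((blocks i).get j))) =
            -(MvPowerSeries.coeff i w • cohClass (diff w') one)) ∧
      -- in one variable, `H` is the homotopy `a ω ↦ ((a - a(0)) / x) θ ω`, `M` is strictly unital
      (n = 1 →
        (∀ (j : Fin n) (c : k) (b : MvPowerSeries (Fin n) k),
          ∀ ω ∈ Algebra.adjoin k {theta (k := k) j, del j},
          H.h ((MvPowerSeries.C c + MvPowerSeries.X j * b) • ω) = b • (theta j * ω)) ∧
        M.IsStrictlyUnital (cohClass (diff w') one)) := by
  refine (exists_coefficients w hw w' hw').elim fun f hf => ?_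
  have hK := isKoszulDGA hf.1
  have hQ := quadraticPart_apply hf.2.1 hf.2.2
  refine ⟨hK.contraction, hK.contraction.aInfinity hK.toIsSuperDGA, ⟨1, hK.d_one⟩,
    fun i => ⟨del i - ∑ j, f i j • theta j, hK.d_D i⟩, ?_⟩
  have hφ := hK.exists_cliffordEquiv hQ ⟨1, hK.d_one⟩ rfl
    (fun i => ⟨del i - ∑ j, f i j • theta j, hK.d_D i⟩) fun _ => rfl
  have hm := hK.transfer_blocks hf.2.1 hf.2.2 ⟨1, hK.d_one⟩ rfl
    (fun i => ⟨del i - ∑ j, f i j • theta j, hK.d_D i⟩) fun _ => rfl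
  refine ⟨fun _ _ => rfl, rfl, fun i => ⟨f i, rfl⟩, hK.aInfinity_one, hφ, hm,
    fun hn => ⟨fun j c b ω hω => ?_, hK.isStrictlyUnital _ rfl⟩⟩
  have hj : ∀ i, i = j := fun i => Fin.ext (by omega)
  have hδθ := ((isFermionic_theta_del (k := k) (n := n)).del_theta j j).trans (if_pos rfl)
  have hD : del j - ∑ l, f j l • theta l = (del j - f j j • theta j : Alg k n) :=
    congrArg (del j - ·) (Fintype.sum_eq_single j fun i hi => absurd (hj i) hi)
  exact hK.homotopy_smul_of_forall_eq hj hδθ (isFermionic_theta_del.del_sq j) hD c b hω
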